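/- **Setting.** Identify the plane with $\mathbb R^2=\mathbb C$ and write $x\times y$ for the planar cross product. *Asteroid orbits.* For $0<\mu<1$ let the restricted planar circular three-body problem be given by the Hamiltonian $H(q,p)=\frac12|p|^2-q\times p-\frac{1-\mu}{r_1}-\frac{\mu}{r_2}$, with $r_1=|q-(-\mu,0)|$, $r_2=|q-(1-\mu,0)|$. Let $L_1=(a_1,0)$, $-\mu<a_1<1-\mu$, and $L_2=(a_2,0)$, $a_2>1-\mu$, be its Lagrangian points, i.e. $a_1,a_2$ are critical points of $\frac{x^2}2+\frac{1-\mu}{|x+\mu|}+\frac{\mu}{|x+\mu-1|}$. Let $\gamma_i=(q_i,p_i)$ ($i=1,2$) be a nonconstant periodic solution, of minimal period $T_i$, which surrounds $L_i$ in the sense that $L_i$ lies in the convex hull of the curve $q_i$; the small Lyapunov periodic orbits of $L_i$ are of this kind. The diameter of $\gamma_i$ is that of the curve $q_i$. *Sun, Jupiter and planet.* Let $k,m\ge1$ be integers, $\varepsilon=k/m$, $C>0$. Consider collision-free solutions $(q_S,q_J,q_P)(t)$, $t\in\mathbb R$, of the planar three-body problem with masses $1-\mu,\mu,\delta$ and centre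 of mass at $0$. Put $q^{(1)}=q_J-q_S$, $q^{(2)}=q_P-((1-\mu)q_S+\mu q_J)$, $r=|q^{(1)}|$, $R=\mu(1-\mu)\dot r$, $\alpha=\mu(1-\mu)$, and let $\theta_1$ be the polar angle of $q^{(1)}$. Assume that for some $T>0$ the motion is periodic of period $T$ up to a rotation: there is $\psi$ such that $q_\bullet(t+T)=e^{i\psi}q_\bullet(t)$ for $\bullet=S,J,P$ and all $t$; that $|r-1|\le C\sqrt\delta$ and $|R|\le C\sqrt\delta$ for all times; that the total angular momentum differs from $\alpha$ by at most $C\delta$; that $|T-2\pi m|\le C$; and that the osculating Kepler elements of $(q^{(2)},\dot q_P)$ at time $0$, for the Kepler Hamiltonian $\frac12|v|^2-1/|q|$, satisfy $|L_P-\varepsilon^{-1/3}|\le C$ ($L_P^2$ is the semimajor axis), $G_P>0$ ($G_P$ is the angular momentum), and have eccentricity $e_P$. *The perturbation.* In the frame rotated by $\theta_1(t)$, in which $q^{(1)}$ points along the positive $x$-axis, let the positions of the three bodies at time $t=\nu/\varepsilon$ be denoted by $q_S(\nu),q_J(\nu),q_P(\nu)$, and let $$f(q,p,\nu)=-(\dot\theta_1-1)\,q\times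 p+(1-\mu)\Big(\frac1{r_1}-\frac1{|q-q_S(\nu)|}\Big)+\mu\Big(\frac1{r_2}-\frac1{|q-q_J(\nu)|}\Big)-\frac{\delta}{|q-q_P(\nu)|},$$ $$\bar f_i(\nu)=\frac1{T_i}\int_0^{T_i}f(q_i(t),p_i(t),\nu)\,dt ,\qquad i=1,2 .$$ **Lemma.** There are $\mu_0,\kappa>0$ such that for all $0<\mu<\mu_0$ and all orbits $\gamma_1,\gamma_2$ as above of diameter less than $\kappa\mu^{1/3}$ there is a vector $u\ne0$ with the following property. For all $k\ge1$, $C>0$, $e_0>0$ and $\eta>0$ there is $\varepsilon_0>0$ such that for every $m\ge 1$ with $\varepsilon=k/m<\varepsilon_0$, every $0<\delta\le C\varepsilon^3$, every $e_P\in[e_0,1/2)$ and every motion of Sun, Jupiter and planet as above, 1. $\bar f_1(\nu)-\bar f_2(\nu)$ is not constant in $\nu\in\mathbb R$; 2. $\big|\bar f_1(\nu)-\bar f_2(\nu)-\delta\langle u,q_P(\nu)\rangle\big|\le\eta\,\delta\,|q_P(\nu)|$ for all $\nu\in\mathbb R$. -/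

import Mathlib

noncomputable section

namespace FourBody

/-! The plane is identified with `ℂ`; `Complex.I * z` is `z` turned by a right angle. -/

/-- The planar cross product `z × w`. -/
def cross (z w : ℂ) : ℝ := z.re * w.im - z.im * w.re

/-- The vector `z / |z|³` of the inverse square law. -/
def invSq (z : ℂ) : ℂ := z / ((‖z‖ ^ 3 : ℝ) : ℂ)

/-! ### The restricted planar circular three-body problem (Sun, Jupiter, asteroid) -/

/-- The effective potential restricted to the axis through the primaries, the Sun (mass `1 - μ`)
being at `-μ` and Jupiter (mass `μ`) at `1 - μ`. -/
def axisPotential (μ x : ℝ) : ℝ := x ^ 2 / 2 + (1 - μ) / |x + μ| + μ / |x + μ - 1|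

/-- `a` is the abscissa of the Lagrangian point `L₁`, which lies between Sun and Jupiter. -/
def IsL1 (μ a : ℝ) : Prop := -μ < a ∧ a < 1 - μ ∧ HasDerivAt (axisPotential μ) 0 a

/-- `a` is the abscissa of the Lagrangian point `L₂`, which lies beyond Jupiter. -/
def IsL2 (μ a : ℝ) : Prop := 1 - μ < a ∧ HasDerivAt (axisPotential μ) 0 a

/-- `(q, p)` is a nonconstant periodic solution, of minimal period `T`, of Hamilton's equations of
`H(q, p) = |p|² / 2 - q × p - (1 - μ) / |q - (-μ, 0)| - μ / |q - (1 - μ, 0)|`, the Hamiltonian of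
the restricted planar circular three-body problem in rotating coordinates. -/
structure IsPeriodicOrbit (μ : ℝ) (q p : ℝ → ℂ) (T : ℝ) : Prop where
  period_pos : 0 < T
  periodic_q : Function.Periodic q T
  periodic_p : Function.Periodic p T
  minimal : ∀ S : ℝ, 0 < S → S < T → ¬ (Function.Periodic q S ∧ Function.Periodic p S)
  ne_sun : ∀ t, q t ≠ ((-μ : ℝ) : ℂ)
  ne_jupiter : ∀ t, q t ≠ ((1 - μ : ℝ) : ℂ)
  deriv_q : ∀ t, HasDerivAt q (p t - Complex.I * q t) t
  deriv_p : ∀ t, HasDerivAt p (-(Complex.I * p t)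
    - ((1 - μ : ℝ) : ℂ) * invSq (q t - ((-μ : ℝ) : ℂ))
    - (μ : ℂ) * invSq (q t - ((1 - μ : ℝ) : ℂ))) t

/-- A periodic orbit surrounding the collinear equilibrium with abscissa `a`: the equilibrium lies
in the convex hull of the projection of the orbit to the configuration plane. The members of the
Lyapunov family of that equilibrium close to it are such orbits. -/
structure IsLyapunovOrbit (μ a : ℝ) (q p : ℝ → ℂ) (T : ℝ) : Prop
    extends IsPeriodicOrbit μ q p T where
  surrounds : (a : ℂ) ∈ convexHull ℝ (Set.range q)

/-! ### The three-body problem Sun, Jupiter, planet -/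

/-- Positions and velocities of Sun, Jupiter and planet in an inertial frame. -/
structure Motion where
  qS : ℝ → ℂ
  qJ : ℝ → ℂ
  qP : ℝ → ℂ
  vS : ℝ → ℂ
  vJ : ℝ → ℂ
  vP : ℝ → ℂ

/-- `M` is a collision-free solution of the planar three-body problem with masses `1 - μ` (Sun),
`μ` (Jupiter) and `δ` (planet), with the centre of mass at the origin. -/
structure IsThreeBodySolution (μ δ : ℝ) (M : Motion) : Prop where
  ne_SJ : ∀ t, M.qS t ≠ M.qJ t
  ne_SP : ∀ t, M.qS t ≠ M.qP t
  ne_JP : ∀ t, M.qJ t ≠ M.qP t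
  deriv_qS : ∀ t, HasDerivAt M.qS (M.vS t) t
  deriv_qJ : ∀ t, HasDerivAt M.qJ (M.vJ t) t
  deriv_qP : ∀ t, HasDerivAt M.qP (M.vP t) t
  deriv_vS : ∀ t, HasDerivAt M.vS
    ((μ : ℂ) * invSq (M.qJ t - M.qS t) + (δ : ℂ) * invSq (M.qP t - M.qS t)) t
  deriv_vJ : ∀ t, HasDerivAt M.vJ
    (((1 - μ : ℝ) : ℂ) * invSq (M.qS t - M.qJ t) + (δ : ℂ) * invSq (M.qP t - M.qJ t)) t
  deriv_vP : ∀ t, HasDerivAt M.vP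
    (((1 - μ : ℝ) : ℂ) * invSq (M.qS t - M.qP t) + (μ : ℂ) * invSq (M.qJ t - M.qP t)) t
  center : ∀ t, ((1 - μ : ℝ) : ℂ) * M.qS t + (μ : ℂ) * M.qJ t + (δ : ℂ) * M.qP t = 0

namespace Motion

/-- The Jacobi vector from the Sun to Jupiter. -/
def q1 (M : Motion) (t : ℝ) : ℂ := M.qJ t - M.qS t

/-- The velocity of the Jacobi vector `q1`. -/
def v1 (M : Motion) (t : ℝ) : ℂ := M.vJ t - M.vS t

/-- The Jacobi vector from the centre of mass of Sun and Jupiter to the planet. -/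
def q2 (M : Motion) (μ t : ℝ) : ℂ :=
  M.qP t - (((1 - μ : ℝ) : ℂ) * M.qS t + (μ : ℂ) * M.qJ t)

/-- The Sun-Jupiter distance `r`. -/
def r (M : Motion) (t : ℝ) : ℝ := ‖M.q1 t‖

/-- The radial momentum `R = μ(1 - μ) dr/dt` of the pair Sun-Jupiter. -/
def radialMomentum (M : Motion) (μ t : ℝ) : ℝ :=
  μ * (1 - μ) * (inner ℝ (M.q1 t) (M.v1 t) / ‖M.q1 t‖)

/-- The total angular momentum. -/
def angularMomentum (M : Motion) (μ δ t : ℝ) : ℝ :=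
  (1 - μ) * cross (M.qS t) (M.vS t) + μ * cross (M.qJ t) (M.vJ t)
    + δ * cross (M.qP t) (M.vP t)

/-- The derivative `dθ₁/dt - 1`, where `θ₁` is the polar angle of `q1`. -/
def thetaDot (M : Motion) (t : ℝ) : ℝ := cross (M.q1 t) (M.v1 t) / ‖M.q1 t‖ ^ 2 - 1

/-- The coordinates of `z` in the frame rotated by the polar angle of `q1`, in which the vector
from the Sun to Jupiter points in the direction of the positive horizontal axis. -/
def toRotating (M : Motion) (t : ℝ) (z : ℂ) : ℂ :=
  (starRingEnd ℂ) (M.q1 t / (‖M.q1 t‖ : ℂ)) * z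

end Motion

/-! ### Osculating Kepler elements, for the Kepler Hamiltonian `|v|² / 2 - 1 / |q|` -/

/-- The Kepler energy. -/
def keplerEnergy (q v : ℂ) : ℝ := ‖v‖ ^ 2 / 2 - 1 / ‖q‖

/-- The Delaunay action `L` (`L²` is the semimajor axis, the energy is `-1 / (2 L²)`). -/
def delaunayL (q v : ℂ) : ℝ := 1 / Real.sqrt (-2 * keplerEnergy q v)

/-- The Delaunay action `G`, the angular momentum. -/
def delaunayG (q v : ℂ) : ℝ := cross q v

/-- The eccentricity. -/
def eccentricity (q v : ℂ) : ℝ := Real.sqrt (1 - (delaunayG q v / delaunayL q v) ^ 2)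

/-- The background motions of Sun, Jupiter and planet. They are periodic, of period `T`, modulo
rotations (so quasi-periodic in the inertial frame). Put `ε = k / m`. Sun and Jupiter are nearly
circular: in the scaled variables `r = 1 + √δ r'`, `R = √δ R'` the pair `(r', R')` is bounded by
`C`, and the total angular momentum is `μ(1 - μ) + c δ` with `|c| ≤ C`. The planet is on a nearly
Keplerian prograde orbit, with initial eccentricity `eP`, in `k : m` resonance with the pair
Sun-Jupiter: `T` is `2πm` and its `L` is initially `ε^(-1/3)`, up to errors bounded by `C`. The
planet is described by `q2` and the scaled momentum `v2 = p2 / δ`, the barycentric velocity of the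
planet. -/
structure IsBackgroundMotion (μ δ : ℝ) (k m : ℕ) (C eP T : ℝ) (M : Motion) : Prop
    extends IsThreeBodySolution μ δ M where
  period_pos : 0 < T
  relPeriodic : ∃ ψ : ℝ, ∀ t,
    M.qS (t + T) = Complex.exp (ψ * Complex.I) * M.qS t ∧
    M.qJ (t + T) = Complex.exp (ψ * Complex.I) * M.qJ t ∧
    M.qP (t + T) = Complex.exp (ψ * Complex.I) * M.qP t
  r_near : ∀ t, |M.r t - 1| ≤ C * Real.sqrt δ
  R_near : ∀ t, |M.radialMomentum μ t| ≤ C * Real.sqrt δ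
  angularMomentum_near : ∀ t, |M.angularMomentum μ δ t - μ * (1 - μ)| ≤ C * δ
  period_near : |T - 2 * Real.pi * m| ≤ C
  L_near : |delaunayL (M.q2 μ 0) (M.vP 0) - ((k : ℝ) / m) ^ (-(1 / 3) : ℝ)| ≤ C
  G_pos : 0 < delaunayG (M.q2 μ 0) (M.vP 0)
  ecc_eq : eccentricity (M.q2 μ 0) (M.vP 0) = eP

/-! ### The perturbation and its averages -/

/-- The perturbation `f(q, p, ν)` by which the Hamiltonian of the asteroid in the rotating frame
differs from that of the restricted three-body problem; the background motion is frozen at the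
time `t` with `ν = ε t`. -/
def perturbation (μ δ ε : ℝ) (M : Motion) (q p : ℂ) (ν : ℝ) : ℝ :=
  -M.thetaDot (ν / ε) * cross q p
    + (1 - μ) * (1 / ‖q - ((-μ : ℝ) : ℂ)‖ - 1 / ‖q - M.toRotating (ν / ε) (M.qS (ν / ε))‖)
    + μ * (1 / ‖q - ((1 - μ : ℝ) : ℂ)‖ - 1 / ‖q - M.toRotating (ν / ε) (M.qJ (ν / ε))‖)
    - δ / ‖q - M.toRotating (ν / ε) (M.qP (ν / ε))‖

/-- The average over one period of `f(·, ν)` along the curve `(q, p)`, for fixed `ν`. -/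
def average (μ δ ε : ℝ) (M : Motion) (q p : ℝ → ℂ) (T ν : ℝ) : ℝ :=
  (1 / T) * ∫ t in (0 : ℝ)..T, perturbation μ δ ε M (q t) (p t) ν

end FourBody

end

/-! The vector is `u = c₁ - c₂`, where `cᵢ` is the time average of `qᵢ` (`meanPos`). Hamilton's
equations give `d/dt (p + i q) = q - F(q)`, with `F` the force `primaryForce`, so over a period the
mean of `F` is the mean of `q` (`integral_primaryForce`). In the rotating frame Sun and Jupiter
leave their circular positions by the common shift `-δ q_P`, forced by the centre of mass, and by
multiples of `r - 1`. To first order the average of `f` is therefore `-δ/|q_P| + δ⟨q_P, cᵢ⟩`, with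
an error of order `|θ₁' - 1| + |r - 1| + (|r - 1| + δ|q_P|)² + δ` (`exists_average_estimate`). The
term `-δ/|q_P|` drops out of the difference.

Write `ε = h³`. Then `|q_P|` is of order `h⁻²`, and the hypothesis `|r - 1| ≤ C√δ` is far too weak
to make the error small against `δ|q_P|`. The heart of the proof is the improvement of `r - 1` and
`θ₁' - 1` to `O(δ/h)` (`exists_background_estimates`). It compares two eccentricity
(Laplace-Runge-Lenz) vectors, each of which is multiplied over one period `T` by the same unit
number `ω`, the rotation in the definition of relative periodicity.

For the planet, the quadrupole of the nearly circular pair Sun-Jupiter advances the apsidal line at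
a rate of order `h⁷`. Since `T` is of order `h⁻³` and the eccentricity is at least `e₀`, this forces
`|ω - 1| ≥ β h⁴` (`exists_rotation_lower_bound`). The rate is isolated by subtracting explicit
primitives of the two oscillating parts of the force, one at the planet's frequency and one at twice
Jupiter's (`exists_deriv_lrlCorrected`).

For Jupiter, the tide of the planet is `O(δ h⁶)`, so the eccentricity vector `A` changes by `O(δ
h³)` in one period, while this change is `(ω - 1) A`. Hence `A = O(δ/h)` (`norm_lrl_q1_le`). Since
the angular momentum of the pair is also known up to `O(δ/h)`, the equation of the conic gives the
improved bounds (`circular_defects`).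

Finally `u ≠ 0`: `cᵢ` is within one diameter of `Lᵢ`, and the distance from `L₁` to `L₂` exceeds
`(μ/3)^(1/3)` (`meanPos_sub_ne_zero`). In the rotating frame the slow planet turns almost uniformly
backwards, so `⟨u, q_P⟩` takes large values of both signs (`exists_direction`), and the difference
of averages cannot be constant. -/

namespace FourBody

open ComplexConjugate

/-! ### Multipole expansion of the inverse square law -/

/-- The linear part of `z ↦ invSq (X + z)`. -/
noncomputable def invSqLin (X z : ℂ) : ℂ :=
  -(((‖X‖⁻¹ ^ 3 : ℝ) : ℂ) * (z / 2)) - 3 / 2 * ((‖X‖⁻¹ ^ 5 : ℝ) : ℂ) * (X ^ 2 * conj z)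

/-- The part of the quadratic term of `z ↦ invSq (X + z)` that depends on `s = z ^ 2` only. -/
noncomputable def invSqQuad (X s : ℂ) : ℂ :=
  ((‖X‖⁻¹ ^ 7 : ℝ) : ℂ) * (3 / 8 * s * (X * conj X ^ 2) + 15 / 8 * conj s * X ^ 3)

/-- The rotation invariant part of the quadratic term of `z ↦ invSq (X + z)`, for `|z| = 1`. -/
noncomputable def invSqMean (X : ℂ) : ℂ := 3 / 4 * ((‖X‖⁻¹ ^ 5 : ℝ) : ℂ) * X

/-- The subtracted polynomial is the Taylor polynomial of `(1 + x)^(-3/2)` in `x = s² - 1`; this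
variable is used because `‖1 + w‖²` is a polynomial in `w` and `conj w`. The remainder has the exact
factor `(1 - s)³`. -/
theorem abs_inv_cube_sub_le {s : ℝ} (h1 : 1 / 2 ≤ s) (h2 : s ≤ 3 / 2) :
    |s⁻¹ ^ 3 - (1 - 3 / 2 * (s ^ 2 - 1) + 15 / 8 * (s ^ 2 - 1) ^ 2)| ≤ 380 * |s - 1| ^ 3 := by
  have hs : 0 < s := by linarith
  have e : s⁻¹ ^ 3 - (1 - 3 / 2 * (s ^ 2 - 1) + 15 / 8 * (s ^ 2 - 1) ^ 2)
      = (s⁻¹ ^ 3 * ((8 + 24 * s + 48 * s ^ 2 + 45 * s ^ 3 + 15 * s ^ 4) / 8)) * (1 - s) ^ 3 := by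
    field_simp
    ring
  rw [e, abs_mul, abs_pow, abs_sub_comm 1 s]
  gcongr
  have h3 : s⁻¹ ≤ 2 := by
    rw [inv_le_comm₀ hs (by norm_num)]; linarith
  have h4 : s⁻¹ ^ 3 ≤ 2 ^ 3 := by gcongr
  have h5 : (8 + 24 * s + 48 * s ^ 2 + 45 * s ^ 3 + 15 * s ^ 4) / 8
      ≤ (8 + 24 * (3 / 2) + 48 * (3 / 2) ^ 2 + 45 * (3 / 2) ^ 3 + 15 * (3 / 2) ^ 4) / 8 := by
    gcongr
  rw [abs_of_pos (by positivity)]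
  calc _ ≤ (2 : ℝ) ^ 3 * ((8 + 24 * (3 / 2) + 48 * (3 / 2) ^ 2 + 45 * (3 / 2) ^ 3
        + 15 * (3 / 2) ^ 4) / 8) := by gcongr
    _ ≤ 380 := by norm_num

/-- Insert `‖1 + w‖² - 1 = w + conj w + w * conj w` in the Taylor polynomial, multiply by `1 + w`,
and discard the terms of degree at least three. -/
theorem norm_one_add_div_sub_le {w : ℂ} (hw : ‖w‖ ≤ 1 / 2) :
    ‖(1 + w) * ((‖1 + w‖⁻¹ ^ 3 : ℝ) : ℂ) - (1 - w / 2 - 3 / 2 * conj w + 3 / 8 * w ^ 2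
      + 3 / 4 * (w * conj w) + 15 / 8 * conj w ^ 2)‖ ≤ 600 * ‖w‖ ^ 3 := by
  set s := ‖1 + w‖ with hs
  have hs1 : |s - 1| ≤ ‖w‖ := by
    have := abs_norm_sub_norm_le (1 + w) 1
    simpa using this
  have hs2 := abs_le.1 (hs1.trans hw)
  have h1 := abs_inv_cube_sub_le (s := s) (by linarith) (by linarith)
  have hn : ((s ^ 2 : ℝ) : ℂ) = (1 + w) * (1 + conj w) := by
    rw [hs, ← Complex.normSq_eq_norm_sq, ← Complex.mul_conj]; simp
  set P : ℝ := 1 - 3 / 2 * (s ^ 2 - 1) + 15 / 8 * (s ^ 2 - 1) ^ 2 with hP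
  have e : (1 + w) * ((s⁻¹ ^ 3 : ℝ) : ℂ) - (1 - w / 2 - 3 / 2 * conj w + 3 / 8 * w ^ 2
      + 3 / 4 * (w * conj w) + 15 / 8 * conj w ^ 2)
      = (1 + w) * ((s⁻¹ ^ 3 - P : ℝ) : ℂ) + (15 / 8 * w ^ 3 + 6 * w ^ 2 * conj w
        + 45 / 8 * w * conj w ^ 2 + 15 / 4 * w ^ 3 * conj w + 45 / 8 * w ^ 2 * conj w ^ 2
        + 15 / 8 * w ^ 3 * conj w ^ 2) := by
    have : ((P : ℝ) : ℂ) = 1 - 3 / 2 * ((1 + w) * (1 + conj w) - 1)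
        + 15 / 8 * ((1 + w) * (1 + conj w) - 1) ^ 2 := by
      rw [hP, ← hn]; push_cast; ring
    rw [Complex.ofReal_sub, this]
    ring
  rw [e]
  have hw0 := norm_nonneg w
  have b1 : ‖(1 + w) * ((s⁻¹ ^ 3 - P : ℝ) : ℂ)‖ ≤ 3 / 2 * (380 * ‖w‖ ^ 3) := by
    rw [norm_mul, Complex.norm_real, Real.norm_eq_abs, ← hs]
    have : |s - 1| ^ 3 ≤ ‖w‖ ^ 3 := by gcongr
    have : s ≤ 3 / 2 := by linarith
    gcongr
    linarith
  have b2 : ‖15 / 8 * w ^ 3 + 6 * w ^ 2 * conj w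
        + 45 / 8 * w * conj w ^ 2 + 15 / 4 * w ^ 3 * conj w + 45 / 8 * w ^ 2 * conj w ^ 2
        + 15 / 8 * w ^ 3 * conj w ^ 2‖ ≤ 15 / 8 * ‖w‖ ^ 3 + 6 * ‖w‖ ^ 2 * ‖w‖
        + 45 / 8 * ‖w‖ * ‖w‖ ^ 2 + 15 / 4 * ‖w‖ ^ 3 * ‖w‖ + 45 / 8 * ‖w‖ ^ 2 * ‖w‖ ^ 2
        + 15 / 8 * ‖w‖ ^ 3 * ‖w‖ ^ 2 := by
    refine (norm_add_le _ _).trans (add_le_add ((norm_add_le _ _).trans (add_le_add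
      ((norm_add_le _ _).trans (add_le_add ((norm_add_le _ _).trans (add_le_add
      ((norm_add_le _ _).trans (add_le_add ?_ ?_)) ?_)) ?_)) ?_)) ?_) <;>
    simp
  have c1 : ‖w‖ ^ 3 * ‖w‖ ≤ ‖w‖ ^ 3 * (1 / 2) := by gcongr
  have c2 : ‖w‖ ^ 3 * ‖w‖ ^ 2 ≤ ‖w‖ ^ 3 * (1 / 2) ^ 2 := by gcongr
  refine (norm_add_le _ _).trans ?_
  nlinarith [pow_nonneg hw0 3]

/-- By homogeneity it is enough to expand at `1`, with `z = X * w`. The quadratic term is split into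
a part in `z²` and its conjugate, which oscillates when `z` runs around a circle, and a part in
`|z|²`, which survives averaging. -/
theorem norm_invSq_add_sub_le {X z : ℂ} (hX : X ≠ 0) (hz : ‖z‖ ≤ ‖X‖ / 2) :
    ‖invSq (X + z) - (invSq X + invSqLin X z + invSqQuad X (z ^ 2)
      + ((‖z‖ ^ 2 : ℝ) : ℂ) * invSqMean X)‖ ≤ 600 * (‖X‖⁻¹ ^ 5 * ‖z‖ ^ 3) := by
  obtain ⟨w, rfl⟩ : ∃ w, z = X * w := ⟨z / X, by field_simp⟩
  have hX0 : 0 < ‖X‖ := norm_pos_iff.2 hX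
  have hw : ‖w‖ ≤ 1 / 2 := by
    rw [norm_mul] at hz
    by_contra! h
    nlinarith
  have hXX : X * conj X = ((‖X‖ : ℝ) : ℂ) ^ 2 := by
    rw [Complex.mul_conj, Complex.normSq_eq_norm_sq]; push_cast; rfl
  have hww : ((‖w‖ : ℝ) : ℂ) ^ 2 = w * conj w := by
    rw [Complex.mul_conj, Complex.normSq_eq_norm_sq]; push_cast; rfl
  have hXc : ((‖X‖ : ℝ) : ℂ) ≠ 0 := by exact_mod_cast hX0.ne'
  have e : invSq (X + X * w) - (invSq X + invSqLin X (X * w) + invSqQuad X ((X * w) ^ 2)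
      + ((‖X * w‖ ^ 2 : ℝ) : ℂ) * invSqMean X)
      = X * ((‖X‖⁻¹ ^ 3 : ℝ) : ℂ) * ((1 + w) * ((‖1 + w‖⁻¹ ^ 3 : ℝ) : ℂ)
      - (1 - w / 2 - 3 / 2 * conj w + 3 / 8 * w ^ 2
      + 3 / 4 * (w * conj w) + 15 / 8 * conj w ^ 2)) := by
    have e1 : X + X * w = X * (1 + w) := by ring
    have i3 : ((‖X‖ : ℝ) : ℂ)⁻¹ ^ 5 * (X * conj X) = ((‖X‖ : ℝ) : ℂ)⁻¹ ^ 3 := by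
      rw [hXX]; field_simp
    have i4 : ((‖X‖ : ℝ) : ℂ)⁻¹ ^ 7 * (X * conj X) ^ 2 = ((‖X‖ : ℝ) : ℂ)⁻¹ ^ 3 := by
      rw [hXX]; field_simp
    have i5 : ((‖X‖ : ℝ) : ℂ)⁻¹ ^ 5 * ((‖X‖ : ℝ) : ℂ) ^ 2 = ((‖X‖ : ℝ) : ℂ)⁻¹ ^ 3 := by
      field_simp
    rw [e1]
    simp only [invSq, invSqLin, invSqQuad, invSqMean, norm_mul, map_mul, map_pow]
    push_cast
    rw [mul_pow ((‖X‖ : ℝ) : ℂ), mul_pow ((‖X‖ : ℝ) : ℂ), hww]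
    have d1 : X * (1 + w) / (((‖X‖ : ℝ) : ℂ) ^ 3 * ((‖1 + w‖ : ℝ) : ℂ) ^ 3)
      = X * ((‖X‖ : ℝ) : ℂ)⁻¹ ^ 3 * ((1 + w) * ((‖1 + w‖ : ℝ) : ℂ)⁻¹ ^ 3) := by
      rw [div_eq_mul_inv, mul_inv, inv_pow, inv_pow]; ring
    rw [d1, div_eq_mul_inv X, ← inv_pow]
    linear_combination (3 / 2 * X * conj w) * i3
      - (3 / 8 * X * w ^ 2 + 15 / 8 * X * conj w ^ 2) * i4 - 3 / 4 * X * w * conj w * i5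
  rw [e, norm_mul]
  have := norm_one_add_div_sub_le hw
  have h2 : ‖X * ((‖X‖⁻¹ ^ 3 : ℝ) : ℂ)‖ * (600 * ‖w‖ ^ 3)
      = 600 * (‖X‖⁻¹ ^ 5 * ‖X * w‖ ^ 3) := by
    rw [norm_mul, norm_mul, Complex.norm_real, Real.norm_of_nonneg (by positivity)]
    field_simp
  rw [← h2]
  gcongr

/-- The attraction by two bodies of masses `1 - μ` and `μ` at `-μ z` and `(1 - μ) z`. -/
noncomputable def binaryForce (μ : ℝ) (X z : ℂ) : ℂ :=
  ((1 - μ : ℝ) : ℂ) * invSq (X + μ * z) + (μ : ℂ) * invSq (X - ((1 - μ : ℝ) : ℂ) * z)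

/-- The linear terms of the two bodies cancel because `X` is measured from their centre of mass, and
the quadratic ones add up with weight `(1 - μ)μ² + μ(1 - μ)² = μ(1 - μ)`. -/
theorem norm_binaryForce_sub_le {μ : ℝ} (h0 : 0 < μ) (h1 : μ < 1) {X z : ℂ} (hX : X ≠ 0)
    (hz : ‖z‖ ≤ ‖X‖ / 2) :
    ‖binaryForce μ X z - invSq X - ((μ * (1 - μ) : ℝ) : ℂ) *
      (invSqQuad X (z ^ 2) + ((‖z‖ ^ 2 : ℝ) : ℂ) * invSqMean X)‖
      ≤ 600 * (‖X‖⁻¹ ^ 5 * ‖z‖ ^ 3) := by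
  have n1 : ‖(μ : ℂ) * z‖ = μ * ‖z‖ := by simp [abs_of_pos h0]
  have n2 : ‖-(((1 - μ : ℝ) : ℂ) * z)‖ = (1 - μ) * ‖z‖ := by
    rw [norm_neg, norm_mul, Complex.norm_real, Real.norm_of_nonneg (by linarith)]
  have hz0 := norm_nonneg z
  have a1 := norm_invSq_add_sub_le (z := (μ : ℂ) * z) hX (by rw [n1]; nlinarith)
  have a2 := norm_invSq_add_sub_le (z := -(((1 - μ : ℝ) : ℂ) * z)) hX (by rw [n2]; nlinarith)
  rw [n1] at a1
  rw [n2] at a2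
  have e : binaryForce μ X z - invSq X - ((μ * (1 - μ) : ℝ) : ℂ) *
      (invSqQuad X (z ^ 2) + ((‖z‖ ^ 2 : ℝ) : ℂ) * invSqMean X)
      = ((1 - μ : ℝ) : ℂ) * (invSq (X + μ * z) - (invSq X + invSqLin X (μ * z)
        + invSqQuad X ((μ * z) ^ 2) + (((μ * ‖z‖) ^ 2 : ℝ) : ℂ) * invSqMean X))
      + (μ : ℂ) * (invSq (X + -(((1 - μ : ℝ) : ℂ) * z)) - (invSq X
        + invSqLin X (-(((1 - μ : ℝ) : ℂ) * z))
        + invSqQuad X ((-(((1 - μ : ℝ) : ℂ) * z)) ^ 2)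
        + ((((1 - μ) * ‖z‖) ^ 2 : ℝ) : ℂ) * invSqMean X)) := by
    simp only [binaryForce, invSqLin, invSqQuad, map_mul, map_pow, map_neg, Complex.conj_ofReal]
    push_cast
    ring_nf
  rw [e]
  refine (norm_add_le _ _).trans ?_
  rw [norm_mul, norm_mul, Complex.norm_real, Complex.norm_real,
    Real.norm_of_nonneg (by linarith : 0 ≤ 1 - μ), Real.norm_of_nonneg h0.le]
  have c1 : (μ * ‖z‖) ^ 3 ≤ ‖z‖ ^ 3 := by
    gcongr; nlinarith
  have c2 : ((1 - μ) * ‖z‖) ^ 3 ≤ ‖z‖ ^ 3 := by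
    have : 0 ≤ 1 - μ := by linarith
    gcongr; nlinarith
  have c3 : ‖X‖⁻¹ ^ 5 * (μ * ‖z‖) ^ 3 ≤ ‖X‖⁻¹ ^ 5 * ‖z‖ ^ 3 := by gcongr
  have c4 : ‖X‖⁻¹ ^ 5 * ((1 - μ) * ‖z‖) ^ 3 ≤ ‖X‖⁻¹ ^ 5 * ‖z‖ ^ 3 := by gcongr
  have := mul_le_mul_of_nonneg_left (a1.trans (mul_le_mul_of_nonneg_left c3 (by norm_num)))
    (by linarith : 0 ≤ 1 - μ)
  have := mul_le_mul_of_nonneg_left (a2.trans (mul_le_mul_of_nonneg_left c4 (by norm_num))) h0.le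
  linarith


/-! ### The perturbed Kepler problem -/

/-- The Laplace-Runge-Lenz (eccentricity) vector of the Kepler Hamiltonian `|Y|² / 2 - 1 / |X|`. -/
noncomputable def lrl (X Y : ℂ) : ℂ := -(Complex.I * (cross X Y : ℂ) * Y) - X / (‖X‖ : ℂ)

theorem cross_eq_im (X Y : ℂ) : cross X Y = (conj X * Y).im := by
  simp [cross]; ring

theorem inner_eq_re (X Y : ℂ) : inner ℝ X Y = (conj X * Y).re := by
  rw [Complex.inner, mul_comm]

theorem abs_cross_le (X Y : ℂ) : |cross X Y| ≤ ‖X‖ * ‖Y‖ := by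
  rw [cross_eq_im]
  refine (Complex.abs_im_le_norm _).trans ?_
  simp

theorem cross_mul_mul {u : ℂ} (hu : ‖u‖ = 1) (X Y : ℂ) : cross (u * X) (u * Y) = cross X Y := by
  have : conj u * u = 1 := by
    rw [mul_comm, Complex.mul_conj, Complex.normSq_eq_norm_sq, hu]; simp
  rw [cross_eq_im, cross_eq_im, map_mul]
  congr 1
  linear_combination (conj X * Y) * this

theorem lrl_mul_mul {u : ℂ} (hu : ‖u‖ = 1) (X Y : ℂ) : lrl (u * X) (u * Y) = u * lrl X Y := by
  simp only [lrl, cross_mul_mul hu, norm_mul, hu, one_mul]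
  ring

theorem conj_mul_eq (X Y : ℂ) :
    conj X * Y = ((inner ℝ X Y : ℝ) : ℂ) + (cross X Y : ℂ) * Complex.I := by
  rw [cross_eq_im, inner_eq_re, Complex.re_add_im]

theorem mul_conj_self (X : ℂ) : X * conj X = (‖X‖ : ℂ) ^ 2 := by
  rw [Complex.mul_conj, Complex.normSq_eq_norm_sq]; push_cast; rfl

/-- The polar equation of the osculating conic. It is how bounds on the elements become bounds on
distances, for the planet and for Jupiter alike. -/
theorem norm_add_inner_lrl {X : ℂ} (hX : X ≠ 0) (Y : ℂ) :
    ‖X‖ + inner ℝ X (lrl X Y) = cross X Y ^ 2 := by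
  have h0 : ((‖X‖ : ℝ) : ℂ) ≠ 0 := by simpa using hX
  have e : conj X * lrl X Y
      = -(Complex.I * (cross X Y : ℂ) * ((inner ℝ X Y : ℝ) + (cross X Y : ℂ) * Complex.I))
        - (‖X‖ : ℂ) := by
    rw [← conj_mul_eq, lrl]
    field_simp
    linear_combination -(mul_conj_self X)
  have e2 : conj X * lrl X Y = ((cross X Y ^ 2 - ‖X‖ : ℝ) : ℂ)
      + ((-(cross X Y * inner ℝ X Y) : ℝ) : ℂ) * Complex.I := by
    rw [e]; push_cast; linear_combination -((cross X Y : ℂ) ^ 2) * Complex.I_sq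
  rw [inner_eq_re, e2, Complex.add_re, Complex.re_ofReal_mul, Complex.ofReal_re, Complex.I_re]
  ring

/-- The relation `e² = 1 + 2 E g²` between eccentricity, energy and angular momentum. -/
theorem norm_lrl_sq {X : ℂ} (hX : X ≠ 0) (Y : ℂ) :
    ‖lrl X Y‖ ^ 2 = 1 + cross X Y ^ 2 * (‖Y‖ ^ 2 - 2 / ‖X‖) := by
  have h0 : ((‖X‖ : ℝ) : ℂ) ≠ 0 := by simpa using hX
  have hI : conj Complex.I = -Complex.I := Complex.conj_I
  have e1 := conj_mul_eq X Y
  have e2 : X * conj Y = ((inner ℝ X Y : ℝ) : ℂ) - (cross X Y : ℂ) * Complex.I := by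
    have := congrArg conj e1
    simpa [sub_eq_add_neg] using this
  have : (((‖lrl X Y‖ ^ 2 : ℝ)) : ℂ)
      = ((1 + cross X Y ^ 2 * (‖Y‖ ^ 2 - 2 / ‖X‖) : ℝ) : ℂ) := by
    push_cast
    rw [← mul_conj_self (lrl X Y), lrl]
    simp only [map_sub, map_neg, map_mul, map_div₀, Complex.conj_ofReal, hI]
    field_simp
    linear_combination (-(cross X Y : ℂ) ^ 2 * (‖X‖ : ℂ) ^ 2 * Y * conj Y) * Complex.I_sq
      + ((cross X Y : ℂ) ^ 2 * (‖X‖ : ℂ) ^ 2) * mul_conj_self Y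
      + mul_conj_self X + Complex.I * (cross X Y : ℂ) * (‖X‖ : ℂ) * (e1 - e2)
      + 2 * ((cross X Y : ℂ) ^ 2 * (‖X‖ : ℂ)) * Complex.I_sq
  exact_mod_cast this

theorem hasDerivAt_conj {f : ℝ → ℂ} {f' : ℂ} {t : ℝ} (h : HasDerivAt f f' t) :
    HasDerivAt (fun s => conj (f s)) (conj f') t :=
  (Complex.conjCLE.toContinuousLinearMap.hasFDerivAt (x := f t)).comp_hasDerivAt t h

theorem hasDerivAt_im {f : ℝ → ℂ} {f' : ℂ} {t : ℝ} (h : HasDerivAt f f' t) :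
    HasDerivAt (fun s => (f s).im) f'.im t :=
  (Complex.imCLM.hasFDerivAt (x := f t)).comp_hasDerivAt t h

theorem hasDerivAt_cross {X Y : ℝ → ℂ} {X' Y' : ℂ} {t : ℝ} (hX : HasDerivAt X X' t)
    (hY : HasDerivAt Y Y' t) :
    HasDerivAt (fun s => cross (X s) (Y s)) (cross X' (Y t) + cross (X t) Y') t := by
  simp only [cross_eq_im]
  have := hasDerivAt_im ((hasDerivAt_conj hX).mul hY)
  simpa using this

theorem hasDerivAt_norm {X : ℝ → ℂ} {X' : ℂ} {t : ℝ} (hX : HasDerivAt X X' t) (h0 : X t ≠ 0) :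
    HasDerivAt (fun s => ‖X s‖) (inner ℝ (X t) X' / ‖X t‖) t := by
  have h1 := hX.norm_sq
  have h2 := h1.sqrt (by simpa using h0)
  have e : (fun s => Real.sqrt (‖X s‖ ^ 2)) = fun s => ‖X s‖ := by
    ext s; exact Real.sqrt_sq (norm_nonneg _)
  rw [e] at h2
  refine h2.congr_deriv ?_
  rw [Real.sqrt_sq (norm_nonneg _)]
  ring

theorem hasDerivAt_unit {X : ℝ → ℂ} {X' : ℂ} {t : ℝ} (hX : HasDerivAt X X' t) (h0 : X t ≠ 0) :
    HasDerivAt (fun s => X s / (‖X s‖ : ℂ))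
      (Complex.I * (X t / (‖X t‖ : ℂ)) * ((cross (X t) X' / ‖X t‖ ^ 2 : ℝ) : ℂ)) t := by
  have hn : ((‖X t‖ : ℝ) : ℂ) ≠ 0 := by simpa using h0
  have h1 := hX.div (hasDerivAt_norm hX h0).ofReal_comp hn
  refine h1.congr_deriv ?_
  have e := conj_mul_eq (X t) X'
  push_cast
  field_simp
  linear_combination X t * e - X' * mul_conj_self (X t)

theorem hasDerivAt_inv_norm {X : ℝ → ℂ} {X' : ℂ} {t : ℝ} (hX : HasDerivAt X X' t)
    (h0 : X t ≠ 0) :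
    HasDerivAt (fun s => ‖X s‖⁻¹) (-(inner ℝ (X t) X' / ‖X t‖) / ‖X t‖ ^ 2) t :=
  (hasDerivAt_norm hX h0).inv (by simpa using h0)

theorem invSq_eq (X : ℂ) : invSq X = ((‖X‖⁻¹ ^ 3 : ℝ) : ℂ) * X := by
  rw [invSq, div_eq_mul_inv, mul_comm]; push_cast; rw [inv_pow]

theorem norm_invSq (X : ℂ) : ‖invSq X‖ = ‖X‖⁻¹ ^ 2 := by
  rw [invSq_eq, norm_mul, Complex.norm_real, Real.norm_of_nonneg (by positivity)]
  rcases eq_or_ne ‖X‖ 0 with h | h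
  · simp [h]
  · field_simp

theorem cross_self (X : ℂ) : cross X X = 0 := by simp [cross]; ring

theorem cross_add_right (X Y Z : ℂ) : cross X (Y + Z) = cross X Y + cross X Z := by
  simp [cross]; ring

theorem cross_real_mul_right (c : ℝ) (X Y : ℂ) : cross X (c * Y) = c * cross X Y := by
  simp [cross]; ring

theorem cross_real_mul_left (c : ℝ) (X Y : ℂ) : cross (c * X) Y = c * cross X Y := by
  simp [cross]; ring

theorem cross_neg_right (X Y : ℂ) : cross X (-Y) = -cross X Y := by
  simp [cross]; ring

section PerturbedKepler

variable {X Y : ℝ → ℂ} {E : ℂ} {t κ : ℝ}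

theorem hasDerivAt_cross_kepler (hX : HasDerivAt X (κ * Y t) t)
    (hY : HasDerivAt Y (-(κ * (invSq (X t) + E))) t) :
    HasDerivAt (fun s => cross (X s) (Y s)) (-(κ * cross (X t) E)) t := by
  convert hasDerivAt_cross hX hY using 1
  rw [cross_neg_right, cross_real_mul_right, cross_add_right, cross_real_mul_left, cross_self,
    invSq_eq, cross_real_mul_right, cross_self]
  ring

/-- The Kepler terms cancel, since the vector is conserved when `E = 0`; only the perturbing force
`E` contributes. The factor `κ` is the time scale of the rescaled problem. -/
theorem hasDerivAt_lrl (h0 : X t ≠ 0) (hX : HasDerivAt X (κ * Y t) t)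
    (hY : HasDerivAt Y (-(κ * (invSq (X t) + E))) t) :
    HasDerivAt (fun s => lrl (X s) (Y s))
      (κ * (Complex.I * (cross (X t) E * Y t + cross (X t) (Y t) * E))) t := by
  have hn : ((‖X t‖ : ℝ) : ℂ) ≠ 0 := by simpa using h0
  have hg := (hasDerivAt_cross_kepler hX hY).ofReal_comp
  have h := ((hg.const_mul Complex.I).mul hY).neg.sub (hasDerivAt_unit hX h0)
  refine h.congr_deriv ?_
  rw [cross_real_mul_right, invSq_eq]
  push_cast
  field_simp
  ring

end PerturbedKepler

/-- The conic equation puts `‖X‖` between `g²/(1 + 7/10)` and `g²/(1 - 7/10)`, and the definition of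
`lrl` gives `g‖Y‖ ≤ 1 + 7/10`. -/
theorem kepler_bounds {X Y : ℂ} (hX : X ≠ 0) (hA : ‖lrl X Y‖ ≤ 7 / 10)
    (hg1 : 3 / 5 ≤ cross X Y) (hg2 : cross X Y ≤ 7 / 5) :
    1 / 5 ≤ ‖X‖ ∧ ‖X‖ ≤ 7 ∧ ‖Y‖ ≤ 3 := by
  have hX0 : 0 < ‖X‖ := norm_pos_iff.2 hX
  have h1 := norm_add_inner_lrl hX Y
  have h2 := abs_le.1 (abs_real_inner_le_norm X (lrl X Y))
  have h3 : ‖X‖ * ‖lrl X Y‖ ≤ ‖X‖ * (7 / 10) := by gcongr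
  refine ⟨by nlinarith, by nlinarith, ?_⟩
  have e : Complex.I * (cross X Y : ℂ) * Y = -(lrl X Y + X / (‖X‖ : ℂ)) := by
    rw [lrl]; ring
  have h4 : ‖X / (‖X‖ : ℂ)‖ = 1 := by
    rw [norm_div, Complex.norm_real, norm_norm, div_self hX0.ne']
  have h5 := congrArg norm e
  rw [norm_neg, norm_mul, norm_mul, Complex.norm_I, one_mul, Complex.norm_real,
    Real.norm_of_nonneg (by linarith)] at h5
  have h6 := norm_add_le (lrl X Y) (X / (‖X‖ : ℂ))
  have h7 := norm_nonneg Y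
  nlinarith


/-! ### Confinement of perturbed Kepler motions -/

theorem norm_lrl_deriv_le {X Y E : ℂ} {κ B : ℝ} (hκ : 0 ≤ κ) (hX : ‖X‖ ≤ 7) (hY : ‖Y‖ ≤ 3)
    (hg : |cross X Y| ≤ 7 / 5) (hE : ‖E‖ ≤ B) :
    ‖(κ : ℂ) * (Complex.I * (cross X E * Y + cross X Y * E))‖ ≤ 23 * κ * B := by
  have h1 : ‖((cross X E : ℝ) : ℂ) * Y‖ ≤ (7 * B) * 3 := by
    rw [norm_mul, Complex.norm_real, Real.norm_eq_abs]
    have := abs_cross_le X E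
    have : ‖X‖ * ‖E‖ ≤ 7 * B := by gcongr
    have := (norm_nonneg E).trans hE
    gcongr
    linarith
  have h2 : ‖((cross X Y : ℝ) : ℂ) * E‖ ≤ 7 / 5 * B := by
    rw [norm_mul, Complex.norm_real, Real.norm_eq_abs]
    gcongr
  rw [norm_mul, norm_mul, Complex.norm_real, Real.norm_of_nonneg hκ, Complex.norm_I, one_mul]
  have h3 := norm_add_le (((cross X E : ℝ) : ℂ) * Y) (((cross X Y : ℝ) : ℂ) * E)
  have := (norm_nonneg E).trans hE
  calc _ ≤ κ * (23 * B) := by gcongr; linarith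
    _ = _ := by ring

/-- A barrier argument for angular momentum and eccentricity vector together. The speed of the pair
has to be bounded only at times when the barrier `24 * κ * B * t` is touched; there the elements are
still within `1 / 10` of their initial values, so `kepler_bounds` applies and the speed is at most
`23 * κ * B`. -/
theorem kepler_confined_of_ne_zero {X Y E : ℝ → ℂ} {κ B T : ℝ} (hκ : 0 < κ) (hB : 0 < B)
    (h0 : ∀ t ∈ Set.Icc 0 T, X t ≠ 0)
    (hX : ∀ t, HasDerivAt X (κ * Y t) t)
    (hY : ∀ t, HasDerivAt Y (-(κ * (invSq (X t) + E t))) t)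
    (hE : ∀ t, 1 / 5 ≤ ‖X t‖ → ‖E t‖ ≤ B)
    (hg1 : 7 / 10 ≤ cross (X 0) (Y 0)) (hg2 : cross (X 0) (Y 0) ≤ 13 / 10)
    (hA : ‖lrl (X 0) (Y 0)‖ ≤ 3 / 5) (hT : 24 * κ * B * T ≤ 1 / 10) :
    ∀ t ∈ Set.Icc 0 T, |cross (X t) (Y t) - cross (X 0) (Y 0)| ≤ 24 * κ * B * t ∧
      ‖lrl (X t) (Y t) - lrl (X 0) (Y 0)‖ ≤ 24 * κ * B * t := by
  set f : ℝ → ℝ × ℂ := fun t => (cross (X t) (Y t) - cross (X 0) (Y 0),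
    lrl (X t) (Y t) - lrl (X 0) (Y 0)) with hf
  have hd : ∀ t ∈ Set.Icc 0 T, HasDerivAt f (-(κ * cross (X t) (E t)),
      κ * (Complex.I * (cross (X t) (E t) * Y t + cross (X t) (Y t) * E t))) t := fun t ht =>
    ((hasDerivAt_cross_kepler (hX t) (hY t)).sub_const _).prodMk
      ((hasDerivAt_lrl (h0 t ht) (hX t) (hY t)).sub_const _)
  have key : ∀ ⦃t⦄, t ∈ Set.Icc 0 T → ‖f t‖ ≤ 24 * κ * B * t := by
    refine image_norm_le_of_norm_deriv_right_lt_deriv_boundary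
      (f' := fun t => (-(κ * cross (X t) (E t)),
        κ * (Complex.I * (cross (X t) (E t) * Y t + cross (X t) (Y t) * E t))))
      (B' := fun _ => 24 * κ * B)
      (fun t ht => (hd t ht).continuousAt.continuousWithinAt)
      (fun t ht => (hd t ⟨ht.1, ht.2.le⟩).hasDerivWithinAt) ?_ ?_ ?_
    · simp [hf]
    · intro t
      simpa using (hasDerivAt_id t).const_mul (24 * κ * B)
    · intro t ht hft
      have hb : ‖f t‖ ≤ 1 / 10 := by
        rw [hft]
        refine le_trans ?_ hT
        have := ht.2.le
        gcongr
      have b1 : |cross (X t) (Y t) - cross (X 0) (Y 0)| ≤ 1 / 10 := (norm_fst_le (f t)).trans hb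
      have b2 : ‖lrl (X t) (Y t) - lrl (X 0) (Y 0)‖ ≤ 1 / 10 := (norm_snd_le (f t)).trans hb
      have b3 := abs_le.1 b1
      have b4 : ‖lrl (X t) (Y t)‖ ≤ 7 / 10 := by
        have := norm_le_norm_add_norm_sub' (lrl (X t) (Y t)) (lrl (X 0) (Y 0))
        linarith
      obtain ⟨c1, c2, c3⟩ := kepler_bounds (h0 t ⟨ht.1, ht.2.le⟩) b4 (by linarith) (by linarith)
      have hEt := hE t c1
      have d1 : |cross (X t) (Y t)| ≤ 7 / 5 := abs_le.2 ⟨by linarith, by linarith⟩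
      have d2 := norm_lrl_deriv_le hκ.le c2 c3 d1 hEt
      have d3 : ‖-(κ * cross (X t) (E t))‖ ≤ 23 * κ * B := by
        rw [norm_neg, norm_mul, Real.norm_of_nonneg hκ.le, Real.norm_eq_abs]
        have e1 := abs_cross_le (X t) (E t)
        have e2 : ‖X t‖ * ‖E t‖ ≤ 7 * B := by gcongr
        have : κ * |cross (X t) (E t)| ≤ κ * (7 * B) := by gcongr; linarith
        nlinarith [mul_pos hκ hB]
      have : (23 * κ * B) < 24 * κ * B := by nlinarith [mul_pos hκ hB]
      exact lt_of_le_of_lt (max_le d3 d2) this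
  intro t ht
  exact ⟨(norm_fst_le (f t)).trans (key ht), (norm_snd_le (f t)).trans (key ht)⟩

/-- Before a first zero of `X` the preceding lemma keeps `‖X‖ ≥ 1 / 5`, which by continuity persists
at the zero itself. Thus noncollision is a consequence and need not be assumed. -/
theorem kepler_confined {X Y E : ℝ → ℂ} {κ B T : ℝ} (hκ : 0 < κ) (hB : 0 < B)
    (hX : ∀ t, HasDerivAt X (κ * Y t) t)
    (hY : ∀ t, HasDerivAt Y (-(κ * (invSq (X t) + E t))) t)
    (hE : ∀ t, 1 / 5 ≤ ‖X t‖ → ‖E t‖ ≤ B)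
    (hg1 : 7 / 10 ≤ cross (X 0) (Y 0)) (hg2 : cross (X 0) (Y 0) ≤ 13 / 10)
    (hA : ‖lrl (X 0) (Y 0)‖ ≤ 3 / 5) (hT : 24 * κ * B * T ≤ 1 / 10) :
    ∀ t ∈ Set.Icc 0 T, X t ≠ 0 ∧ |cross (X t) (Y t) - cross (X 0) (Y 0)| ≤ 24 * κ * B * t ∧
      ‖lrl (X t) (Y t) - lrl (X 0) (Y 0)‖ ≤ 24 * κ * B * t := by
  have hc : Continuous X := continuous_iff_continuousAt.2 fun t => (hX t).continuousAt
  suffices h0 : ∀ t ∈ Set.Icc 0 T, X t ≠ 0 from fun t ht =>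
    ⟨h0 t ht, kepler_confined_of_ne_zero hκ hB h0 hX hY hE hg1 hg2 hA hT t ht⟩
  by_contra! hne
  set S := Set.Icc 0 T ∩ X ⁻¹' {0} with hS
  have hScomp : IsCompact S := isCompact_Icc.inter_right (isClosed_singleton.preimage hc)
  have hmem : sInf S ∈ S := hScomp.sInf_mem (by
    obtain ⟨t, ht, h⟩ := hne
    exact ⟨t, ht, h⟩)
  have hX00 : X 0 ≠ 0 := by
    intro h
    rw [h] at hg1
    simp [cross] at hg1
    norm_num at hg1
  have hpos : 0 < sInf S := lt_of_le_of_ne hmem.1.1 (by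
    intro h; rw [← h] at hmem; exact hX00 hmem.2)
  have hlt : ∀ t ∈ Set.Ico 0 (sInf S), 1 / 5 ≤ ‖X t‖ := by
    intro t ht
    have hne0 : ∀ s ∈ Set.Icc 0 t, X s ≠ 0 := fun s hs h =>
      absurd (csInf_le hScomp.bddBelow ⟨⟨hs.1, (hs.2.trans ht.2.le).trans hmem.1.2⟩, h⟩)
        (not_le.2 (hs.2.trans_lt ht.2))
    have hle : 24 * κ * B * t ≤ 1 / 10 := by
      refine le_trans ?_ hT
      have := ht.2.le.trans hmem.1.2
      gcongr
    obtain ⟨b1, b2⟩ := kepler_confined_of_ne_zero hκ hB hne0 hX hY hE hg1 hg2 hA hle t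
      ⟨ht.1, le_rfl⟩
    have b3 := abs_le.1 (b1.trans hle)
    have b4 : ‖lrl (X t) (Y t)‖ ≤ 7 / 10 := by
      have := norm_le_norm_add_norm_sub' (lrl (X t) (Y t)) (lrl (X 0) (Y 0))
      linarith
    exact (kepler_bounds (hne0 t ⟨ht.1, le_rfl⟩) b4 (by linarith) (by linarith)).1
  have hlim : 1 / 5 ≤ ‖X (sInf S)‖ := by
    refine ge_of_tendsto (hc.norm.continuousWithinAt (s := Set.Iio (sInf S))) ?_
    filter_upwards [Ioo_mem_nhdsLT hpos] with t ht using hlt t ⟨ht.1.le, ht.2⟩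
  have h0 : X (sInf S) = 0 := hmem.2
  rw [h0, norm_zero] at hlim
  norm_num at hlim

/-! ### Functions with small derivatives -/

/-- At `t` the function `f` is bounded by `K` and its derivative by `K * κ`. -/
def SlowAt (f : ℝ → ℂ) (t K κ : ℝ) : Prop :=
  ∃ f', HasDerivAt f f' t ∧ ‖f t‖ ≤ K ∧ ‖f'‖ ≤ K * κ

namespace SlowAt

variable {f g : ℝ → ℂ} {t K L κ : ℝ}

theorem nonneg (h : SlowAt f t K κ) : 0 ≤ K := by
  obtain ⟨_, _, h1, _⟩ := h
  exact (norm_nonneg _).trans h1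

theorem const (hκ : 0 ≤ κ) (c : ℂ) : SlowAt (fun _ => c) t ‖c‖ κ :=
  ⟨0, hasDerivAt_const _ _, le_rfl, by rw [norm_zero]; positivity⟩

/-- The product rule produces the factor 2; it is also put into the bound of the value so that one
constant serves for both. -/
theorem mul (hf : SlowAt f t K κ) (hg : SlowAt g t L κ) :
    SlowAt (fun s => f s * g s) t (2 * K * L) κ := by
  have hK := hf.nonneg
  have hL := hg.nonneg
  obtain ⟨f', h1, h2, h3⟩ := hf
  obtain ⟨g', k1, k2, k3⟩ := hg
  refine ⟨_, h1.mul k1, ?_, ?_⟩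
  · rw [norm_mul]
    have : ‖f t‖ * ‖g t‖ ≤ K * L := by gcongr
    nlinarith [mul_nonneg hK hL]
  · refine (norm_add_le _ _).trans ?_
    rw [norm_mul, norm_mul]
    have a1 : ‖f'‖ * ‖g t‖ ≤ (K * κ) * L := by gcongr; exact (norm_nonneg _).trans h3
    have a2 : ‖f t‖ * ‖g'‖ ≤ K * (L * κ) := by gcongr
    linarith

theorem add (hf : SlowAt f t K κ) (hg : SlowAt g t L κ) :
    SlowAt (fun s => f s + g s) t (K + L) κ := by
  obtain ⟨f', h1, h2, h3⟩ := hf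
  obtain ⟨g', k1, k2, k3⟩ := hg
  refine ⟨_, h1.add k1, (norm_add_le _ _).trans (add_le_add h2 k2), ?_⟩
  rw [add_mul]
  exact (norm_add_le _ _).trans (add_le_add h3 k3)

theorem sub (hf : SlowAt f t K κ) (hg : SlowAt g t L κ) :
    SlowAt (fun s => f s - g s) t (K + L) κ := by
  obtain ⟨f', h1, h2, h3⟩ := hf
  obtain ⟨g', k1, k2, k3⟩ := hg
  refine ⟨_, h1.sub k1, (norm_sub_le _ _).trans (add_le_add h2 k2), ?_⟩
  rw [add_mul]
  exact (norm_sub_le _ _).trans (add_le_add h3 k3)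

theorem conjugate (hf : SlowAt f t K κ) : SlowAt (fun s => (starRingEnd ℂ) (f s)) t K κ := by
  obtain ⟨f', h1, h2, h3⟩ := hf
  exact ⟨_, hasDerivAt_conj h1, by simpa using h2, by simpa using h3⟩

theorem pow (hκ : 0 ≤ κ) (hf : SlowAt f t K κ) (n : ℕ) :
    SlowAt (fun s => f s ^ n) t ((2 * K) ^ n) κ := by
  induction n with
  | zero => simpa using const (t := t) hκ 1
  | succ n ih =>
    have h := ih.mul hf
    have e : 2 * (2 * K) ^ n * K = (2 * K) ^ (n + 1) := by ring
    rw [e] at h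
    simpa only [pow_succ] using h

theorem of_le (hf : SlowAt f t K κ) (hκ : 0 ≤ κ) (h : K ≤ L) : SlowAt f t L κ := by
  obtain ⟨f', h1, h2, h3⟩ := hf
  exact ⟨f', h1, h2.trans h, h3.trans (by gcongr)⟩

end SlowAt

/-! ### The oscillating quadrupole force and its slow coefficients -/

/-- The coefficient of `s` in `invSqQuad X s`. -/
noncomputable def quadCoeff (X : ℂ) : ℂ :=
  3 / 8 * ((‖X‖⁻¹ : ℝ) : ℂ) ^ 7 * (X * conj X ^ 2)

/-- The coefficient of `conj s` in `invSqQuad X s`. -/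
noncomputable def quadCoeffConj (X : ℂ) : ℂ :=
  15 / 8 * ((‖X‖⁻¹ : ℝ) : ℂ) ^ 7 * X ^ 3

/-- The coefficient of `s` in the change of `lrl X Y` due to the force `invSqQuad X s`. -/
noncomputable def lrlCoeff (X Y : ℂ) : ℂ :=
  1 / 2 * (Y * (conj X * quadCoeff X - X * conj (quadCoeffConj X)))
    + Complex.I * ((cross X Y : ℂ) * quadCoeff X)

/-- The coefficient of `conj s` in the change of `lrl X Y` due to the force `invSqQuad X s`. -/
noncomputable def lrlCoeffConj (X Y : ℂ) : ℂ :=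
  1 / 2 * (Y * (conj X * quadCoeffConj X - X * conj (quadCoeff X)))
    + Complex.I * ((cross X Y : ℂ) * quadCoeffConj X)

theorem invSqQuad_eq (X s : ℂ) :
    invSqQuad X s = s * quadCoeff X + conj s * quadCoeffConj X := by
  simp only [invSqQuad, quadCoeff, quadCoeffConj]
  push_cast
  ring

theorem cross_eq_sub (X Z : ℂ) :
    (cross X Z : ℂ) = (conj X * Z - X * conj Z) * (-Complex.I / 2) := by
  have e1 := conj_mul_eq X Z
  have e2 : X * conj Z = ((inner ℝ X Z : ℝ) : ℂ) - (cross X Z : ℂ) * Complex.I := by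
    have := congrArg conj e1
    simpa [sub_eq_add_neg] using this
  rw [e1, e2]
  linear_combination (cross X Z : ℂ) * Complex.I_sq

/-- The change of `lrl` is real linear in the force, hence of the form `s * P + conj s * Q`. With `s
= q²` the factor `s` turns at twice Jupiter's frequency, whereas `P` and `Q` vary on the slow time
scale of the planet. -/
theorem lrl_quad_eq (X Y s : ℂ) :
    Complex.I * (cross X (invSqQuad X s) * Y + cross X Y * invSqQuad X s)
      = s * lrlCoeff X Y + conj s * lrlCoeffConj X Y := by
  rw [cross_eq_sub X (invSqQuad X s), invSqQuad_eq, lrlCoeff, lrlCoeffConj]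
  simp only [map_add, map_mul, Complex.conj_conj]
  linear_combination (-(1 / 2) * Y * (conj X * (s * quadCoeff X + conj s * quadCoeffConj X)
    - X * (conj s * conj (quadCoeff X) + s * conj (quadCoeffConj X)))) * Complex.I_sq

/-- `X`, `Y`, `1/‖X‖` and the angular momentum all have derivatives of order `κ`, and both
coefficients are polynomials in these and their conjugates. -/
theorem exists_slowAt_lrlCoeff : ∃ K : ℝ, 0 < K ∧
    ∀ (X Y : ℝ → ℂ) (E : ℂ) (t κ : ℝ), 0 ≤ κ → 1 / 5 ≤ ‖X t‖ → ‖X t‖ ≤ 7 → ‖Y t‖ ≤ 3 →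
    |cross (X t) (Y t)| ≤ 7 / 5 → ‖E‖ ≤ 1 → HasDerivAt X (κ * Y t) t →
    HasDerivAt Y (-(κ * (invSq (X t) + E))) t →
    SlowAt (fun s => lrlCoeff (X s) (Y s)) t K κ ∧
    SlowAt (fun s => lrlCoeffConj (X s) (Y s)) t K κ := by
  have key : ∃ K L : ℝ,
    ∀ (X Y : ℝ → ℂ) (E : ℂ) (t κ : ℝ), 0 ≤ κ → 1 / 5 ≤ ‖X t‖ → ‖X t‖ ≤ 7 → ‖Y t‖ ≤ 3 →
    |cross (X t) (Y t)| ≤ 7 / 5 → ‖E‖ ≤ 1 → HasDerivAt X (κ * Y t) t →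
    HasDerivAt Y (-(κ * (invSq (X t) + E))) t →
    SlowAt (fun s => lrlCoeff (X s) (Y s)) t K κ ∧
    SlowAt (fun s => lrlCoeffConj (X s) (Y s)) t L κ := by
    -- The two constants remain metavariables here and are fixed by the product and sum rules of
    -- `SlowAt` in the closing term.
    constructor
    constructor
    intro X Y E t κ hκ h1 h2 h3 hg hE dX dY
    have hX0 : X t ≠ 0 := by
      intro h; rw [h, norm_zero] at h1; linarith
    have hi : ‖X t‖⁻¹ ≤ 5 := by
      rw [inv_le_comm₀ (by linarith) (by norm_num)]; linarith
    have nX' : ‖(κ : ℂ) * Y t‖ ≤ κ * 3 := by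
      rw [norm_mul, Complex.norm_real, Real.norm_of_nonneg hκ]
      gcongr
    have sX : SlowAt X t 100 κ := ⟨_, dX, by linarith, by linarith⟩
    have sY : SlowAt Y t 100 κ := by
      refine ⟨_, dY, by linarith, ?_⟩
      rw [norm_neg, norm_mul, Complex.norm_real, Real.norm_of_nonneg hκ, mul_comm]
      have := norm_add_le (invSq (X t)) E
      rw [norm_invSq] at this
      have : ‖X t‖⁻¹ ^ 2 ≤ 5 ^ 2 := by gcongr
      gcongr
      linarith
    have sR : SlowAt (fun s => ((‖X s‖⁻¹ : ℝ) : ℂ)) t 100 κ := by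
      refine ⟨_, (hasDerivAt_inv_norm dX hX0).ofReal_comp, ?_, ?_⟩
      · rw [Complex.norm_real, Real.norm_of_nonneg (by positivity)]; linarith
      · rw [Complex.norm_real, norm_div, norm_neg, norm_div, norm_norm, norm_pow, norm_norm,
          Real.norm_eq_abs]
        have a1 := abs_real_inner_le_norm (X t) (κ * Y t)
        have a2 : |inner ℝ (X t) (κ * Y t)| / ‖X t‖ / ‖X t‖ ^ 2
            = |inner ℝ (X t) (κ * Y t)| * ‖X t‖⁻¹ ^ 3 := by
          field_simp
        rw [a2]
        calc _ ≤ (‖X t‖ * ‖(κ : ℂ) * Y t‖) * ‖X t‖⁻¹ ^ 3 := by gcongr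
          _ = ‖(κ : ℂ) * Y t‖ * ‖X t‖⁻¹ ^ 2 := by field_simp
          _ ≤ (κ * 3) * 5 ^ 2 := by gcongr
          _ ≤ 100 * κ := by linarith
    have sG : SlowAt (fun s => (cross (X s) (Y s) : ℂ)) t 100 κ := by
      refine ⟨_, (hasDerivAt_cross_kepler dX dY).ofReal_comp, ?_, ?_⟩
      · rw [Complex.norm_real, Real.norm_eq_abs]; linarith
      · rw [Complex.norm_real, norm_neg, norm_mul, Real.norm_of_nonneg hκ, mul_comm,
          Real.norm_eq_abs]
        have := abs_cross_le (X t) E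
        have : ‖X t‖ * ‖E‖ ≤ 7 * 1 := by gcongr
        gcongr
        linarith
    have sA : SlowAt (fun s => quadCoeff (X s)) t _ κ :=
      ((SlowAt.const hκ (3 / 8)).mul (sR.pow hκ 7)).mul (sX.mul (sX.conjugate.pow hκ 2))
    have sB : SlowAt (fun s => quadCoeffConj (X s)) t _ κ :=
      ((SlowAt.const hκ (15 / 8)).mul (sR.pow hκ 7)).mul (sX.pow hκ 3)
    exact ⟨((SlowAt.const hκ (1 / 2)).mul (sY.mul ((sX.conjugate.mul sA).sub (sX.mul sB.conjugate)))).add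
        ((SlowAt.const hκ Complex.I).mul (sG.mul sA)),
      ((SlowAt.const hκ (1 / 2)).mul (sY.mul ((sX.conjugate.mul sB).sub (sX.mul sA.conjugate)))).add
        ((SlowAt.const hκ Complex.I).mul (sG.mul sB))⟩
  obtain ⟨K, L, h⟩ := key
  refine ⟨|K| + |L| + 1, by positivity, fun X Y E t κ hκ h1 h2 h3 hg hE dX dY => ?_⟩
  obtain ⟨a, b⟩ := h X Y E t κ hκ h1 h2 h3 hg hE dX dY
  exact ⟨a.of_le hκ (by linarith [le_abs_self K, abs_nonneg L]),
    b.of_le hκ (by linarith [le_abs_self L, abs_nonneg K])⟩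


/-! ### The apsidal precession forced by a close circular binary -/

/-- The primitive of the periodic part of `(1 + ⟨A, w⟩) ^ 2 dw` on the unit circle. -/
noncomputable def apsidalPrimitive (A w : ℂ) : ℂ :=
  w * (1 + A * conj A / 2) + conj A * w ^ 2 / 2 - A ^ 2 * conj w / 4 + conj A ^ 2 * w ^ 3 / 12

/-- On the unit circle `w (1 + ⟨A, w⟩)²` is a trigonometric polynomial with mean `A`, which is the
source of the precession; the primitive integrates its other Fourier modes. -/
theorem hasDerivAt_apsidalPrimitive {w : ℝ → ℂ} {θ t : ℝ} (A : ℂ) (hw : ‖w t‖ = 1)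
    (h : HasDerivAt w (Complex.I * w t * θ) t) :
    HasDerivAt (fun s => apsidalPrimitive A (w s))
      (Complex.I * θ * (w t * (((1 + inner ℝ A (w t)) ^ 2 : ℝ) : ℂ) - A)) t := by
  have hww : w t * conj (w t) = 1 := by rw [mul_conj_self, hw]; simp
  have hre : ((inner ℝ A (w t) : ℝ) : ℂ) = (conj A * w t + A * conj (w t)) / 2 := by
    rw [inner_eq_re, Complex.re_eq_add_conj]
    simp
  have h1 := (((h.mul_const (1 + A * conj A / 2)).add
    (((h.pow 2).const_mul (conj A)).div_const 2)).sub
    (((hasDerivAt_conj h).const_mul (A ^ 2)).div_const 4)).add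
    (((h.pow 3).const_mul (conj A ^ 2)).div_const 12)
  refine h1.congr_deriv ?_
  push_cast
  rw [hre]
  simp only [map_mul, Complex.conj_I, Complex.conj_ofReal]
  linear_combination (-Complex.I * θ * A - Complex.I * θ * A * conj A * w t / 2
    - Complex.I * θ * A ^ 2 * conj (w t) / 4) * hww

/-- Every term of the difference has the factor `u - 1` or its conjugate. Hence the boundary term of
the primitive over one period is controlled by the rotation that is to be estimated. -/
theorem norm_apsidalPrimitive_sub_le {A w u : ℂ} (hA : ‖A‖ ≤ 1) (hw : ‖w‖ = 1) (hu : ‖u‖ = 1) :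
    ‖apsidalPrimitive A (u * w) - apsidalPrimitive A w‖ ≤ 3 * ‖u - 1‖ := by
  have e : apsidalPrimitive A (u * w) - apsidalPrimitive A w
      = (u - 1) * (w * (1 + A * conj A / 2)) + (u - 1) * ((u + 1) * (conj A * w ^ 2 / 2))
        + -conj (u - 1) * (A ^ 2 * conj w / 4)
        + (u - 1) * ((u ^ 2 + u + 1) * (conj A ^ 2 * w ^ 3 / 12)) := by
    simp only [apsidalPrimitive, map_mul, map_sub, map_one]
    ring
  have hA0 := norm_nonneg A
  have b1 : ‖w * (1 + A * conj A / 2)‖ ≤ 3 / 2 := by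
    rw [norm_mul, hw, one_mul]
    refine (norm_add_le _ _).trans ?_
    simp
    nlinarith
  have b2 : ‖(u + 1) * (conj A * w ^ 2 / 2)‖ ≤ 1 := by
    have := norm_add_le u 1
    rw [hu] at this
    simp [hw] at this ⊢
    nlinarith [norm_nonneg (u + 1)]
  have b3 : ‖A ^ 2 * conj w / 4‖ ≤ 1 / 4 := by
    simp [hw]
    nlinarith
  have b4 : ‖(u ^ 2 + u + 1) * (conj A ^ 2 * w ^ 3 / 12)‖ ≤ 1 / 4 := by
    have h1 : ‖u ^ 2 + u + 1‖ ≤ 3 := by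
      refine (norm_add₃_le).trans ?_
      simp [hu]; norm_num
    have h2 : ‖conj A ^ 2 * w ^ 3 / 12‖ ≤ 1 / 12 := by
      simp [hw]
      nlinarith
    rw [norm_mul]
    calc _ ≤ (3 : ℝ) * (1 / 12) := by gcongr
      _ = _ := by norm_num
  rw [e]
  refine (norm_add_le _ _).trans ?_
  have n0 := norm_nonneg (u - 1)
  have := mul_le_mul_of_nonneg_left b1 n0
  have := mul_le_mul_of_nonneg_left b2 n0
  have := mul_le_mul_of_nonneg_left b3 n0
  have := mul_le_mul_of_nonneg_left b4 n0
  have := norm_add₃_le (a := (u - 1) * (w * (1 + A * conj A / 2)))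
    (b := (u - 1) * ((u + 1) * (conj A * w ^ 2 / 2)))
    (c := -conj (u - 1) * (A ^ 2 * conj w / 4))
  simp only [norm_mul (u - 1), norm_mul (-conj (u - 1)), norm_neg, RCLike.norm_conj] at *
  linarith

/-- With `ρ = 1/‖X‖`, `x = ⟨A, w⟩` and `n = ‖q‖²`, the last hypothesis is the conic equation. The
lemma replaces the current elements by the initial ones in the strength of the apsidal term. -/
theorem abs_frozen_sub_le {x x₀ g g₀ n ρ η : ℝ} (hx : |x| ≤ 7 / 10) (hx₀ : |x₀| ≤ 7 / 10)
    (hxx : |x - x₀| ≤ η) (hg1 : 3 / 5 ≤ g) (hg2 : g ≤ 7 / 5) (hg₀1 : 3 / 5 ≤ g₀) (hg₀2 : g₀ ≤ 7 / 5)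
    (hgg : |g - g₀| ≤ η) (hn : |n - 1| ≤ η) (hρ : 1 + x = g ^ 2 * ρ) :
    |n * ρ ^ 2 - (1 + x₀) ^ 2 / g₀ ^ 4| ≤ 600 * η := by
  obtain ⟨ρ₀, hρ₀⟩ : ∃ ρ₀, 1 + x₀ = g₀ ^ 2 * ρ₀ := ⟨(1 + x₀) / g₀ ^ 2, by field_simp⟩
  have hη : 0 ≤ η := (abs_nonneg _).trans hn
  have e0 : (1 + x₀) ^ 2 / g₀ ^ 4 = ρ₀ ^ 2 := by rw [hρ₀]; field_simp
  have hx' := abs_le.1 hx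
  have hx₀' := abs_le.1 hx₀
  have bρ : 0 ≤ ρ ∧ ρ ≤ 5 := by
    constructor <;> by_contra! h <;> nlinarith
  have bρ₀ : 0 ≤ ρ₀ ∧ ρ₀ ≤ 5 := by
    constructor <;> by_contra! h <;> nlinarith
  have e1 : g ^ 2 * (ρ - ρ₀) = (x - x₀) - (g - g₀) * ((g + g₀) * ρ₀) := by
    linear_combination hρ₀ - hρ
  have h1 : |g ^ 2 * (ρ - ρ₀)| ≤ η + η * 14 := by
    rw [e1]
    refine (abs_sub _ _).trans ?_
    rw [abs_mul (g - g₀)]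
    have : |(g + g₀) * ρ₀| ≤ 14 := by
      rw [abs_of_nonneg (by nlinarith)]
      nlinarith [hg2, hg₀2]
    gcongr
  have h2 : |ρ - ρ₀| ≤ 45 * η := by
    rw [abs_mul, abs_of_nonneg (by positivity)] at h1
    have : 9 / 25 * |ρ - ρ₀| ≤ g ^ 2 * |ρ - ρ₀| := by
      gcongr
      nlinarith
    linarith
  rw [e0]
  have e2 : n * ρ ^ 2 - ρ₀ ^ 2 = (n - 1) * ρ ^ 2 + (ρ - ρ₀) * (ρ + ρ₀) := by ring
  rw [e2]
  refine (abs_add_le _ _).trans ?_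
  rw [abs_mul, abs_mul, abs_of_nonneg (by positivity : 0 ≤ ρ ^ 2),
    abs_of_nonneg (by linarith : 0 ≤ ρ + ρ₀)]
  have : |n - 1| * ρ ^ 2 ≤ η * 5 ^ 2 := by
    have := bρ.1
    gcongr; exact bρ.2
  have : |ρ - ρ₀| * (ρ + ρ₀) ≤ 45 * η * 10 := by
    gcongr <;> linarith [bρ.2, bρ₀.2]
  linarith

/-- Integration by parts: if `J' ≈ -2 s` and `P`, `Q` are slow, then `s P + conj s Q` is minus the
derivative of `(J P + conj J Q) / 2` up to a small error. It is used with `J = q v`, where `v ≈ i q`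
and `v' ≈ -q` make `J' ≈ -2 q²`. -/
theorem SlowAt.exists_deriv_averaged {P Q J : ℝ → ℂ} {J' s : ℂ} {t K L κ η : ℝ}
    (hP : SlowAt P t K κ) (hQ : SlowAt Q t K κ) (hJ : HasDerivAt J J' t) (hJL : ‖J t‖ ≤ L)
    (hs : ‖J' + 2 * s‖ ≤ η) :
    ∃ d, HasDerivAt (fun τ => 1 / 2 * (J τ * P τ + conj (J τ) * Q τ)) d t ∧
      ‖d + (s * P t + conj s * Q t)‖ ≤ K * (η + L * κ) := by
  have hK := hP.nonneg
  obtain ⟨P', p1, p2, p3⟩ := hP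
  obtain ⟨Q', k1, k2, k3⟩ := hQ
  refine ⟨_, ((hJ.mul p1).add ((hasDerivAt_conj hJ).mul k1)).const_mul (1 / 2), ?_⟩
  have e : 1 / 2 * (J' * P t + J t * P' + (conj J' * Q t + conj (J t) * Q'))
      + (s * P t + conj s * Q t)
      = 1 / 2 * (((J' + 2 * s) * P t + J t * P') + (conj (J' + 2 * s) * Q t
        + conj (J t) * Q')) := by
    simp only [map_add, map_mul, Complex.conj_ofNat]
    ring
  rw [e, norm_mul]
  have hL := (norm_nonneg _).trans hJL
  have hη := (norm_nonneg _).trans hs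
  have a1 : ‖(J' + 2 * s) * P t + J t * P'‖ ≤ η * K + L * (K * κ) := by
    refine (norm_add_le _ _).trans ?_
    rw [norm_mul, norm_mul]
    gcongr
  have a2 : ‖conj (J' + 2 * s) * Q t + conj (J t) * Q'‖ ≤ η * K + L * (K * κ) := by
    refine (norm_add_le _ _).trans ?_
    rw [norm_mul, norm_mul, RCLike.norm_conj, RCLike.norm_conj]
    gcongr
  have a3 := (norm_add_le _ _).trans (add_le_add a1 a2)
  have n2 : ‖(1 / 2 : ℂ)‖ = 1 / 2 := by norm_num
  rw [n2]
  linarith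


/-- The three summands are the part oscillating at twice Jupiter's frequency, the apsidal part, and
the effect of the multipole remainder. The rotation invariant force is radial, so it exerts no
torque and contributes only through the angular momentum factor. -/
theorem lrl_change_eq {X Y E R q : ℂ} {α a κ : ℝ}
    (hR : R = E - ((α * a ^ 2 : ℝ) : ℂ) * (invSqQuad X (q ^ 2)
      + ((‖q‖ ^ 2 : ℝ) : ℂ) * invSqMean X)) :
    (κ : ℂ) * (Complex.I * (cross X E * Y + cross X Y * E))
      = ((α * a ^ 2 * κ : ℝ) : ℂ) * (q ^ 2 * lrlCoeff X Y + conj (q ^ 2) * lrlCoeffConj X Y)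
      + ((3 / 4 * α * a ^ 2 * κ * cross X Y * ‖X‖⁻¹ ^ 4 * ‖q‖ ^ 2 : ℝ) : ℂ)
        * (Complex.I * (X / (‖X‖ : ℂ)))
      + (κ : ℂ) * (Complex.I * (cross X R * Y + cross X Y * R)) := by
  obtain rfl : E = R + ((α * a ^ 2 : ℝ) : ℂ) * (invSqQuad X (q ^ 2)
      + ((‖q‖ ^ 2 : ℝ) : ℂ) * invSqMean X) := by rw [hR]; ring
  rw [← lrl_quad_eq]
  have hm : invSqMean X = ((3 / 4 * ‖X‖⁻¹ ^ 5 : ℝ) : ℂ) * X := by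
    rw [invSqMean]; push_cast; ring
  have hc : cross X (invSqMean X) = 0 := by
    rw [hm, cross_real_mul_right, cross_self, mul_zero]
  rw [cross_add_right, cross_real_mul_right, cross_add_right, cross_real_mul_right, hc,
    invSqMean]
  push_cast
  ring

/-- The imaginary part of `conj A * d` is the component of `d` along `i A`, that is, the rotation of
`A`. -/
theorem im_conj_mul_ge {A Z : ℂ} {r B : ℝ} (hA : ‖A‖ ≤ 1) (hZ : ‖Z‖ ≤ B) :
    r * ‖A‖ ^ 2 - B ≤ (conj A * ((r : ℂ) * (Complex.I * A) + Z)).im := by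
  have e : (conj A * ((r : ℂ) * (Complex.I * A) + Z)).im = r * ‖A‖ ^ 2 + (conj A * Z).im := by
    have : conj A * ((r : ℂ) * (Complex.I * A) + Z)
        = ((r * ‖A‖ ^ 2 : ℝ) : ℂ) * Complex.I + conj A * Z := by
      push_cast; rw [← mul_conj_self]; ring
    rw [this, Complex.add_im, Complex.im_ofReal_mul, Complex.I_im, mul_one]
  have h1 := abs_le.1 (Complex.abs_im_le_norm (conj A * Z))
  have h2 : ‖conj A * Z‖ ≤ 1 * B := by
    rw [norm_mul, RCLike.norm_conj]
    gcongr
  linarith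

/-- The Laplace-Runge-Lenz vector with the periodic part of its forced oscillation removed. -/
noncomputable def lrlCorrected (X Y q v : ℝ → ℂ) (A₀ : ℂ) (b c : ℝ) (t : ℝ) : ℂ :=
  lrl (X t) (Y t) - (b : ℂ) * apsidalPrimitive A₀ (X t / (‖X t‖ : ℂ))
    + (c : ℂ) * (1 / 2 * (q t * v t * lrlCoeff (X t) (Y t)
      + conj (q t * v t) * lrlCoeffConj (X t) (Y t)))

theorem exists_deriv_lrlCorrected : ∃ K : ℝ, 0 < K ∧
    ∀ (X Y q v : ℝ → ℂ) (E v' A₀ : ℂ) (κ a α η g₀ t : ℝ), 0 < κ → 0 < α → α ≤ 1 / 4 →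
    κ ≤ η → η ≤ 1 / 10 → X t ≠ 0 →
    HasDerivAt X (κ * Y t) t → HasDerivAt Y (-(κ * (invSq (X t) + E))) t →
    HasDerivAt q (v t) t → HasDerivAt v v' t →
    ‖E‖ ≤ 1 →
    ‖E - ((α * a ^ 2 : ℝ) : ℂ) * (invSqQuad (X t) (q t ^ 2)
      + ((‖q t‖ ^ 2 : ℝ) : ℂ) * invSqMean (X t))‖ ≤ η * a ^ 2 →
    ‖v t - Complex.I * q t‖ ≤ η → ‖v' + q t‖ ≤ η → |‖q t‖ ^ 2 - 1| ≤ η →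
    7 / 10 ≤ g₀ → g₀ ≤ 13 / 10 → ‖A₀‖ ≤ 3 / 5 →
    |cross (X t) (Y t) - g₀| ≤ η → ‖lrl (X t) (Y t) - A₀‖ ≤ η →
    ∃ d, HasDerivAt (lrlCorrected X Y q v A₀ (3 / 4 * α * a ^ 2 / g₀ ^ 4) (α * a ^ 2 * κ)) d t ∧
      κ * a ^ 2 * (α * ‖A₀‖ ^ 2 / 600 - K * η) ≤ (conj A₀ * d).im := by
  obtain ⟨K, hK, hslow⟩ := exists_slowAt_lrlCoeff
  refine ⟨4000 + 2 * K, by positivity, ?_⟩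
  intro X Y q v E v' A₀ κ a α η g₀ t hκ hα hα4 hκη hη h0 dX dY dq dv hE hR hv hv' hq hg₀1 hg₀2
    hA₀ hg hA
  set g := cross (X t) (Y t) with hgdef
  set A := lrl (X t) (Y t) with hAdef
  have hg' := abs_le.1 hg
  have hA7 : ‖A‖ ≤ 7 / 10 := by
    have := norm_le_norm_add_norm_sub' A A₀
    linarith
  obtain ⟨c1, c2, c3⟩ := kepler_bounds h0 hA7 (by linarith) (by linarith)
  have hX0 : 0 < ‖X t‖ := norm_pos_iff.2 h0
  have hi : ‖X t‖⁻¹ ≤ 5 := by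
    rw [inv_le_comm₀ hX0 (by norm_num)]; linarith
  have hi' : 1 / 7 ≤ ‖X t‖⁻¹ := by
    rw [le_inv_comm₀ (by norm_num) hX0]; linarith
  have habsg : |g| ≤ 7 / 5 := abs_le.2 ⟨by linarith, by linarith⟩
  obtain ⟨sP, sQ⟩ := hslow X Y E t κ hκ.le c1 c2 c3 habsg hE dX dY
  have hq' := abs_le.1 hq
  have nq : ‖q t‖ ≤ 11 / 10 := by
    by_contra! h; nlinarith
  have nIq : ‖Complex.I * q t‖ ≤ 11 / 10 := by
    rw [norm_mul, Complex.norm_I, one_mul]; exact nq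
  have nv : ‖v t‖ ≤ 12 / 10 := by
    have := norm_le_norm_add_norm_sub' (v t) (Complex.I * q t)
    linarith
  have nJ : ‖q t * v t‖ ≤ 2 := by
    rw [norm_mul]
    calc ‖q t‖ * ‖v t‖ ≤ (11 / 10) * (12 / 10) := by gcongr
      _ ≤ 2 := by norm_num
  have hη0 : 0 < η := by linarith
  have nJ' : ‖(v t * v t + q t * v') + 2 * q t ^ 2‖ ≤ 4 * η := by
    have e : (v t * v t + q t * v') + 2 * q t ^ 2
        = (v t - Complex.I * q t) * (v t + Complex.I * q t) + q t * (v' + q t) := by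
      linear_combination q t ^ 2 * Complex.I_sq
    rw [e]
    refine (norm_add_le _ _).trans ?_
    rw [norm_mul, norm_mul]
    have := norm_add_le (v t) (Complex.I * q t)
    have : ‖v t - Complex.I * q t‖ * ‖v t + Complex.I * q t‖ ≤ η * (23 / 10) := by
      gcongr; linarith
    have : ‖q t‖ * ‖v' + q t‖ ≤ (11 / 10) * η := by gcongr
    linarith
  obtain ⟨d, hd, hd'⟩ := sP.exists_deriv_averaged sQ (J := fun τ => q τ * v τ) (dq.mul dv) nJ nJ'
  have nw : ‖X t / (‖X t‖ : ℂ)‖ = 1 := by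
    rw [norm_div, Complex.norm_real, norm_norm, div_self hX0.ne']
  have dA := hasDerivAt_lrl h0 dX dY
  have dS := hasDerivAt_apsidalPrimitive (w := fun s => X s / (‖X s‖ : ℂ)) A₀ nw (hasDerivAt_unit dX h0)
  refine ⟨_, (dA.sub (dS.const_mul (((3 / 4 * α * a ^ 2 / g₀ ^ 4 : ℝ)) : ℂ))).add
    (hd.const_mul ((α * a ^ 2 * κ : ℝ) : ℂ)), ?_⟩
  set w := X t / (‖X t‖ : ℂ) with hw
  set R := E - ((α * a ^ 2 : ℝ) : ℂ) * (invSqQuad (X t) (q t ^ 2)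
      + ((‖q t‖ ^ 2 : ℝ) : ℂ) * invSqMean (X t)) with hRdef
  rw [lrl_change_eq hRdef, ← hw]
  have hθ : cross (X t) (κ * Y t) / ‖X t‖ ^ 2 = κ * g * ‖X t‖⁻¹ ^ 2 := by
    rw [cross_real_mul_right, ← hgdef, div_eq_mul_inv, inv_pow]
  rw [hθ]
  set ρ := ‖X t‖⁻¹ with hρ
  set n₀ := (1 + inner ℝ A₀ w) ^ 2 with hn₀
  set r := 3 / 4 * α * a ^ 2 / g₀ ^ 4 * (κ * g * ρ ^ 2) with hr
  set D := ‖q t‖ ^ 2 * ρ ^ 2 - n₀ / g₀ ^ 4 with hD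
  -- Subtracting the derivative of the primitive leaves the secular term `r * (i A₀)`, where `r` is
  -- a positive multiple of the planet's angular speed; the three remaining summands are errors.
  have key : ((α * a ^ 2 * κ : ℝ) : ℂ) * (q t ^ 2 * lrlCoeff (X t) (Y t)
        + conj (q t ^ 2) * lrlCoeffConj (X t) (Y t))
      + ((3 / 4 * α * a ^ 2 * κ * g * ρ ^ 4 * ‖q t‖ ^ 2 : ℝ) : ℂ) * (Complex.I * w)
      + (κ : ℂ) * (Complex.I * (cross (X t) R * Y t + g * R))
      - ((3 / 4 * α * a ^ 2 / g₀ ^ 4 : ℝ) : ℂ)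
        * (Complex.I * ((κ * g * ρ ^ 2 : ℝ) : ℂ) * (w * (n₀ : ℂ) - A₀))
      + ((α * a ^ 2 * κ : ℝ) : ℂ) * d
      = (r : ℂ) * (Complex.I * A₀) + (((3 / 4 * α * a ^ 2 * (κ * g * ρ ^ 2) * D : ℝ) : ℂ)
        * (Complex.I * w)
      + ((α * a ^ 2 * κ : ℝ) : ℂ) * (d + (q t ^ 2 * lrlCoeff (X t) (Y t)
        + conj (q t ^ 2) * lrlCoeffConj (X t) (Y t)))
      + (κ : ℂ) * (Complex.I * (cross (X t) R * Y t + g * R))) := by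
    rw [hr, hD]
    push_cast
    ring
  have hin : ∀ B : ℂ, |inner ℝ B w| ≤ ‖B‖ := fun B => by
    have := abs_real_inner_le_norm B w
    rwa [nw, mul_one] at this
  have hDle : |D| ≤ 600 * η := by
    refine abs_frozen_sub_le (x := inner ℝ A w) (g := g) ((hin _).trans hA7)
      ((hin _).trans (hA₀.trans (by norm_num))) ?_ (by linarith) (by linarith) (by linarith)
      (by linarith) hg hq ?_
    · rw [← inner_sub_left]
      exact (hin _).trans hA
    · have h1 := norm_add_inner_lrl h0 (Y t)
      have h2 : inner ℝ A w = ρ * inner ℝ (X t) A := by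
        rw [real_inner_comm, hw, div_eq_inv_mul, ← Complex.ofReal_inv, ← Complex.real_smul,
          real_inner_smul_left]
      rw [← hgdef, ← hAdef] at h1
      rw [h2, ← h1, hρ]
      field_simp
  have hm : 0 ≤ κ * a ^ 2 * η := by positivity
  have b1 : ‖((3 / 4 * α * a ^ 2 * (κ * g * ρ ^ 2) * D : ℝ) : ℂ) * (Complex.I * w)‖
      ≤ 3950 * κ * a ^ 2 * η := by
    rw [norm_mul, norm_mul, Complex.norm_I, nw, Complex.norm_real, Real.norm_eq_abs, abs_mul,
      mul_one, mul_one]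
    have h1 : |3 / 4 * α * a ^ 2 * (κ * g * ρ ^ 2)| ≤ (3 / 4 * (1 / 4) * a ^ 2)
        * (κ * (7 / 5) * 5 ^ 2) := by
      have : 0 ≤ g := by linarith
      rw [abs_of_nonneg (by positivity)]
      gcongr
      linarith
    calc _ ≤ ((3 / 4 * (1 / 4) * a ^ 2) * (κ * (7 / 5) * 5 ^ 2)) * (600 * η) := by gcongr
      _ ≤ _ := by linarith
  have b2 : ‖((α * a ^ 2 * κ : ℝ) : ℂ) * (d + (q t ^ 2 * lrlCoeff (X t) (Y t)
        + conj (q t ^ 2) * lrlCoeffConj (X t) (Y t)))‖ ≤ κ * a ^ 2 * η * (2 * K) := by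
    rw [norm_mul, Complex.norm_real, Real.norm_of_nonneg (by positivity)]
    calc _ ≤ (1 / 4 * a ^ 2 * κ) * (K * (4 * η + 2 * η)) := by
          gcongr
          exact hd'.trans (by gcongr)
      _ ≤ _ := by
          have : 0 ≤ κ * a ^ 2 * η * K := by positivity
          linarith
  have b3 := norm_lrl_deriv_le hκ.le c2 c3 habsg hR
  have hZ := (norm_add₃_le).trans (add_le_add (add_le_add b1 b2) b3)
  have fin := im_conj_mul_ge (r := r) (hA₀.trans (by norm_num)) hZ
  rw [← key] at fin
  refine le_trans ?_ fin
  have hr' : κ * a ^ 2 * (α / 600) ≤ r := by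
    have h4 : g₀ ^ 4 ≤ 3 := by
      calc g₀ ^ 4 ≤ (13 / 10) ^ 4 := by gcongr
        _ ≤ 3 := by norm_num
    have h5 : (1 / 3 : ℝ) ≤ (g₀ ^ 4)⁻¹ := by
      rw [le_inv_comm₀ (by norm_num) (by positivity)]; linarith
    have h6 : (3 / 5) * (1 / 7) ^ 2 ≤ g * ρ ^ 2 := by
      have : 3 / 5 ≤ g := by linarith
      gcongr
    calc κ * a ^ 2 * (α / 600)
        ≤ (3 / 4 * α * a ^ 2 * κ) * ((1 / 3) * ((3 / 5) * (1 / 7) ^ 2)) := by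
          have : 0 ≤ κ * a ^ 2 * α := by positivity
          linarith
      _ ≤ (3 / 4 * α * a ^ 2 * κ) * ((g₀ ^ 4)⁻¹ * (g * ρ ^ 2)) := by gcongr
      _ = r := by rw [hr]; ring
  have h7 := mul_le_mul_of_nonneg_right hr' (sq_nonneg ‖A₀‖)
  linarith


/-! ### The precession over one period -/

theorem mul_le_sub_of_hasDerivAt {f f' : ℝ → ℝ} {c T : ℝ} (hT : 0 ≤ T)
    (hf : ∀ t ∈ Set.Icc 0 T, HasDerivAt f (f' t) t) (hc : ∀ t ∈ Set.Icc 0 T, c ≤ f' t) :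
    c * T ≤ f T - f 0 := by
  have h := (convex_Icc (0 : ℝ) T).mul_sub_le_image_sub_of_le_deriv (f := f) (C := c)
    (fun t ht => (hf t ht).continuousAt.continuousWithinAt)
    (fun t ht => (hf t (interior_subset ht)).differentiableAt.differentiableWithinAt)
    (fun t ht => by
      rw [(hf t (interior_subset ht)).deriv]
      exact hc t (interior_subset ht))
    0 ⟨le_rfl, hT⟩ T ⟨hT, le_rfl⟩ hT
  simpa using h

/-- Integrate the lower bound for the rotation of the corrected vector over `[0, T]`. By
equivariance its total change is `(u - 1) * A₀` plus boundary terms of the two primitives: one has a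
factor `u - 1`, the other a factor `κ` that makes it negligible against the integral when `κ * T` is
bounded below and `κ` is small. -/
theorem exists_precession_estimate : ∃ K : ℝ, 0 < K ∧
    ∀ (X Y q v E v' : ℝ → ℂ) (u : ℂ) (κ a α η T : ℝ), 0 < κ → 0 < α → α ≤ 1 / 4 →
    κ ≤ η → η ≤ 1 / 10 → 0 ≤ T → (∀ t, X t ≠ 0) →
    (∀ t, HasDerivAt X (κ * Y t) t) → (∀ t, HasDerivAt Y (-(κ * (invSq (X t) + E t))) t) →
    (∀ t, HasDerivAt q (v t) t) → (∀ t, HasDerivAt v (v' t) t) →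
    (∀ t ∈ Set.Icc 0 T, ‖E t‖ ≤ 1) →
    (∀ t ∈ Set.Icc 0 T, ‖E t - ((α * a ^ 2 : ℝ) : ℂ) * (invSqQuad (X t) (q t ^ 2)
      + ((‖q t‖ ^ 2 : ℝ) : ℂ) * invSqMean (X t))‖ ≤ η * a ^ 2) →
    (∀ t ∈ Set.Icc 0 T, ‖v t - Complex.I * q t‖ ≤ η) →
    (∀ t ∈ Set.Icc 0 T, ‖v' t + q t‖ ≤ η) →
    (∀ t ∈ Set.Icc 0 T, |‖q t‖ ^ 2 - 1| ≤ η) →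
    7 / 10 ≤ cross (X 0) (Y 0) → cross (X 0) (Y 0) ≤ 13 / 10 → ‖lrl (X 0) (Y 0)‖ ≤ 3 / 5 →
    (∀ t ∈ Set.Icc 0 T, |cross (X t) (Y t) - cross (X 0) (Y 0)| ≤ η) →
    (∀ t ∈ Set.Icc 0 T, ‖lrl (X t) (Y t) - lrl (X 0) (Y 0)‖ ≤ η) →
    ‖u‖ = 1 → X T = u * X 0 → Y T = u * Y 0 →
    κ * a ^ 2 * (α * ‖lrl (X 0) (Y 0)‖ ^ 2 / 600 - K * η) * T
      ≤ (1 + 3 * a ^ 2) * ‖u - 1‖ + K * (κ * a ^ 2) := by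
  obtain ⟨K₁, hK₁, hslow⟩ := exists_slowAt_lrlCoeff
  obtain ⟨K₂, hK₂, hder⟩ := exists_deriv_lrlCorrected
  refine ⟨K₁ + K₂, by positivity, ?_⟩
  intro X Y q v E v' u κ a α η T hκ hα hα4 hκη hη hT h0 dX dY dq dv hE hR hv hv' hq hg1 hg2
    hA0 hg hA hu hXT hYT
  set A₀ := lrl (X 0) (Y 0) with hA₀
  set g₀ := cross (X 0) (Y 0) with hg₀
  set b := 3 / 4 * α * a ^ 2 / g₀ ^ 4 with hb
  set c := α * a ^ 2 * κ with hc
  have hη0 : 0 < η := by linarith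
  have h1 : ∀ t, t ∈ Set.Icc 0 T → ∃ d, HasDerivAt (lrlCorrected X Y q v A₀ b c) d t ∧
      κ * a ^ 2 * (α * ‖A₀‖ ^ 2 / 600 - K₂ * η) ≤ (conj A₀ * d).im := fun t ht =>
    hder X Y q v (E t) (v' t) A₀ κ a α η g₀ t hκ hα hα4 hκη hη (h0 t) (dX t) (dY t) (dq t)
      (dv t) (hE t ht) (hR t ht) (hv t ht) (hv' t ht) (hq t ht) hg1 hg2 hA0 (hg t ht) (hA t ht)
  choose! d hd hd' using h1
  have h2 := mul_le_sub_of_hasDerivAt (f := fun t => (conj A₀ * lrlCorrected X Y q v A₀ b c t).im)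
    hT (fun t ht => hasDerivAt_im ((hd t ht).const_mul (conj A₀))) hd'
  have osc : ∀ t ∈ Set.Icc 0 T, ‖1 / 2 * (q t * v t * lrlCoeff (X t) (Y t)
      + conj (q t * v t) * lrlCoeffConj (X t) (Y t))‖ ≤ 2 * K₁ := by
    intro t ht
    have hg' := abs_le.1 (hg t ht)
    have hA7 : ‖lrl (X t) (Y t)‖ ≤ 7 / 10 := by
      have := norm_le_norm_add_norm_sub' (lrl (X t) (Y t)) A₀
      linarith [hA t ht]
    obtain ⟨c1, c2, c3⟩ := kepler_bounds (h0 t) hA7 (by linarith) (by linarith)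
    obtain ⟨⟨_, -, n1, -⟩, ⟨_, -, n2, -⟩⟩ := hslow X Y (E t) t κ hκ.le c1 c2 c3
      (abs_le.2 ⟨by linarith, by linarith⟩) (hE t ht) (dX t) (dY t)
    have hq' := abs_le.1 (hq t ht)
    have nq : ‖q t‖ ≤ 11 / 10 := by
      by_contra! h; nlinarith
    have nv : ‖v t‖ ≤ 12 / 10 := by
      have h3 := norm_le_norm_add_norm_sub' (v t) (Complex.I * q t)
      rw [norm_mul, Complex.norm_I, one_mul] at h3
      linarith [hv t ht]
    have nJ : ‖q t * v t‖ ≤ 2 := by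
      rw [norm_mul]
      calc ‖q t‖ * ‖v t‖ ≤ (11 / 10) * (12 / 10) := by gcongr
        _ ≤ 2 := by norm_num
    have e1 : ‖q t * v t * lrlCoeff (X t) (Y t)‖ ≤ 2 * K₁ := by
      rw [norm_mul]
      gcongr
    have e2 : ‖conj (q t * v t) * lrlCoeffConj (X t) (Y t)‖ ≤ 2 * K₁ := by
      rw [norm_mul, RCLike.norm_conj]
      gcongr
    have e3 := (norm_add_le _ _).trans (add_le_add e1 e2)
    rw [norm_mul]
    norm_num at e3 ⊢
    linarith
  set O : ℝ → ℂ := fun t => 1 / 2 * (q t * v t * lrlCoeff (X t) (Y t)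
      + conj (q t * v t) * lrlCoeffConj (X t) (Y t)) with hO
  set w := X 0 / (‖X 0‖ : ℂ) with hw
  have nw : ‖w‖ = 1 := by
    rw [hw, norm_div, Complex.norm_real, norm_norm, div_self (norm_ne_zero_iff.2 (h0 0))]
  have hwT : X T / (‖X T‖ : ℂ) = u * w := by
    rw [hXT, norm_mul, hu, one_mul, hw, mul_div_assoc]
  have hAT : lrl (X T) (Y T) = u * A₀ := by rw [hXT, hYT, lrl_mul_mul hu]
  have e : lrlCorrected X Y q v A₀ b c T - lrlCorrected X Y q v A₀ b c 0
      = (u - 1) * A₀ - (b : ℂ) * (apsidalPrimitive A₀ (u * w) - apsidalPrimitive A₀ w)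
        + (c : ℂ) * (O T - O 0) := by
    simp only [lrlCorrected, hO]
    rw [hwT, hAT, ← hw, ← hA₀]
    ring
  have n1 : ‖(u - 1) * A₀‖ ≤ ‖u - 1‖ * (3 / 5) := by
    rw [norm_mul]; gcongr
  have hb' : 0 ≤ b ∧ b ≤ a ^ 2 := by
    refine ⟨by positivity, ?_⟩
    rw [hb, div_le_iff₀ (by positivity)]
    have : (7 / 10) ^ 4 ≤ g₀ ^ 4 := by gcongr
    have : a ^ 2 * (7 / 10) ^ 4 ≤ a ^ 2 * g₀ ^ 4 := by gcongr
    have : α * a ^ 2 ≤ 1 / 4 * a ^ 2 := by gcongr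
    linarith [sq_nonneg a]
  have n2 : ‖(b : ℂ) * (apsidalPrimitive A₀ (u * w) - apsidalPrimitive A₀ w)‖
      ≤ a ^ 2 * (3 * ‖u - 1‖) := by
    rw [norm_mul, Complex.norm_real, Real.norm_of_nonneg hb'.1]
    have := norm_apsidalPrimitive_sub_le (hA0.trans (by norm_num)) nw hu
    gcongr
    exact hb'.2
  have n3 : ‖(c : ℂ) * (O T - O 0)‖ ≤ (1 / 4 * a ^ 2 * κ) * (4 * K₁) := by
    rw [norm_mul, Complex.norm_real, Real.norm_of_nonneg (by positivity)]
    have := norm_sub_le (O T) (O 0)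
    have : ‖O T‖ ≤ 2 * K₁ := osc T ⟨hT, le_rfl⟩
    have : ‖O 0‖ ≤ 2 * K₁ := osc 0 ⟨le_rfl, hT⟩
    have : c ≤ 1 / 4 * a ^ 2 * κ := by rw [hc]; gcongr
    gcongr
    linarith
  have n4 : ‖lrlCorrected X Y q v A₀ b c T - lrlCorrected X Y q v A₀ b c 0‖
      ≤ (1 + 3 * a ^ 2) * ‖u - 1‖ + K₁ * (κ * a ^ 2) := by
    rw [e]
    refine (norm_add_le _ _).trans ?_
    have := norm_sub_le ((u - 1) * A₀)
      ((b : ℂ) * (apsidalPrimitive A₀ (u * w) - apsidalPrimitive A₀ w))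
    have := norm_nonneg (u - 1)
    linarith
  have h3 : (conj A₀ * lrlCorrected X Y q v A₀ b c T).im
      - (conj A₀ * lrlCorrected X Y q v A₀ b c 0).im
      ≤ (1 + 3 * a ^ 2) * ‖u - 1‖ + K₁ * (κ * a ^ 2) := by
    rw [← Complex.sub_im, ← mul_sub]
    refine (le_abs_self _).trans ((Complex.abs_im_le_norm _).trans ?_)
    rw [norm_mul, RCLike.norm_conj]
    refine le_trans ?_ n4
    have : ‖A₀‖ ≤ 1 := hA0.trans (by norm_num)
    exact mul_le_of_le_one_left (norm_nonneg _) this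
  have h4 : 0 ≤ κ * a ^ 2 * (K₁ * η) * T := by positivity
  have h5 : 0 ≤ K₂ * (κ * a ^ 2) := by positivity
  linarith


/-! ### The three-body problem in Jacobi coordinates -/

namespace IsThreeBodySolution

variable {μ δ : ℝ} {M : Motion}

theorem qS_eq (h : IsThreeBodySolution μ δ M) (t : ℝ) :
    M.qS t = -(δ * M.qP t) - μ * M.q1 t := by
  have := h.center t
  push_cast at this
  simp only [Motion.q1]
  linear_combination this

theorem qJ_eq (h : IsThreeBodySolution μ δ M) (t : ℝ) :
    M.qJ t = -(δ * M.qP t) + ((1 - μ : ℝ) : ℂ) * M.q1 t := by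
  have := h.center t
  push_cast at this ⊢
  simp only [Motion.q1]
  linear_combination this

theorem q2_eq (h : IsThreeBodySolution μ δ M) (t : ℝ) :
    M.q2 μ t = ((1 + δ : ℝ) : ℂ) * M.qP t := by
  have := h.center t
  push_cast at this ⊢
  simp only [Motion.q2]
  push_cast
  linear_combination -this

theorem center_vel (h : IsThreeBodySolution μ δ M) (t : ℝ) :
    ((1 - μ : ℝ) : ℂ) * M.vS t + (μ : ℂ) * M.vJ t + (δ : ℂ) * M.vP t = 0 := by
  have h1 := (((h.deriv_qS t).const_mul ((1 - μ : ℝ) : ℂ)).add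
    ((h.deriv_qJ t).const_mul (μ : ℂ))).add ((h.deriv_qP t).const_mul (δ : ℂ))
  refine h1.unique ((hasDerivAt_const t (0 : ℂ)).congr_of_eventuallyEq ?_)
  exact Filter.Eventually.of_forall fun s => h.center s

theorem vS_eq (h : IsThreeBodySolution μ δ M) (t : ℝ) :
    M.vS t = -(δ * M.vP t) - μ * M.v1 t := by
  have := h.center_vel t
  push_cast at this
  simp only [Motion.v1]
  linear_combination this

theorem vJ_eq (h : IsThreeBodySolution μ δ M) (t : ℝ) :
    M.vJ t = -(δ * M.vP t) + ((1 - μ : ℝ) : ℂ) * M.v1 t := by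
  have := h.center_vel t
  push_cast at this ⊢
  simp only [Motion.v1]
  linear_combination this

theorem hasDerivAt_q1 (h : IsThreeBodySolution μ δ M) (t : ℝ) : HasDerivAt M.q1 (M.v1 t) t :=
  (h.deriv_qJ t).sub (h.deriv_qS t)

theorem hasDerivAt_q2 (h : IsThreeBodySolution μ δ M) (t : ℝ) :
    HasDerivAt (M.q2 μ) (((1 + δ : ℝ) : ℂ) * M.vP t) t := by
  have e : M.q2 μ = fun s => ((1 + δ : ℝ) : ℂ) * M.qP s := funext h.q2_eq
  rw [e]
  exact (h.deriv_qP t).const_mul _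

theorem qP_sub_qS (h : IsThreeBodySolution μ δ M) (t : ℝ) :
    M.qP t - M.qS t = M.q2 μ t + μ * M.q1 t := by
  rw [h.qS_eq, h.q2_eq]; push_cast; ring

theorem qP_sub_qJ (h : IsThreeBodySolution μ δ M) (t : ℝ) :
    M.qP t - M.qJ t = M.q2 μ t - ((1 - μ : ℝ) : ℂ) * M.q1 t := by
  rw [h.qJ_eq, h.q2_eq]; push_cast; ring

theorem q1_ne_zero (h : IsThreeBodySolution μ δ M) (t : ℝ) : M.q1 t ≠ 0 :=
  sub_ne_zero.2 (h.ne_SJ t).symm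

end IsThreeBodySolution

theorem invSq_neg (z : ℂ) : invSq (-z) = -invSq z := by
  rw [invSq_eq, invSq_eq, norm_neg]; ring

/-- The tidal force of the planet on the pair Sun-Jupiter. -/
noncomputable def Motion.tide (M : Motion) (μ δ t : ℝ) : ℂ :=
  δ * (invSq (M.q2 μ t + μ * M.q1 t) - invSq (M.q2 μ t - ((1 - μ : ℝ) : ℂ) * M.q1 t))

namespace IsThreeBodySolution

variable {μ δ : ℝ} {M : Motion}

theorem hasDerivAt_v1 (h : IsThreeBodySolution μ δ M) (t : ℝ) :
    HasDerivAt M.v1 (-(invSq (M.q1 t) + M.tide μ δ t)) t := by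
  refine ((h.deriv_vJ t).sub (h.deriv_vS t)).congr_deriv ?_
  have e : M.qS t - M.qJ t = -M.q1 t := by simp [Motion.q1]
  have e' : M.qJ t - M.qS t = M.q1 t := rfl
  rw [Motion.tide, ← h.qP_sub_qS, ← h.qP_sub_qJ, e, e', invSq_neg]
  push_cast
  ring

theorem hasDerivAt_vP (h : IsThreeBodySolution μ δ M) (t : ℝ) :
    HasDerivAt M.vP (-binaryForce μ (M.q2 μ t) (M.q1 t)) t := by
  refine (h.deriv_vP t).congr_deriv ?_
  rw [binaryForce, ← h.qP_sub_qS, ← h.qP_sub_qJ, ← neg_sub (M.qP t), ← neg_sub (M.qP t),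
    invSq_neg, invSq_neg]
  ring

/-- In Jacobi coordinates the angular momentum has no mixed terms, so that of the pair can be
separated from that of the planet. -/
theorem angularMomentum_eq (h : IsThreeBodySolution μ δ M) (t : ℝ) :
    M.angularMomentum μ δ t = μ * (1 - μ) * cross (M.q1 t) (M.v1 t)
      + δ * cross (M.q2 μ t) (M.vP t) := by
  rw [Motion.angularMomentum, h.qS_eq, h.qJ_eq, h.vS_eq, h.vJ_eq, h.q2_eq]
  simp [cross]
  ring

end IsThreeBodySolution

theorem vel_equivariant {q v : ℝ → ℂ} {u : ℂ} {T : ℝ} (hq : ∀ t, HasDerivAt q (v t) t)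
    (hu : ∀ t, q (t + T) = u * q t) (t : ℝ) : v (t + T) = u * v t := by
  have h1 : HasDerivAt (fun s => q (s + T)) (v (t + T)) t := (hq (t + T)).comp_add_const t T
  have h2 := (hq t).const_mul u
  refine h1.unique (h2.congr_of_eventuallyEq ?_)
  exact Filter.Eventually.of_forall hu

theorem norm_invSq_sub_le {P Q : ℂ} (hP : 1 / 10 ≤ ‖P‖) (hQ : 1 / 10 ≤ ‖Q‖) :
    ‖invSq P - invSq Q‖ ≤ 4000 * ‖P - Q‖ := by
  set p := ‖P‖⁻¹ with hp
  set q := ‖Q‖⁻¹ with hq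
  have hp0 : 0 < p := inv_pos.2 (by linarith)
  have hq0 : 0 < q := inv_pos.2 (by linarith)
  have hp10 : p ≤ 10 := by
    rw [hp, inv_le_comm₀ (by linarith) (by norm_num)]; linarith
  have hq10 : q ≤ 10 := by
    rw [hq, inv_le_comm₀ (by linarith) (by norm_num)]; linarith
  have e : invSq P - invSq Q = ((p ^ 3 : ℝ) : ℂ) * (P - Q)
      + (((‖Q‖ - ‖P‖) * (p * q * (p ^ 2 + p * q + q ^ 2)) : ℝ) : ℂ) * Q := by
    have : p ^ 3 - q ^ 3 = (‖Q‖ - ‖P‖) * (p * q * (p ^ 2 + p * q + q ^ 2)) := by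
      have h1 : ‖P‖ * p = 1 := mul_inv_cancel₀ (by linarith)
      have h2 : ‖Q‖ * q = 1 := mul_inv_cancel₀ (by linarith)
      linear_combination (q * (p ^ 2 + p * q + q ^ 2)) * h1 - (p * (p ^ 2 + p * q + q ^ 2)) * h2
    rw [← this, invSq_eq P, invSq_eq Q, ← hp, ← hq]
    push_cast
    ring
  have hqQ : q * ‖Q‖ = 1 := inv_mul_cancel₀ (by linarith)
  have b1 : ‖((p ^ 3 : ℝ) : ℂ) * (P - Q)‖ ≤ 10 ^ 3 * ‖P - Q‖ := by
    rw [norm_mul, Complex.norm_real, Real.norm_of_nonneg (by positivity)]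
    gcongr
  have b2 : ‖(((‖Q‖ - ‖P‖) * (p * q * (p ^ 2 + p * q + q ^ 2)) : ℝ) : ℂ) * Q‖
      ≤ ‖P - Q‖ * (10 * (10 ^ 2 + 10 * 10 + 10 ^ 2)) := by
    rw [norm_mul, Complex.norm_real, norm_mul, Real.norm_eq_abs, Real.norm_of_nonneg
      (by positivity : 0 ≤ p * q * (p ^ 2 + p * q + q ^ 2))]
    have e1 : |‖Q‖ - ‖P‖| ≤ ‖P - Q‖ := by
      rw [abs_sub_comm]; exact abs_norm_sub_norm_le P Q
    calc _ = |‖Q‖ - ‖P‖| * (p * (p ^ 2 + p * q + q ^ 2)) * (q * ‖Q‖) := by ring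
      _ = |‖Q‖ - ‖P‖| * (p * (p ^ 2 + p * q + q ^ 2)) := by rw [hqQ, mul_one]
      _ ≤ _ := by gcongr
  rw [e]
  refine (norm_add_le _ _).trans ?_
  linarith

theorem invSq_real_mul {c : ℝ} (hc : 0 < c) (X : ℂ) :
    invSq (c * X) = (c⁻¹ ^ 2 : ℝ) * invSq X := by
  rw [invSq_eq, invSq_eq, norm_mul, Complex.norm_real, Real.norm_of_nonneg hc.le]
  have : ((c : ℝ) : ℂ) ≠ 0 := by exact_mod_cast hc.ne'
  push_cast
  rw [mul_inv]
  field_simp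

theorem norm_invSqQuad_le (X s : ℂ) : ‖invSqQuad X s‖ ≤ 9 / 4 * (‖X‖⁻¹ ^ 7 * ‖X‖ ^ 3 * ‖s‖) := by
  rw [invSqQuad, norm_mul, Complex.norm_real, Real.norm_of_nonneg (by positivity)]
  have : ‖3 / 8 * s * (X * conj X ^ 2) + 15 / 8 * conj s * X ^ 3‖ ≤ 9 / 4 * (‖X‖ ^ 3 * ‖s‖) := by
    refine (norm_add_le _ _).trans ?_
    simp
    linarith [show ‖s‖ * (‖X‖ * ‖X‖ ^ 2) = ‖X‖ ^ 3 * ‖s‖ by ring]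
  calc _ ≤ ‖X‖⁻¹ ^ 7 * (9 / 4 * (‖X‖ ^ 3 * ‖s‖)) := by gcongr
    _ = _ := by ring

theorem norm_invSqMean (X : ℂ) : ‖invSqMean X‖ = 3 / 4 * (‖X‖⁻¹ ^ 5 * ‖X‖) := by
  rw [invSqMean, norm_mul, norm_mul, Complex.norm_real, Real.norm_of_nonneg (by positivity)]
  norm_num
  ring

theorem invSqQuad_real_mul (X s : ℂ) (c : ℝ) : invSqQuad X (c * s) = c * invSqQuad X s := by
  simp only [invSqQuad, map_mul, Complex.conj_ofReal]; ring

/-- The deviation of the attraction of a binary from that of a point mass. -/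
theorem norm_binaryForce_sub_invSq_le {μ a : ℝ} (h0 : 0 < μ) (h1 : μ < 1) (ha : 0 < a)
    (ha' : a ≤ 1 / 100) {X q : ℂ} (hX : 1 / 5 ≤ ‖X‖) (hq : ‖q‖ ≤ 11 / 10) :
    ‖binaryForce μ X (a * q) - invSq X - ((μ * (1 - μ) * a ^ 2 : ℝ) : ℂ) *
      (invSqQuad X (q ^ 2) + ((‖q‖ ^ 2 : ℝ) : ℂ) * invSqMean X)‖ ≤ 3000000 * a * a ^ 2 ∧
    ‖binaryForce μ X (a * q) - invSq X‖ ≤ 40000 * a ^ 2 := by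
  have hX0 : 0 < ‖X‖ := by linarith
  have hi : ‖X‖⁻¹ ≤ 5 := by
    rw [inv_le_comm₀ hX0 (by norm_num)]; linarith
  have nz : ‖(a : ℂ) * q‖ = a * ‖q‖ := by
    rw [norm_mul, Complex.norm_real, Real.norm_of_nonneg ha.le]
  have nz' : a * ‖q‖ ≤ a * (11 / 10) := by gcongr
  have b := norm_binaryForce_sub_le h0 h1 (X := X) (z := a * q) (norm_pos_iff.1 hX0)
    (by rw [nz]; linarith)
  have e : ((μ * (1 - μ) : ℝ) : ℂ) * (invSqQuad X ((a * q) ^ 2)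
      + ((‖(a : ℂ) * q‖ ^ 2 : ℝ) : ℂ) * invSqMean X)
      = ((μ * (1 - μ) * a ^ 2 : ℝ) : ℂ) *
      (invSqQuad X (q ^ 2) + ((‖q‖ ^ 2 : ℝ) : ℂ) * invSqMean X) := by
    have : ((a : ℂ) * q) ^ 2 = ((a ^ 2 : ℝ) : ℂ) * q ^ 2 := by push_cast; ring
    rw [nz, this, invSqQuad_real_mul]
    push_cast
    ring
  rw [e] at b
  have b1 : 600 * (‖X‖⁻¹ ^ 5 * ‖(a : ℂ) * q‖ ^ 3) ≤ 3000000 * a * a ^ 2 := by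
    rw [nz]
    calc _ ≤ 600 * (5 ^ 5 * (a * (11 / 10)) ^ 3) := by gcongr
      _ = 600 * 5 ^ 5 * (11 / 10) ^ 3 * (a * a ^ 2) := by ring
      _ ≤ 3000000 * (a * a ^ 2) := by
        gcongr
        norm_num
      _ = _ := by ring
  have b2 := b.trans b1
  refine ⟨b2, ?_⟩
  have q1 : ‖invSqQuad X (q ^ 2)‖ ≤ 2000 := by
    refine (norm_invSqQuad_le _ _).trans ?_
    have : ‖X‖⁻¹ ^ 7 * ‖X‖ ^ 3 = ‖X‖⁻¹ ^ 4 := by field_simp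
    rw [this, norm_pow]
    calc _ ≤ 9 / 4 * ((5 : ℝ) ^ 4 * (11 / 10) ^ 2) := by gcongr
      _ ≤ _ := by norm_num
  have q2 : ‖((‖q‖ ^ 2 : ℝ) : ℂ) * invSqMean X‖ ≤ 1000 := by
    have : ‖X‖⁻¹ ^ 5 * ‖X‖ = ‖X‖⁻¹ ^ 4 := by field_simp
    rw [norm_mul, norm_invSqMean, this, Complex.norm_real, Real.norm_of_nonneg (by positivity)]
    calc _ ≤ ((11 / 10) ^ 2 : ℝ) * (3 / 4 * (5 : ℝ) ^ 4) := by gcongr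
      _ ≤ _ := by norm_num
  have q3 := (norm_add_le _ _).trans (add_le_add q1 q2)
  have q4 : ‖((μ * (1 - μ) * a ^ 2 : ℝ) : ℂ) *
      (invSqQuad X (q ^ 2) + ((‖q‖ ^ 2 : ℝ) : ℂ) * invSqMean X)‖ ≤ 1 * a ^ 2 * 3000 := by
    have : 0 < 1 - μ := by linarith
    rw [norm_mul, Complex.norm_real, Real.norm_of_nonneg (by positivity)]
    gcongr
    · nlinarith
    · linarith
  have q5 := norm_le_norm_add_norm_sub' (binaryForce μ X (a * q) - invSq X)
    (((μ * (1 - μ) * a ^ 2 : ℝ) : ℂ) *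
      (invSqQuad X (q ^ 2) + ((‖q‖ ^ 2 : ℝ) : ℂ) * invSqMean X))
  have : 3000000 * a * a ^ 2 ≤ 3000000 * (1 / 100) * a ^ 2 := by gcongr
  linarith [sq_nonneg a]


/-! ### Sun, Jupiter and planet -/

theorem cross_real_mul_mul (b c : ℝ) (X Y : ℂ) :
    cross (b * X) (c * Y) = b * c * cross X Y := by
  rw [cross_real_mul_left, cross_real_mul_right, mul_assoc]

/-- The rescaled osculating elements of the planet at the initial time. -/
theorem planet_initial {x y : ℂ} {h δ C eP e₀ : ℝ} (hh : 0 < h) (hδ : 0 < δ) (hδ' : δ ≤ 1 / 100)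
    (hδe : δ ≤ e₀ ^ 2 / 6) (hL : |delaunayL x y - h⁻¹| ≤ C) (hC : C * h ≤ 1 / 10)
    (hG : 0 < delaunayG x y) (he : eccentricity x y = eP) (he₀ : 0 < e₀) (heP : e₀ ≤ eP)
    (heP' : eP < 1 / 2) {X Y : ℂ} (hX : X = (((1 + δ) * h ^ 2 : ℝ) : ℂ) * x)
    (hY : Y = ((h⁻¹ : ℝ) : ℂ) * y) :
    7 / 10 ≤ cross X Y ∧ cross X Y ≤ 13 / 10 ∧ ‖lrl X Y‖ ≤ 3 / 5 ∧
      e₀ ^ 2 / 2 ≤ ‖lrl X Y‖ ^ 2 := by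
  set s := Real.sqrt (-2 * keplerEnergy x y) with hs
  set G := delaunayG x y with hGdef
  have hLs : delaunayL x y = s⁻¹ := by rw [delaunayL, one_div]
  rw [hLs] at hL
  have hL' := abs_le.1 hL
  have hhi : h⁻¹ * h = 1 := inv_mul_cancel₀ hh.ne'
  have l1 : 9 / 10 ≤ s⁻¹ * h := by
    have := mul_le_mul_of_nonneg_right hL'.1 hh.le
    rw [sub_mul, hhi] at this
    linarith
  have l2 : s⁻¹ * h ≤ 11 / 10 := by
    have := mul_le_mul_of_nonneg_right hL'.2 hh.le
    rw [sub_mul, hhi] at this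
    linarith
  -- A nonnegative energy would give `s = 0` and, by division by zero, `L = 0`, against the
  -- closeness of `L` to `h⁻¹`.
  have hs0 : 0 < s := by
    rcases (Real.sqrt_nonneg (-2 * keplerEnergy x y)).eq_or_lt with h0 | h0
    · rw [hs, ← h0] at l1; norm_num at l1
    · exact h0
  have hs2 : s ^ 2 = -2 * keplerEnergy x y := Real.sq_sqrt (Real.sqrt_pos.1 hs0).le
  have hecc : 1 - (G * s) ^ 2 = eP ^ 2 := by
    rw [eccentricity, hLs, ← hGdef, div_inv_eq_mul] at he
    rw [← he, Real.sq_sqrt]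
    -- A negative radicand would make the eccentricity zero, against `e₀ ≤ eP`.
    by_contra! hn
    rw [Real.sqrt_eq_zero_of_nonpos hn.le] at he
    linarith
  have hGs0 : 0 < G * s := mul_pos hG hs0
  have hGs1 : G * s ≤ 1 := by
    by_contra! hn
    have := one_lt_pow₀ hn two_ne_zero
    linarith [sq_nonneg eP]
  have hGs2 : 8 / 10 ≤ G * s := by
    by_contra! hn
    have : eP ^ 2 ≤ (1 / 2) ^ 2 := by gcongr; linarith
    have : (G * s) ^ 2 < (8 / 10) ^ 2 := by gcongr
    linarith
  have hx : x ≠ 0 := by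
    rintro rfl
    simp [hGdef, delaunayG, cross] at hG
  have hx0 : 0 < ‖x‖ := norm_pos_iff.2 hx
  have hX0 : X ≠ 0 := by
    rw [hX]
    refine mul_ne_zero ?_ hx
    exact_mod_cast (by positivity : 0 < (1 + δ) * h ^ 2).ne'
  have hg : cross X Y = (1 + δ) * ((G * s) * (s⁻¹ * h)) := by
    rw [hX, hY, cross_real_mul_mul, hGdef, delaunayG]
    field_simp
  set g := cross X Y with hgdef
  have g1 : 7 / 10 ≤ g := by
    rw [hg]
    calc (7 / 10 : ℝ) ≤ 1 * ((8 / 10) * (9 / 10)) := by norm_num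
      _ ≤ _ := by gcongr; linarith
  have g2 : g ≤ 13 / 10 := by
    rw [hg]
    calc _ ≤ (1 + 1 / 100 : ℝ) * (1 * (11 / 10)) := by gcongr
      _ ≤ _ := by norm_num
  have nX : ‖X‖ = (1 + δ) * h ^ 2 * ‖x‖ := by
    rw [hX, norm_mul, Complex.norm_real, Real.norm_of_nonneg (by positivity)]
  have nY : ‖Y‖ = h⁻¹ * ‖y‖ := by
    rw [hY, norm_mul, Complex.norm_real, Real.norm_of_nonneg (by positivity)]
  -- The masses `1 + δ` in the rescaling make the eccentricity of `(X, Y)` differ slightly from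
  -- `eP`, for which `eP² = 1 - (G s)²`.
  have hA : ‖lrl X Y‖ ^ 2 = 1 - (1 + δ) ^ 2 * (G * s) ^ 2 + 2 * δ * (g ^ 2 / ‖X‖) := by
    rw [norm_lrl_sq hX0, ← hgdef]
    have e1 : ‖y‖ ^ 2 = -s ^ 2 + 2 / ‖x‖ := by
      rw [hs2, keplerEnergy]; ring
    have e2 : ‖Y‖ ^ 2 = h⁻¹ ^ 2 * (-s ^ 2 + 2 / ‖x‖) := by rw [nY, mul_pow, e1]
    have e3 : g ^ 2 * (h⁻¹ ^ 2 * s ^ 2) = (1 + δ) ^ 2 * (G * s) ^ 2 := by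
      rw [hg]; field_simp
    rw [e2, nX, ← e3]
    have : (1 + δ) ≠ 0 := by positivity
    field_simp
    ring
  have hA1 : g ^ 2 / ‖X‖ ≤ 1 + ‖lrl X Y‖ := by
    rw [div_le_iff₀ (norm_pos_iff.2 hX0), hgdef, ← norm_add_inner_lrl hX0 Y]
    have := (abs_le.1 (abs_real_inner_le_norm X (lrl X Y))).2
    linarith
  have hA2 : 0 ≤ g ^ 2 / ‖X‖ := by positivity
  have n0 := norm_nonneg (lrl X Y)
  refine ⟨g1, g2, ?_, ?_⟩
  · by_contra! hn
    have h1 : eP ^ 2 ≤ (1 / 2) ^ 2 := by gcongr; linarith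
    have h2 : δ * (g ^ 2 / ‖X‖) ≤ 1 / 100 * (1 + ‖lrl X Y‖) := by gcongr
    have h3 : (1 : ℝ) ^ 2 * (G * s) ^ 2 ≤ (1 + δ) ^ 2 * (G * s) ^ 2 := by
      gcongr; linarith
    have h4 : 3 / 5 * ‖lrl X Y‖ ≤ ‖lrl X Y‖ ^ 2 := by
      rw [sq]; gcongr
    linarith
  · have h1 : e₀ ^ 2 ≤ eP ^ 2 := by gcongr
    have h2 : 0 ≤ δ * (g ^ 2 / ‖X‖) := by positivity
    have h3 : δ * (G * s) ^ 2 ≤ δ * 1 := by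
      gcongr
      exact pow_le_one₀ hGs0.le hGs1
    have h4 : δ ^ 2 * (G * s) ^ 2 ≤ δ * 1 := by
      have : δ ^ 2 ≤ δ := by nlinarith
      have : (G * s) ^ 2 ≤ 1 := pow_le_one₀ hGs0.le hGs1
      gcongr
    have h5 : (1 + δ) ^ 2 * (G * s) ^ 2
        = (G * s) ^ 2 + 2 * (δ * (G * s) ^ 2) + δ ^ 2 * (G * s) ^ 2 := by ring
    linarith

/-- Near a circular orbit of radius one. -/
theorem near_circular {q v : ℂ} {α s : ℝ} (hα : 0 < α) (hα4 : α ≤ 1 / 4) (hs : 0 ≤ s)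
    (hsα : s / α ≤ 1 / 100) (hr : |‖q‖ - 1| ≤ s) (hR : |α * (inner ℝ q v / ‖q‖)| ≤ s)
    (hΛ : |cross q v - 1| ≤ s / α) :
    ‖v - Complex.I * q‖ ≤ 5 * (s / α) ∧ |‖q‖ ^ 2 - 1| ≤ 5 * (s / α) ∧
      ‖q - invSq q‖ ≤ 5 * (s / α) ∧ ‖q‖ ≤ 11 / 10 ∧ 9 / 10 ≤ ‖q‖ ∧ ‖v‖ ≤ 2 := by
  set p := s / α with hp
  have hsp : s ≤ p / 4 := by
    rw [hp, div_div, le_div_iff₀ (by positivity)]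
    nlinarith
  have hp0 : 0 ≤ p := by positivity
  have hr' := abs_le.1 hr
  have n1 : ‖q‖ ≤ 11 / 10 := by linarith
  have n2 : 9 / 10 ≤ ‖q‖ := by linarith
  have hq0 : 0 < ‖q‖ := by linarith
  have hi : |inner ℝ q v| ≤ p * ‖q‖ := by
    rw [abs_mul, abs_of_pos hα, abs_div, abs_norm, mul_comm, ← le_div_iff₀ hα,
      div_le_iff₀ hq0] at hR
    exact hR
  have hr2 : |‖q‖ ^ 2 - 1| ≤ p := by
    have : ‖q‖ ^ 2 - 1 = (‖q‖ - 1) * (‖q‖ + 1) := by ring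
    rw [this, abs_mul, abs_of_pos (by linarith : 0 < ‖q‖ + 1)]
    calc _ ≤ s * (21 / 10) := by gcongr; linarith
      _ ≤ p := by linarith
  have e : conj q * (v - Complex.I * q)
      = ((inner ℝ q v : ℝ) : ℂ) + ((cross q v - ‖q‖ ^ 2 : ℝ) : ℂ) * Complex.I := by
    have h1 := conj_mul_eq q v
    have h2 := mul_conj_self q
    push_cast
    linear_combination h1 - Complex.I * h2
  have hv : ‖v - Complex.I * q‖ ≤ 5 * p := by
    have h1 := congrArg norm e
    rw [norm_mul, RCLike.norm_conj] at h1
    have h2 := norm_add_le ((inner ℝ q v : ℝ) : ℂ)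
      (((cross q v - ‖q‖ ^ 2 : ℝ) : ℂ) * Complex.I)
    rw [norm_mul, Complex.norm_I, Complex.norm_real, Complex.norm_real, Real.norm_eq_abs,
      Real.norm_eq_abs] at h2
    have h3 : |cross q v - ‖q‖ ^ 2| ≤ 2 * p := by
      have h3 := abs_le.1 hΛ
      have h4 := abs_le.1 hr2
      rw [abs_le]; constructor <;> linarith
    have h5 : p * ‖q‖ ≤ p * (11 / 10) := by gcongr
    nlinarith [norm_nonneg (v - Complex.I * q)]
  refine ⟨hv, by linarith, ?_, n1, n2, ?_⟩
  · have e2 : q - invSq q = (((‖q‖⁻¹ ^ 3) * ((‖q‖ - 1) * (‖q‖ ^ 2 + ‖q‖ + 1)) : ℝ) : ℂ) * q := by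
      have : (‖q‖⁻¹ ^ 3) * ((‖q‖ - 1) * (‖q‖ ^ 2 + ‖q‖ + 1)) = 1 - ‖q‖⁻¹ ^ 3 := by
        field_simp; ring
      rw [this, invSq_eq]; push_cast; ring
    have hi2 : ‖q‖⁻¹ ≤ 10 / 9 := by
      rw [inv_le_comm₀ hq0 (by norm_num)]; linarith
    rw [e2, norm_mul, Complex.norm_real, Real.norm_eq_abs, abs_mul, abs_mul,
      abs_of_pos (by positivity : 0 < ‖q‖⁻¹ ^ 3),
      abs_of_pos (by positivity : 0 < ‖q‖ ^ 2 + ‖q‖ + 1)]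
    calc _ = ‖q‖⁻¹ ^ 2 * (|‖q‖ - 1| * (‖q‖ ^ 2 + ‖q‖ + 1)) := by field_simp
      _ ≤ (10 / 9) ^ 2 * (p / 4 * ((11 / 10) ^ 2 + 11 / 10 + 1)) := by
        gcongr
        exact hr.trans hsp
      _ ≤ 5 * p := by linarith
  · have h3 := norm_le_norm_add_norm_sub' v (Complex.I * q)
    rw [norm_mul, Complex.norm_I, one_mul] at h3
    linarith

/-- The tidal force of a distant planet. -/
theorem norm_tide_le {M : Motion} {μ δ a t : ℝ} (h0 : 0 < μ) (h1 : μ < 1) (hδ : 0 < δ)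
    (ha : 0 < a) (ha' : a ≤ 1 / 100) (hX : 1 / 5 ≤ ‖(a : ℂ) * M.q2 μ t‖)
    (hq : ‖M.q1 t‖ ≤ 11 / 10) :
    ‖M.tide μ δ t‖ ≤ 4400 * δ * a ^ 3 := by
  have hac : (a : ℂ) ≠ 0 := by exact_mod_cast ha.ne'
  set X := (a : ℂ) * M.q2 μ t with hXdef
  have nz : ‖(a : ℂ) * M.q1 t‖ ≤ a * (11 / 10) := by
    rw [norm_mul, Complex.norm_real, Real.norm_of_nonneg ha.le]; gcongr
  have hμ1 : 0 < 1 - μ := by linarith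
  have e : M.tide μ δ t = ((δ * a ^ 2 : ℝ) : ℂ) * (invSq (X + μ * ((a : ℂ) * M.q1 t))
      - invSq (X - ((1 - μ : ℝ) : ℂ) * ((a : ℂ) * M.q1 t))) := by
    have e1 : M.q2 μ t + μ * M.q1 t
        = ((a⁻¹ : ℝ) : ℂ) * (X + μ * ((a : ℂ) * M.q1 t)) := by
      rw [hXdef]; push_cast; field_simp
    have e2 : M.q2 μ t - ((1 - μ : ℝ) : ℂ) * M.q1 t
        = ((a⁻¹ : ℝ) : ℂ) * (X - ((1 - μ : ℝ) : ℂ) * ((a : ℂ) * M.q1 t)) := by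
      rw [hXdef]; push_cast; field_simp
    rw [Motion.tide, e1, e2, invSq_real_mul (inv_pos.2 ha), invSq_real_mul (inv_pos.2 ha), inv_inv]
    push_cast
    ring
  have n1 : ‖(μ : ℂ) * ((a : ℂ) * M.q1 t)‖ ≤ 1 * (a * (11 / 10)) := by
    rw [norm_mul, Complex.norm_real, Real.norm_of_nonneg h0.le]; gcongr
  have n2 : ‖((1 - μ : ℝ) : ℂ) * ((a : ℂ) * M.q1 t)‖ ≤ 1 * (a * (11 / 10)) := by
    rw [norm_mul, Complex.norm_real, Real.norm_of_nonneg hμ1.le]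
    gcongr; linarith
  have l1 := norm_sub_le_norm_add X ((μ : ℂ) * ((a : ℂ) * M.q1 t))
  have l2 := norm_sub_norm_le X (((1 - μ : ℝ) : ℂ) * ((a : ℂ) * M.q1 t))
  have b := norm_invSq_sub_le (P := X + μ * ((a : ℂ) * M.q1 t))
    (Q := X - ((1 - μ : ℝ) : ℂ) * ((a : ℂ) * M.q1 t)) (by linarith) (by linarith)
  have e3 : X + μ * ((a : ℂ) * M.q1 t) - (X - ((1 - μ : ℝ) : ℂ) * ((a : ℂ) * M.q1 t))
      = (a : ℂ) * M.q1 t := by push_cast; ring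
  rw [e3] at b
  rw [e, norm_mul, Complex.norm_real, Real.norm_of_nonneg (by positivity)]
  calc _ ≤ (δ * a ^ 2) * (4000 * (a * (11 / 10))) := by gcongr; exact b.trans (by gcongr)
    _ = _ := by ring


theorem binaryForce_real_mul {c : ℝ} (hc : 0 < c) (μ : ℝ) (X z : ℂ) :
    binaryForce μ (c * X) (c * z) = (c⁻¹ ^ 2 : ℝ) * binaryForce μ X z := by
  have e1 : (c : ℂ) * X + μ * (c * z) = c * (X + μ * z) := by ring
  have e2 : (c : ℂ) * X - ((1 - μ : ℝ) : ℂ) * (c * z) = c * (X - ((1 - μ : ℝ) : ℂ) * z) := by ring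
  rw [binaryForce, e1, e2, invSq_real_mul hc, invSq_real_mul hc, binaryForce]
  ring

/-- The rescaled position of the planet, of size one when `ε = h ^ 3`. -/
noncomputable def Motion.scaledPos (M : Motion) (μ δ h t : ℝ) : ℂ :=
  (((1 + δ) * h ^ 2 : ℝ) : ℂ) * M.q2 μ t

/-- The rescaled velocity of the planet, of size one when `ε = h ^ 3`. -/
noncomputable def Motion.scaledVel (M : Motion) (h t : ℝ) : ℂ := ((h⁻¹ : ℝ) : ℂ) * M.vP t

/-- The rescaled deviation of the attraction of the planet from that of a point mass. -/
noncomputable def Motion.scaledForce (M : Motion) (μ δ h t : ℝ) : ℂ :=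
  binaryForce μ (M.scaledPos μ δ h t) ((((1 + δ) * h ^ 2 : ℝ) : ℂ) * M.q1 t)
    - invSq (M.scaledPos μ δ h t)

namespace IsThreeBodySolution

variable {μ δ h : ℝ} {M : Motion}

theorem hasDerivAt_scaledPos (H : IsThreeBodySolution μ δ M) (hh : 0 < h) (t : ℝ) :
    HasDerivAt (M.scaledPos μ δ h) ((((1 + δ) ^ 2 * h ^ 3 : ℝ) : ℂ) * M.scaledVel h t) t := by
  refine ((H.hasDerivAt_q2 t).const_mul (((1 + δ) * h ^ 2 : ℝ) : ℂ)).congr_deriv ?_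
  have : (h : ℂ) ≠ 0 := by exact_mod_cast hh.ne'
  rw [Motion.scaledVel]
  push_cast
  field_simp

theorem hasDerivAt_scaledVel (H : IsThreeBodySolution μ δ M) (hδ : 0 < δ) (hh : 0 < h) (t : ℝ) :
    HasDerivAt (M.scaledVel h) (-((((1 + δ) ^ 2 * h ^ 3 : ℝ) : ℂ) *
      (invSq (M.scaledPos μ δ h t) + M.scaledForce μ δ h t))) t := by
  refine ((H.hasDerivAt_vP t).const_mul ((h⁻¹ : ℝ) : ℂ)).congr_deriv ?_
  have ha : 0 < (1 + δ) * h ^ 2 := by positivity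
  have h1 : (h : ℂ) ≠ 0 := by exact_mod_cast hh.ne'
  have h2 : (1 + δ : ℂ) ≠ 0 := by
    have : (1 + δ) ≠ 0 := by positivity
    exact_mod_cast this
  rw [Motion.scaledForce, Motion.scaledPos, binaryForce_real_mul ha]
  push_cast
  field_simp
  ring

end IsThreeBodySolution

/-- The relations between the parameters that hold once `h = ε ^ (1 / 3)` is small. -/
structure SmallParams (μ δ C e₀ h η : ℝ) (k m : ℕ) : Prop where
  μ_pos : 0 < μ
  μ_lt : μ < 1
  C_pos : 0 < C
  e₀_pos : 0 < e₀
  k_pos : 0 < k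
  m_pos : 0 < m
  h_pos : 0 < h
  h_le : h ≤ 1 / 1000
  h_cube : h ^ 3 = (k : ℝ) / m
  δ_pos : 0 < δ
  δ_le : δ ≤ h ^ 8
  δ_le' : δ ≤ e₀ ^ 2 / 6
  C_le : C * h ≤ 1 / 10
  C_sqrt_le : C * Real.sqrt δ ≤ h ^ 3
  C_δ_le : C * δ ≤ h ^ 7
  α_le : h / (μ * (1 - μ)) ≤ 1 / 100
  η_le : η ≤ 1 / 10
  -- The first summand absorbs the drift of the planet's elements over a period, the second the
  -- multipole remainder, the time scale and the tide, the third the noncircularity of Jupiter's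
  -- orbit.
  le_η : 70000000 * k * h + 100000000 * h + 10 * (h / (μ * (1 - μ))) ≤ η

/-! ### A priori bounds for the background motion -/

section Background

variable {μ δ C e₀ eP T h η : ℝ} {k m : ℕ} {M : Motion}

theorem SmallParams.δ_small (S : SmallParams μ δ C e₀ h η k m) : δ ≤ 1 / 100 := by
  have := S.h_pos
  calc δ ≤ h ^ 8 := S.δ_le
    _ ≤ (1 / 1000) ^ 8 := by gcongr; exact S.h_le
    _ ≤ _ := by norm_num

theorem SmallParams.α_bounds (S : SmallParams μ δ C e₀ h η k m) :
    0 < μ * (1 - μ) ∧ μ * (1 - μ) ≤ 1 / 4 :=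
  ⟨mul_pos S.μ_pos (by linarith [S.μ_lt]), by nlinarith [sq_nonneg (μ - 1 / 2)]⟩

theorem SmallParams.scale_bounds (S : SmallParams μ δ C e₀ h η k m) :
    h ^ 2 ≤ (1 + δ) * h ^ 2 ∧ (1 + δ) * h ^ 2 ≤ 2 * h ^ 2 ∧ (1 + δ) * h ^ 2 ≤ 1 / 100 ∧
    h ^ 3 ≤ (1 + δ) ^ 2 * h ^ 3 ∧ (1 + δ) ^ 2 * h ^ 3 ≤ 2 * h ^ 3 := by
  have h1 := S.δ_small
  have h2 := S.δ_pos
  have h3 := S.h_pos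
  have h4 : 0 < h ^ 2 := by positivity
  have h5 : 0 < h ^ 3 := by positivity
  have h6 : h ^ 2 ≤ (1 / 1000) ^ 2 := by gcongr; exact S.h_le
  have h7 : (1 + δ) ^ 2 ≤ 2 := by nlinarith
  have h8 : (1 : ℝ) ≤ (1 + δ) ^ 2 := by nlinarith
  exact ⟨by nlinarith, by nlinarith, by nlinarith, by nlinarith, by nlinarith⟩

/-- Since `h³ m = k`, the quantity `h³ T` is `2πk` up to `h³ C ≤ 1 / 10`. -/
theorem IsBackgroundMotion.period_bounds (H : IsBackgroundMotion μ δ k m C eP T M)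
    (S : SmallParams μ δ C e₀ h η k m) : 5 * k ≤ h ^ 3 * T ∧ h ^ 3 * T ≤ 8 * k := by
  have hm : (0 : ℝ) < m := by exact_mod_cast S.m_pos
  have hk : (1 : ℝ) ≤ k := by exact_mod_cast S.k_pos
  have hh := S.h_pos
  have e : h ^ 3 * m = k := by rw [S.h_cube]; field_simp
  have h1 := abs_le.1 H.period_near
  have h2 : h ^ 3 * C ≤ 1 / 10 := by
    calc h ^ 3 * C = (C * h) * h ^ 2 := by ring
      _ ≤ (1 / 10) * 1 := by
        gcongr
        · exact S.C_le
        · exact pow_le_one₀ hh.le (by linarith [S.h_le])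
      _ = _ := by norm_num
  have h3 := mul_le_mul_of_nonneg_left h1.1 (by positivity : 0 ≤ h ^ 3)
  have h4 := mul_le_mul_of_nonneg_left h1.2 (by positivity : 0 ≤ h ^ 3)
  have h5 : h ^ 3 * (T - 2 * Real.pi * m) = h ^ 3 * T - 2 * Real.pi * k := by
    rw [← e]; ring
  rw [h5] at h3 h4
  have h6 : 3 * (k : ℝ) ≤ Real.pi * k := by gcongr; exact Real.pi_gt_three.le
  have h7 : Real.pi * k ≤ 3.15 * (k : ℝ) := by gcongr; exact Real.pi_lt_d2.le
  constructor <;> linarith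

theorem IsBackgroundMotion.norm_q1_bounds (H : IsBackgroundMotion μ δ k m C eP T M)
    (S : SmallParams μ δ C e₀ h η k m) (t : ℝ) : |‖M.q1 t‖ - 1| ≤ h ^ 3 ∧
      ‖M.q1 t‖ ≤ 11 / 10 := by
  have h1 := (H.r_near t).trans S.C_sqrt_le
  have hh := S.h_pos
  have h2 : h ^ 3 ≤ (1 / 1000) ^ 3 := by gcongr; exact S.h_le
  refine ⟨h1, ?_⟩
  have := (abs_le.1 h1).2
  rw [Motion.r] at this
  linarith

/-- The equivariance of a background motion under the time shift by its period. -/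
theorem IsBackgroundMotion.exists_rotation (H : IsBackgroundMotion μ δ k m C eP T M) (h : ℝ) :
    ∃ u : ℂ, ‖u‖ = 1 ∧ (∀ t, M.q1 (t + T) = u * M.q1 t) ∧ (∀ t, M.v1 (t + T) = u * M.v1 t) ∧
      (∀ t, M.scaledPos μ δ h (t + T) = u * M.scaledPos μ δ h t) ∧
      (∀ t, M.scaledVel h (t + T) = u * M.scaledVel h t) := by
  obtain ⟨ψ, hψ⟩ := H.relPeriodic
  set u := Complex.exp (ψ * Complex.I) with hu
  have h1 : ∀ t, M.q1 (t + T) = u * M.q1 t := fun t => by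
    obtain ⟨a, b, -⟩ := hψ t
    rw [Motion.q1, Motion.q1, a, b]; ring
  have h2 := vel_equivariant H.deriv_qP (fun t => (hψ t).2.2)
  refine ⟨u, Complex.norm_exp_ofReal_mul_I ψ, h1,
    vel_equivariant H.toIsThreeBodySolution.hasDerivAt_q1 h1, fun t => ?_, fun t => ?_⟩
  · rw [Motion.scaledPos, Motion.scaledPos, H.toIsThreeBodySolution.q2_eq,
      H.toIsThreeBodySolution.q2_eq, (hψ t).2.2]
    ring
  · rw [Motion.scaledVel, Motion.scaledVel, h2]
    ring

theorem IsBackgroundMotion.initial (H : IsBackgroundMotion μ δ k m C eP T M)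
    (S : SmallParams μ δ C e₀ h η k m) (he : e₀ ≤ eP) (he' : eP < 1 / 2) :
    7 / 10 ≤ cross (M.scaledPos μ δ h 0) (M.scaledVel h 0) ∧
    cross (M.scaledPos μ δ h 0) (M.scaledVel h 0) ≤ 13 / 10 ∧
    ‖lrl (M.scaledPos μ δ h 0) (M.scaledVel h 0)‖ ≤ 3 / 5 ∧
    e₀ ^ 2 / 2 ≤ ‖lrl (M.scaledPos μ δ h 0) (M.scaledVel h 0)‖ ^ 2 := by
  have hL := H.L_near
  have hh := S.h_pos
  have e : ((k : ℝ) / m) ^ (-(1 / 3) : ℝ) = h⁻¹ := by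
    rw [← S.h_cube, ← Real.rpow_natCast, ← Real.rpow_mul hh.le]
    norm_num
    exact Real.rpow_neg_one h
  rw [e] at hL
  exact planet_initial hh S.δ_pos S.δ_small S.δ_le' hL S.C_le H.G_pos H.ecc_eq S.e₀_pos he he'
    rfl rfl

/-- Over one period the elements of the planet are nearly constant. -/
theorem IsBackgroundMotion.confined (H : IsBackgroundMotion μ δ k m C eP T M)
    (S : SmallParams μ δ C e₀ h η k m) (he : e₀ ≤ eP) (he' : eP < 1 / 2) :
    ∀ t ∈ Set.Icc 0 T, M.scaledPos μ δ h t ≠ 0 ∧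
      |cross (M.scaledPos μ δ h t) (M.scaledVel h t)
        - cross (M.scaledPos μ δ h 0) (M.scaledVel h 0)| ≤ η ∧
      ‖lrl (M.scaledPos μ δ h t) (M.scaledVel h t)
        - lrl (M.scaledPos μ δ h 0) (M.scaledVel h 0)‖ ≤ η := by
  have hh := S.h_pos
  have hδ := S.δ_pos
  obtain ⟨a1, a2, a3, a4, a5⟩ := S.scale_bounds
  obtain ⟨T1, T2⟩ := H.period_bounds S
  obtain ⟨g1, g2, g3, -⟩ := H.initial S he he'
  set a := (1 + δ) * h ^ 2 with ha
  set κ := (1 + δ) ^ 2 * h ^ 3 with hκ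
  have ha0 : 0 < a := by positivity
  have hκ0 : 0 < κ := by positivity
  have hα0 : 0 ≤ h / (μ * (1 - μ)) := div_nonneg hh.le S.α_bounds.1.le
  have hsmall : 24 * κ * (40000 * a ^ 2) * T ≤ η := by
    have hT := H.period_pos
    have h4 : h ^ 4 ≤ h := by
      calc h ^ 4 = h ^ 3 * h := by ring
        _ ≤ 1 * h := by
          gcongr
          exact pow_le_one₀ hh.le (by linarith [S.h_le])
        _ = h := one_mul h
    calc _ ≤ 24 * (2 * h ^ 3) * (40000 * (2 * h ^ 2) ^ 2) * T := by gcongr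
      _ = 7680000 * h ^ 4 * (h ^ 3 * T) := by ring
      _ ≤ 7680000 * h * (8 * k) := by gcongr
      _ ≤ η := by
        have := S.le_η
        have : (0 : ℝ) ≤ k * h := by positivity
        linarith
  have key := kepler_confined (X := M.scaledPos μ δ h) (Y := M.scaledVel h)
    (E := M.scaledForce μ δ h) (κ := κ) (B := 40000 * a ^ 2) (T := T) hκ0 (by positivity)
    (H.toIsThreeBodySolution.hasDerivAt_scaledPos hh)
    (H.toIsThreeBodySolution.hasDerivAt_scaledVel hδ hh)
    (fun t ht => (norm_binaryForce_sub_invSq_le S.μ_pos S.μ_lt ha0 a3 ht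
      (H.norm_q1_bounds S t).2).2)
    g1 g2 g3 (hsmall.trans S.η_le)
  intro t ht
  obtain ⟨b1, b2, b3⟩ := key t ht
  have hle : 24 * κ * (40000 * a ^ 2) * t ≤ η := by
    refine le_trans ?_ hsmall
    have := ht.2
    gcongr
  exact ⟨b1, b2.trans hle, b3.trans hle⟩

/-- Distance and angular momentum are invariant under rotation, hence periodic, so the confinement
on one period holds for all times. -/
theorem IsBackgroundMotion.planet_bounds (H : IsBackgroundMotion μ δ k m C eP T M)
    (S : SmallParams μ δ C e₀ h η k m) (he : e₀ ≤ eP) (he' : eP < 1 / 2) (t : ℝ) :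
    1 / 5 ≤ ‖M.scaledPos μ δ h t‖ ∧ ‖M.scaledPos μ δ h t‖ ≤ 7 ∧
      |cross (M.scaledPos μ δ h t) (M.scaledVel h t)| ≤ 7 / 5 := by
  obtain ⟨u, hu, -, -, hX, hY⟩ := H.exists_rotation h
  have p1 : Function.Periodic (fun s => ‖M.scaledPos μ δ h s‖) T := fun s => by
    simp only [hX, norm_mul, hu, one_mul]
  have p2 : Function.Periodic
      (fun s => |cross (M.scaledPos μ δ h s) (M.scaledVel h s)|) T := fun s => by
    simp only [hX, hY, cross_mul_mul hu]
  have p3 : Function.Periodic (fun s => (‖M.scaledPos μ δ h s‖,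
      |cross (M.scaledPos μ δ h s) (M.scaledVel h s)|)) T := fun s => Prod.ext (p1 s) (p2 s)
  obtain ⟨s, hs, e⟩ := p3.exists_mem_Ico₀ H.period_pos t
  obtain ⟨e1, e2⟩ := Prod.ext_iff.1 e
  simp only at e1 e2
  rw [e1, e2]
  obtain ⟨g1, g2, g3, -⟩ := H.initial S he he'
  obtain ⟨b1, b2, b3⟩ := H.confined S he he' s ⟨hs.1, hs.2.le⟩
  have hη := S.η_le
  have b4 := abs_le.1 (b2.trans hη)
  have b5 : ‖lrl (M.scaledPos μ δ h s) (M.scaledVel h s)‖ ≤ 7 / 10 := by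
    have := norm_le_norm_add_norm_sub' (lrl (M.scaledPos μ δ h s) (M.scaledVel h s))
      (lrl (M.scaledPos μ δ h 0) (M.scaledVel h 0))
    linarith
  obtain ⟨c1, c2, -⟩ := kepler_bounds b1 b5 (by linarith) (by linarith)
  exact ⟨c1, c2, abs_le.2 ⟨by linarith, by linarith⟩⟩

theorem IsBackgroundMotion.abs_cross_q2_le (H : IsBackgroundMotion μ δ k m C eP T M)
    (S : SmallParams μ δ C e₀ h η k m) (he : e₀ ≤ eP) (he' : eP < 1 / 2) (t : ℝ) :
    |cross (M.q2 μ t) (M.vP t)| ≤ 7 / 5 / h := by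
  obtain ⟨-, -, b⟩ := H.planet_bounds S he he' t
  have hh := S.h_pos
  have hδ := S.δ_pos
  rw [Motion.scaledPos, Motion.scaledVel, cross_real_mul_mul, abs_mul,
    abs_of_pos (by positivity)] at b
  have e : (1 + δ) * h ^ 2 * h⁻¹ = (1 + δ) * h := by field_simp
  rw [e] at b
  rw [le_div_iff₀ hh]
  have h1 := abs_nonneg (cross (M.q2 μ t) (M.vP t))
  nlinarith [mul_nonneg h1 (mul_nonneg hδ.le hh.le)]

/-- The planet carries angular momentum of order `δ/h`; subtracting it from the total leaves that of
the pair. This is the origin of the order `δ/h`. -/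
theorem IsBackgroundMotion.abs_cross_q1_sub_le (H : IsBackgroundMotion μ δ k m C eP T M)
    (S : SmallParams μ δ C e₀ h η k m) (he : e₀ ≤ eP) (he' : eP < 1 / 2) (t : ℝ) :
    |cross (M.q1 t) (M.v1 t) - 1| ≤ (C * δ + 7 / 5 * δ / h) / (μ * (1 - μ)) := by
  have h1 := H.angularMomentum_near t
  rw [H.toIsThreeBodySolution.angularMomentum_eq] at h1
  have h2 := H.abs_cross_q2_le S he he' t
  have h3 : |δ * cross (M.q2 μ t) (M.vP t)| ≤ δ * (7 / 5 / h) := by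
    rw [abs_mul, abs_of_pos S.δ_pos]
    have := S.δ_pos
    gcongr
  obtain ⟨α0, -⟩ := S.α_bounds
  rw [le_div_iff₀ α0]
  have e : |cross (M.q1 t) (M.v1 t) - 1| * (μ * (1 - μ))
      = |(μ * (1 - μ) * cross (M.q1 t) (M.v1 t) + δ * cross (M.q2 μ t) (M.vP t)
        - μ * (1 - μ)) - δ * cross (M.q2 μ t) (M.vP t)| := by
    rw [← abs_of_pos α0, ← abs_mul, abs_of_pos α0]
    congr 1
    ring
  rw [e]
  refine (abs_sub _ _).trans ?_
  have : δ * (7 / 5 / h) = 7 / 5 * δ / h := by ring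
  linarith

/-- These bounds use only the weak hypotheses of order `√δ`. They are enough for the precession of
the planet, from which the sharp bounds are then deduced. -/
theorem IsBackgroundMotion.near_circular (H : IsBackgroundMotion μ δ k m C eP T M)
    (S : SmallParams μ δ C e₀ h η k m) (he : e₀ ≤ eP) (he' : eP < 1 / 2) (t : ℝ) :
    ‖M.v1 t - Complex.I * M.q1 t‖ ≤ 5 * (h ^ 3 / (μ * (1 - μ))) ∧
    |‖M.q1 t‖ ^ 2 - 1| ≤ 5 * (h ^ 3 / (μ * (1 - μ))) ∧
    ‖M.q1 t - invSq (M.q1 t)‖ ≤ 5 * (h ^ 3 / (μ * (1 - μ))) ∧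
    ‖M.q1 t‖ ≤ 11 / 10 ∧ 9 / 10 ≤ ‖M.q1 t‖ ∧ ‖M.v1 t‖ ≤ 2 := by
  obtain ⟨α0, α4⟩ := S.α_bounds
  have hh := S.h_pos
  have h1 : h ≤ 1 := by linarith [S.h_le]
  have h3 : h ^ 3 ≤ h := by
    calc h ^ 3 = h * h ^ 2 := by ring
      _ ≤ h * 1 := by gcongr; exact pow_le_one₀ hh.le h1
      _ = h := mul_one h
  refine FourBody.near_circular α0 α4 (by positivity) ?_ (H.norm_q1_bounds S t).1 ?_ ?_
  · exact le_trans (by gcongr) S.α_le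
  · exact (H.R_near t).trans S.C_sqrt_le
  · refine (H.abs_cross_q1_sub_le S he he' t).trans ?_
    gcongr
    have h8 : δ / h ≤ h ^ 7 := by
      rw [div_le_iff₀ hh]
      calc δ ≤ h ^ 8 := S.δ_le
        _ = h ^ 7 * h := by ring
    have h7 : h ^ 7 ≤ h ^ 3 * (1 / 1000) := by
      calc h ^ 7 = h ^ 3 * (h ^ 3 * h) := by ring
        _ ≤ h ^ 3 * (1 * (1 / 1000)) := by
          gcongr
          · exact pow_le_one₀ hh.le h1
          · exact S.h_le
        _ = _ := by ring
    have : 7 / 5 * δ / h = 7 / 5 * (δ / h) := by ring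
    have := S.C_δ_le
    have : 0 < h ^ 3 := by positivity
    linarith

theorem IsBackgroundMotion.norm_tide_le (H : IsBackgroundMotion μ δ k m C eP T M)
    (S : SmallParams μ δ C e₀ h η k m) (he : e₀ ≤ eP) (he' : eP < 1 / 2) (t : ℝ) :
    ‖M.tide μ δ t‖ ≤ 40000 * δ * h ^ 6 := by
  obtain ⟨a1, a2, a3, -⟩ := S.scale_bounds
  have hh := S.h_pos
  have hδ := S.δ_pos
  refine (FourBody.norm_tide_le S.μ_pos S.μ_lt S.δ_pos (by positivity) a3
    (H.planet_bounds S he he' t).1 (H.norm_q1_bounds S t).2).trans ?_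
  calc _ ≤ 4400 * δ * (2 * h ^ 2) ^ 3 := by gcongr
    _ = 35200 * (δ * h ^ 6) := by ring
    _ ≤ 40000 * (δ * h ^ 6) := by gcongr; norm_num
    _ = _ := by ring

end Background


/-! ### Rotation per period and the eccentricity of Jupiter's orbit -/

section Background

variable {μ δ C e₀ eP T h η : ℝ} {k m : ℕ} {M : Motion}

/-- The apsidal precession of the planet bounds the rotation over one period from below. -/
theorem exists_rotation_lower_bound : ∃ K : ℝ, 0 < K ∧
    ∀ {μ δ C e₀ eP T h η : ℝ} {k m : ℕ} {M : Motion} {u : ℂ},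
    IsBackgroundMotion μ δ k m C eP T M → SmallParams μ δ C e₀ h η k m → e₀ ≤ eP → eP < 1 / 2 →
    K * η ≤ μ * (1 - μ) * e₀ ^ 2 / 2400 → ‖u‖ = 1 →
    (∀ t, M.scaledPos μ δ h (t + T) = u * M.scaledPos μ δ h t) →
    (∀ t, M.scaledVel h (t + T) = u * M.scaledVel h t) →
    μ * (1 - μ) * e₀ ^ 2 / 2400 * h ^ 4 ≤ ‖u - 1‖ := by
  obtain ⟨K, hK, key⟩ := exists_precession_estimate
  refine ⟨K, hK, ?_⟩
  intro μ δ C e₀ eP T h η k m M u H S he he' hKη hu hX hY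
  obtain ⟨α0, α4⟩ := S.α_bounds
  have hh := S.h_pos
  have h1 : h ≤ 1 := by linarith [S.h_le]
  have hδ := S.δ_pos
  obtain ⟨a1, a2, a3, a4, a5⟩ := S.scale_bounds
  obtain ⟨T1, -⟩ := H.period_bounds S
  obtain ⟨g1, g2, g3, g4⟩ := H.initial S he he'
  have hk : (1 : ℝ) ≤ k := by exact_mod_cast S.k_pos
  have hle := S.le_η
  have hη := S.η_le
  have hkh : 0 ≤ (k : ℝ) * h := by positivity
  have hα0 : 0 ≤ h / (μ * (1 - μ)) := by positivity
  have h2h : h ^ 2 ≤ h := by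
    calc h ^ 2 = h * h := by ring
      _ ≤ h * 1 := by gcongr
      _ = h := mul_one h
  have h3h : h ^ 3 ≤ h := by
    calc h ^ 3 = h * h ^ 2 := by ring
      _ ≤ h * 1 := by gcongr; exact pow_le_one₀ hh.le h1
      _ = h := mul_one h
  have h3α : h ^ 3 / (μ * (1 - μ)) ≤ h / (μ * (1 - μ)) := by gcongr
  set a := (1 + δ) * h ^ 2 with ha
  set κ := (1 + δ) ^ 2 * h ^ 3 with hκ
  have ha0 : 0 < a := by positivity
  have hκ0 : 0 < κ := by positivity
  have hκη : κ ≤ η := by linarith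
  have circ := H.near_circular S he he'
  have tide : ∀ t, ‖M.tide μ δ t‖ ≤ h := fun t => by
    refine (H.norm_tide_le S he he' t).trans ?_
    have : h ^ 6 ≤ (1 / 1000) ^ 6 := by gcongr; exact S.h_le
    have hδh : δ ≤ h := by
      calc δ ≤ h ^ 8 := S.δ_le
        _ = h * h ^ 7 := by ring
        _ ≤ h * 1 := by gcongr; exact pow_le_one₀ hh.le h1
        _ = h := mul_one h
    calc 40000 * δ * h ^ 6 ≤ 40000 * h * (1 / 1000) ^ 6 := by gcongr
      _ ≤ h := by linarith
  have hX0 : ∀ t, M.scaledPos μ δ h t ≠ 0 := fun t h0 => by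
    have := (H.planet_bounds S he he' t).1
    rw [h0, norm_zero] at this
    norm_num at this
  have force : ∀ t, _ := fun t => norm_binaryForce_sub_invSq_le S.μ_pos S.μ_lt ha0 a3
    (H.planet_bounds S he he' t).1 (H.norm_q1_bounds S t).2
  have main := key (M.scaledPos μ δ h) (M.scaledVel h) M.q1 M.v1 (M.scaledForce μ δ h)
    (fun t => -(invSq (M.q1 t) + M.tide μ δ t)) u κ a (μ * (1 - μ)) η T hκ0 α0 α4 hκη hη
    H.period_pos.le hX0 (H.toIsThreeBodySolution.hasDerivAt_scaledPos hh)
    (H.toIsThreeBodySolution.hasDerivAt_scaledVel hδ hh)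
    H.toIsThreeBodySolution.hasDerivAt_q1 H.toIsThreeBodySolution.hasDerivAt_v1
    (fun t _ => (force t).2.trans (by
      have : a ^ 2 ≤ (2 * h ^ 2) ^ 2 := by gcongr
      have : h ^ 4 ≤ (1 / 1000) ^ 4 := by gcongr; exact S.h_le
      linarith [show (2 * h ^ 2) ^ 2 = 4 * h ^ 4 by ring]))
    (fun t _ => (force t).1.trans (by gcongr; linarith))
    (fun t _ => (circ t).1.trans (by linarith))
    (fun t _ => by
      have e : -(invSq (M.q1 t) + M.tide μ δ t) + M.q1 t
          = (M.q1 t - invSq (M.q1 t)) - M.tide μ δ t := by ring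
      rw [e]
      refine (norm_sub_le _ _).trans ?_
      linarith [(circ t).2.2.1, tide t])
    (fun t _ => (circ t).2.1.trans (by linarith))
    g1 g2 g3 (fun t ht => (H.confined S he he' t ht).2.1)
    (fun t ht => (H.confined S he he' t ht).2.2) hu (by simpa using hX 0) (by simpa using hY 0)
  -- Since `‖lrl‖² ≥ e₀²/2`, the precession coefficient is at least `2β`; the error `K * η` consumes
  -- at most one `β`.
  set β := μ * (1 - μ) * e₀ ^ 2 / 2400 with hβ
  have hβ0 : 0 < β := by
    have := S.e₀_pos
    positivity
  have c1 : 2 * β ≤ μ * (1 - μ)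
      * ‖lrl (M.scaledPos μ δ h 0) (M.scaledVel h 0)‖ ^ 2 / 600 := by
    have := mul_le_mul_of_nonneg_left g4 α0.le
    rw [hβ]
    linarith
  have c2 : K * (κ * a ^ 2) ≤ β * a ^ 2 := by
    have : K * κ ≤ β := le_trans (by gcongr) hKη
    calc _ = (K * κ) * a ^ 2 := by ring
      _ ≤ _ := by gcongr
  have c3 : 5 ≤ κ * T := by
    have := H.period_pos
    calc (5 : ℝ) ≤ 5 * k := by linarith
      _ ≤ h ^ 3 * T := T1
      _ ≤ _ := by gcongr
  have c4 : 5 * (a ^ 2 * β) ≤ κ * a ^ 2 * (μ * (1 - μ)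
      * ‖lrl (M.scaledPos μ δ h 0) (M.scaledVel h 0)‖ ^ 2 / 600 - K * η) * T := by
    calc 5 * (a ^ 2 * β) ≤ (κ * T) * (a ^ 2 * (μ * (1 - μ)
      * ‖lrl (M.scaledPos μ δ h 0) (M.scaledVel h 0)‖ ^ 2 / 600 - K * η)) := by
          have : 0 ≤ κ * T := by linarith
          gcongr
          linarith
      _ = _ := by ring
  have c5 : (1 + 3 * a ^ 2) * ‖u - 1‖ ≤ 4 * ‖u - 1‖ := by
    have : a ^ 2 ≤ 1 := pow_le_one₀ ha0.le (by linarith)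
    gcongr
    linarith
  -- So far `5 a² β ≤ 4 ‖u - 1‖ + a² β`, and `a ≥ h²`.
  have c6 : h ^ 4 * β ≤ a ^ 2 * β := by
    have : h ^ 4 = (h ^ 2) ^ 2 := by ring
    rw [this]
    gcongr
  linarith

theorem hasDerivAt_lrl_q1 (H : IsThreeBodySolution μ δ M) (t : ℝ) :
    HasDerivAt (fun s => lrl (M.q1 s) (M.v1 s)) (((1 : ℝ) : ℂ) * (Complex.I *
      (cross (M.q1 t) (M.tide μ δ t) * M.v1 t + cross (M.q1 t) (M.v1 t) * M.tide μ δ t))) t := by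
  refine hasDerivAt_lrl (H.q1_ne_zero t) ?_ ?_
  · simpa using H.hasDerivAt_q1 t
  · simpa using H.hasDerivAt_v1 t

theorem IsBackgroundMotion.abs_cross_q1_sub_le_const (H : IsBackgroundMotion μ δ k m C eP T M)
    (S : SmallParams μ δ C e₀ h η k m) (he : e₀ ≤ eP) (he' : eP < 1 / 2) (t : ℝ) :
    |cross (M.q1 t) (M.v1 t) - 1| ≤ 3 / 100 := by
  have hh := S.h_pos
  have h1 : h ≤ 1 := by linarith [S.h_le]
  obtain ⟨α0, -⟩ := S.α_bounds
  have c4 : (C * δ + 7 / 5 * δ / h) / (μ * (1 - μ)) ≤ 3 * (h / (μ * (1 - μ))) := by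
    rw [← mul_div_assoc]
    gcongr
    have e1 : δ / h ≤ h := by
      rw [div_le_iff₀ hh]
      calc δ ≤ h ^ 8 := S.δ_le
        _ = h * h * h ^ 6 := by ring
        _ ≤ h * h * 1 := by gcongr; exact pow_le_one₀ hh.le h1
        _ = h * h := mul_one _
    have e2 : C * δ ≤ h := by
      calc C * δ ≤ h ^ 7 := S.C_δ_le
        _ = h * h ^ 6 := by ring
        _ ≤ h * 1 := by gcongr; exact pow_le_one₀ hh.le h1
        _ = h := mul_one h
    have : 7 / 5 * δ / h = 7 / 5 * (δ / h) := by ring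
    linarith
  linarith [(H.abs_cross_q1_sub_le S he he' t).trans c4, S.α_le]

/-- The rotation over one period forces the eccentricity of Jupiter's orbit to be small. -/
theorem IsBackgroundMotion.norm_lrl_q1_le (H : IsBackgroundMotion μ δ k m C eP T M)
    (S : SmallParams μ δ C e₀ h η k m) (he : e₀ ≤ eP) (he' : eP < 1 / 2) {u : ℂ} {β : ℝ}
    (hu : ‖u‖ = 1) (hβ : 0 < β) (huβ : β * h ^ 4 ≤ ‖u - 1‖)
    (hq : ∀ t, M.q1 (t + T) = u * M.q1 t) (hv : ∀ t, M.v1 (t + T) = u * M.v1 t) (t : ℝ) :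
    ‖lrl (M.q1 t) (M.v1 t)‖ ≤ 8000000 * k / β * (δ / h) := by
  have hh := S.h_pos
  have h1 : h ≤ 1 := by linarith [S.h_le]
  have hδ := S.δ_pos
  obtain ⟨α0, -⟩ := S.α_bounds
  obtain ⟨-, T2⟩ := H.period_bounds S
  have bound : ∀ s, ‖((1 : ℝ) : ℂ) * (Complex.I * (cross (M.q1 s) (M.tide μ δ s) * M.v1 s
      + cross (M.q1 s) (M.v1 s) * M.tide μ δ s))‖ ≤ 23 * 1 * (40000 * δ * h ^ 6) := fun s => by
    obtain ⟨-, -, -, c1, -, c2⟩ := H.near_circular S he he' s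
    refine norm_lrl_deriv_le zero_le_one (by linarith) (by linarith) ?_ (H.norm_tide_le S he he' s)
    have c5 := abs_le.1 (H.abs_cross_q1_sub_le_const S he he' s)
    rw [abs_le]
    constructor <;> linarith
  -- By equivariance the change over one period is `(u - 1)` times the vector. It is `O(δ h⁶ T) =
  -- O(δ h³)`, and division by `β h⁴` gives the order `δ/h`.
  have mv := Convex.norm_image_sub_le_of_norm_hasDerivWithin_le
    (fun s _ => (hasDerivAt_lrl_q1 H.toIsThreeBodySolution s).hasDerivWithinAt)
    (fun s _ => bound s) convex_univ (Set.mem_univ t) (Set.mem_univ (t + T))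
  rw [hq, hv, lrl_mul_mul hu, add_sub_cancel_left, Real.norm_of_nonneg H.period_pos.le] at mv
  have e : u * lrl (M.q1 t) (M.v1 t) - lrl (M.q1 t) (M.v1 t)
      = (u - 1) * lrl (M.q1 t) (M.v1 t) := by ring
  rw [e, norm_mul] at mv
  have n0 := norm_nonneg (lrl (M.q1 t) (M.v1 t))
  have m1 : β * h ^ 4 * ‖lrl (M.q1 t) (M.v1 t)‖ ≤ 8000000 * k * (δ * h ^ 3) := by
    calc _ ≤ ‖u - 1‖ * ‖lrl (M.q1 t) (M.v1 t)‖ := by gcongr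
      _ ≤ 23 * 1 * (40000 * δ * h ^ 6) * T := mv
      _ = 920000 * (δ * h ^ 3) * (h ^ 3 * T) := by ring
      _ ≤ 920000 * (δ * h ^ 3) * (8 * k) := by gcongr
      _ = 7360000 * (k * (δ * h ^ 3)) := by ring
      _ ≤ 8000000 * (k * (δ * h ^ 3)) := by gcongr; norm_num
      _ = _ := by ring
  rw [div_mul_div_comm, le_div_iff₀ (by positivity)]
  have h3 : 0 < h ^ 3 := by positivity
  refine le_of_mul_le_mul_right ?_ h3
  calc _ = β * h ^ 4 * ‖lrl (M.q1 t) (M.v1 t)‖ := by ring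
    _ ≤ _ := m1
    _ = _ := by ring

theorem IsBackgroundMotion.norm_qP_bounds (H : IsBackgroundMotion μ δ k m C eP T M)
    (S : SmallParams μ δ C e₀ h η k m) (he : e₀ ≤ eP) (he' : eP < 1 / 2) (t : ℝ) :
    1 / 6 / h ^ 2 ≤ ‖M.qP t‖ ∧ ‖M.qP t‖ ≤ 7 / h ^ 2 ∧
      |cross (M.qP t) (M.vP t) / ‖M.qP t‖ ^ 2| ≤ 60 * h ^ 3 := by
  have hh := S.h_pos
  have hδ := S.δ_pos
  have hδ1 := S.δ_small
  obtain ⟨b1, b2, -⟩ := H.planet_bounds S he he' t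
  have b3 := H.abs_cross_q2_le S he he' t
  have e : ‖M.scaledPos μ δ h t‖ = (1 + δ) ^ 2 * (h ^ 2 * ‖M.qP t‖) := by
    rw [Motion.scaledPos, H.toIsThreeBodySolution.q2_eq, norm_mul, norm_mul, Complex.norm_real,
      Complex.norm_real, Real.norm_of_nonneg (by positivity), Real.norm_of_nonneg (by positivity)]
    ring
  rw [e] at b1 b2
  have n0 : 0 ≤ h ^ 2 * ‖M.qP t‖ := by positivity
  have c1 : (1 + δ) ^ 2 ≤ 6 / 5 := by nlinarith
  have c2 : (1 : ℝ) ≤ (1 + δ) ^ 2 := by nlinarith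
  have d1 : 1 / 6 ≤ h ^ 2 * ‖M.qP t‖ := by nlinarith
  have d2 : h ^ 2 * ‖M.qP t‖ ≤ 7 := by nlinarith
  have h2 : 0 < h ^ 2 := by positivity
  refine ⟨by rw [div_le_iff₀ h2]; linarith, by rw [le_div_iff₀ h2]; linarith, ?_⟩
  have n1 : 0 < ‖M.qP t‖ := by
    by_contra! hn
    nlinarith
  rw [H.toIsThreeBodySolution.q2_eq, cross_real_mul_left, abs_mul, abs_of_pos (by positivity),
    le_div_iff₀ hh] at b3
  have b4 : |cross (M.qP t) (M.vP t)| * h ≤ 7 / 5 := by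
    have := mul_nonneg hδ.le (mul_nonneg (abs_nonneg (cross (M.qP t) (M.vP t))) hh.le)
    linarith
  rw [abs_div, abs_of_pos (by positivity : 0 < ‖M.qP t‖ ^ 2), div_le_iff₀ (by positivity)]
  have d3 : (1 / 6) ^ 2 ≤ (h ^ 2 * ‖M.qP t‖) ^ 2 := by gcongr
  refine le_of_mul_le_mul_right ?_ hh
  calc _ ≤ 7 / 5 := b4
    _ ≤ 60 * (h ^ 2 * ‖M.qP t‖) ^ 2 := by linarith
    _ = _ := by ring

/-- With `Λ` the angular momentum per reduced mass, the conic equation `r + ⟨q, A⟩ = Λ²` controls `r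
- 1`, and then `Λ/r² - 1` is the defect of the angular speed. -/
theorem IsBackgroundMotion.circular_defects (H : IsBackgroundMotion μ δ k m C eP T M)
    (S : SmallParams μ δ C e₀ h η k m) (he : e₀ ≤ eP) (he' : eP < 1 / 2) {D t : ℝ} (hD : 0 < D)
    (hA : ‖lrl (M.q1 t) (M.v1 t)‖ ≤ D * (δ / h)) :
    |M.r t - 1| ≤ (3 * ((C + 2) / (μ * (1 - μ))) + 2 * D) * (δ / h) ∧
    |M.thetaDot t| ≤ (10 * ((C + 2) / (μ * (1 - μ))) + 6 * D) * (δ / h) := by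
  have hh := S.h_pos
  have h1 : h ≤ 1 := by linarith [S.h_le]
  have hδ := S.δ_pos
  have hC := S.C_pos
  obtain ⟨α0, -⟩ := S.α_bounds
  obtain ⟨-, -, -, n1, n2, -⟩ := H.near_circular S he he' t
  set B := (C + 2) / (μ * (1 - μ)) with hB
  set p := δ / h with hp
  have hp0 : 0 < p := by positivity
  have hB0 : 0 < B := by positivity
  have hΛ : |cross (M.q1 t) (M.v1 t) - 1| ≤ B * p := by
    refine (H.abs_cross_q1_sub_le S he he' t).trans ?_
    rw [hB, div_mul_eq_mul_div (C + 2)]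
    gcongr
    have e1 : δ ≤ p := by
      rw [hp, le_div_iff₀ hh]
      calc δ * h ≤ δ * 1 := by gcongr
        _ = δ := mul_one δ
    have e2 : C * δ ≤ C * p := by gcongr
    have : 7 / 5 * δ / h = 7 / 5 * p := by rw [hp]; ring
    linarith
  set Λ := cross (M.q1 t) (M.v1 t) with hΛdef
  have id1 := norm_add_inner_lrl (H.toIsThreeBodySolution.q1_ne_zero t) (M.v1 t)
  rw [← hΛdef] at id1
  have i1 : |inner ℝ (M.q1 t) (lrl (M.q1 t) (M.v1 t))| ≤ 11 / 10 * (D * p) :=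
    (abs_real_inner_le_norm _ _).trans (by gcongr)
  have i2 := abs_le.1 i1
  have hΛ' := abs_le.1 (H.abs_cross_q1_sub_le_const S he he' t)
  rw [← hΛdef] at hΛ'
  have hΛ2 : |Λ ^ 2 - 1| ≤ 21 / 10 * (B * p) := by
    have : Λ ^ 2 - 1 = (Λ - 1) * (Λ + 1) := by ring
    rw [this, abs_mul, abs_of_pos (by linarith : 0 < Λ + 1), mul_comm]
    gcongr
    linarith
  have hΛ2' := abs_le.1 hΛ2
  have hr : |‖M.q1 t‖ - 1| ≤ 21 / 10 * (B * p) + 11 / 10 * (D * p) := by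
    rw [abs_le]; constructor <;> linarith
  have hBp : 0 < B * p := by positivity
  have hDp : 0 < D * p := by positivity
  refine ⟨by rw [Motion.r]; linarith, ?_⟩
  have hr2 : |‖M.q1 t‖ ^ 2 - 1| ≤ 21 / 10 * (21 / 10 * (B * p) + 11 / 10 * (D * p)) := by
    have : ‖M.q1 t‖ ^ 2 - 1 = (‖M.q1 t‖ - 1) * (‖M.q1 t‖ + 1) := by ring
    rw [this, abs_mul, abs_of_pos (by linarith : 0 < ‖M.q1 t‖ + 1), mul_comm]
    gcongr
    linarith
  have e : M.thetaDot t = ((Λ - 1) - (‖M.q1 t‖ ^ 2 - 1)) / ‖M.q1 t‖ ^ 2 := by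
    have : ‖M.q1 t‖ ≠ 0 := by linarith
    rw [Motion.thetaDot, ← hΛdef]
    field_simp
    ring
  have h3 : 81 / 100 ≤ ‖M.q1 t‖ ^ 2 := by nlinarith
  rw [e, abs_div, abs_of_pos (by linarith : 0 < ‖M.q1 t‖ ^ 2), div_le_iff₀ (by linarith)]
  refine (abs_sub _ _).trans ?_
  have h4 : (10 * B + 6 * D) * p * (81 / 100) ≤ (10 * B + 6 * D) * p * ‖M.q1 t‖ ^ 2 := by gcongr
  linarith

end Background


/-- Sun, Jupiter and planet in a resonance of order `k` with the planet far away. -/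
theorem exists_background_estimates {μ C e₀ : ℝ} {k : ℕ} (hμ0 : 0 < μ) (hμ1 : μ < 1)
    (hC : 0 < C) (he₀ : 0 < e₀) (hk : 0 < k) :
    ∃ K : ℝ, 0 < K ∧ ∃ h₀ : ℝ, 0 < h₀ ∧ h₀ ≤ 1 ∧ ∀ (m : ℕ) (δ eP T h : ℝ) (M : Motion),
    0 < m → 0 < h → h < h₀ → h ^ 3 = (k : ℝ) / m → 0 < δ → δ ≤ C * h ^ 9 →
    e₀ ≤ eP → eP < 1 / 2 → IsBackgroundMotion μ δ k m C eP T M →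
    ∀ t, 1 / 6 / h ^ 2 ≤ ‖M.qP t‖ ∧ ‖M.qP t‖ ≤ 7 / h ^ 2 ∧
      |cross (M.qP t) (M.vP t) / ‖M.qP t‖ ^ 2| ≤ 60 * h ^ 3 ∧
      |M.r t - 1| ≤ K * (δ / h) ∧ |M.thetaDot t| ≤ K * (δ / h) := by
  obtain ⟨K₀, hK₀, hrot⟩ := exists_rotation_lower_bound
  have α0 : 0 < μ * (1 - μ) := mul_pos hμ0 (by linarith)
  have hk' : (0 : ℝ) < k := by exact_mod_cast hk
  set β := μ * (1 - μ) * e₀ ^ 2 / 2400 with hβ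
  have hβ0 : 0 < β := by positivity
  set N := 70000000 * (k : ℝ) + 100000000 + 10 / (μ * (1 - μ)) with hN
  have hN0 : 0 < N := by positivity
  set D := 8000000 * (k : ℝ) / β with hD
  have hD0 : 0 < D := by positivity
  set B := (C + 2) / (μ * (1 - μ)) with hB
  have hB0 : 0 < B := by positivity
  -- The threshold `W⁻¹` collects all smallness conditions, each of the form `x * h ≤ 1`; the
  -- parameter `η` of `SmallParams` will be `N * h`.
  set W := 1000 + 10 * C + 6 / e₀ ^ 2 + 100 / (μ * (1 - μ)) + 10 * N + K₀ * N / β with hW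
  have t1 : 0 < 6 / e₀ ^ 2 := by positivity
  have t2 : 0 < 100 / (μ * (1 - μ)) := by positivity
  have t3 : 0 < K₀ * N / β := by positivity
  have hW0 : 0 < W := by positivity
  refine ⟨10 * B + 6 * D, by positivity, W⁻¹, by positivity, ?_, ?_⟩
  · rw [inv_le_one₀ hW0]; linarith
  intro m δ eP T h M hm hh hlt hcube hδ hδC he he' H t
  have hWh : W * h < 1 := by
    rw [lt_inv_comm₀ hh hW0] at hlt
    rw [← lt_div_iff₀ hh, one_div]
    exact hlt
  have hlt' : ∀ x, x ≤ W → x * h ≤ 1 := fun x hx => le_trans (by gcongr) hWh.le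
  have s1 := hlt' 1000 (by linarith)
  have s2 := hlt' (10 * C) (by linarith)
  have s3 := hlt' (6 / e₀ ^ 2) (by linarith)
  have s4 := hlt' (100 / (μ * (1 - μ))) (by linarith)
  have s5 := hlt' (10 * N) (by linarith)
  have s6 := hlt' (K₀ * N / β) (by linarith)
  have h1 : h ≤ 1 := by linarith
  have hδ8 : δ ≤ h ^ 8 := by
    calc δ ≤ C * h ^ 9 := hδC
      _ = (C * h) * h ^ 8 := by ring
      _ ≤ 1 * h ^ 8 := by gcongr; nlinarith
      _ = _ := one_mul _
  have hδh : δ ≤ h := by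
    calc δ ≤ h ^ 8 := hδ8
      _ = h * h ^ 7 := by ring
      _ ≤ h * 1 := by gcongr; exact pow_le_one₀ hh.le h1
      _ = h := mul_one h
  have hCh : C * h ≤ 1 := by nlinarith
  have S : SmallParams μ δ C e₀ h (N * h) k m :=
    { μ_pos := hμ0
      μ_lt := hμ1
      C_pos := hC
      e₀_pos := he₀
      k_pos := hk
      m_pos := hm
      h_pos := hh
      h_le := by linarith
      h_cube := hcube
      δ_pos := hδ
      δ_le := hδ8
      δ_le' := by
        rw [div_mul_eq_mul_div, div_le_one (by positivity)] at s3
        linarith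
      C_le := by linarith
      C_sqrt_le := by
        have : Real.sqrt δ ≤ h ^ 4 := by
          rw [Real.sqrt_le_left (by positivity)]
          calc δ ≤ h ^ 8 := hδ8
            _ = _ := by ring
        calc C * Real.sqrt δ ≤ C * h ^ 4 := by gcongr
          _ = (C * h) * h ^ 3 := by ring
          _ ≤ 1 * h ^ 3 := by gcongr
          _ = _ := one_mul _
      C_δ_le := by
        calc C * δ ≤ C * h ^ 8 := by gcongr
          _ = (C * h) * h ^ 7 := by ring
          _ ≤ 1 * h ^ 7 := by gcongr
          _ = _ := one_mul _
      α_le := by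
        have : 100 / (μ * (1 - μ)) * h = 100 * (h / (μ * (1 - μ))) := by ring
        linarith
      η_le := by linarith
      le_η := by
        rw [hN]
        have : 10 / (μ * (1 - μ)) * h = 10 * (h / (μ * (1 - μ))) := by ring
        linarith }
  obtain ⟨u, hu, hq, hv, hX, hY⟩ := H.exists_rotation h
  have hub := hrot H S he he' (by
    rw [div_mul_eq_mul_div, div_le_one hβ0] at s6
    rw [← hβ]
    linarith) hu hX hY
  have hA := H.norm_lrl_q1_le S he he' hu hβ0 hub hq hv t
  obtain ⟨d1, d2⟩ := H.circular_defects S he he' hD0 hA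
  obtain ⟨p1, p2, p3⟩ := H.norm_qP_bounds S he he' t
  refine ⟨p1, p2, p3, d1.trans ?_, d2⟩
  have : 0 < δ / h := by positivity
  gcongr
  · linarith
  · linarith

/-! ### Averages along periodic orbits of the asteroid -/

/-- The attraction of Sun and Jupiter on the asteroid, with the sign reversed. -/
noncomputable def primaryForce (μ : ℝ) (q : ℂ) : ℂ :=
  ((1 - μ : ℝ) : ℂ) * invSq (q - ((-μ : ℝ) : ℂ)) + (μ : ℂ) * invSq (q - ((1 - μ : ℝ) : ℂ))

theorem continuous_invSq_comp {f : ℝ → ℂ} (hf : Continuous f) (h0 : ∀ t, f t ≠ 0) :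
    Continuous fun t => invSq (f t) := by
  unfold invSq
  refine hf.div (by fun_prop) fun t => ?_
  have : ‖f t‖ ≠ 0 := norm_ne_zero_iff.2 (h0 t)
  exact_mod_cast pow_ne_zero 3 this

theorem continuous_cross {f g : ℝ → ℂ} (hf : Continuous f) (hg : Continuous g) :
    Continuous fun t => cross (f t) (g t) := by
  unfold cross
  exact ((Complex.continuous_re.comp hf).mul (Complex.continuous_im.comp hg)).sub
    ((Complex.continuous_im.comp hf).mul (Complex.continuous_re.comp hg))

namespace IsPeriodicOrbit

variable {μ T : ℝ} {q p : ℝ → ℂ}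

theorem continuous_q (H : IsPeriodicOrbit μ q p T) : Continuous q :=
  continuous_iff_continuousAt.2 fun t => (H.deriv_q t).continuousAt

theorem continuous_p (H : IsPeriodicOrbit μ q p T) : Continuous p :=
  continuous_iff_continuousAt.2 fun t => (H.deriv_p t).continuousAt

theorem continuous_primaryForce (H : IsPeriodicOrbit μ q p T) :
    Continuous fun t => primaryForce μ (q t) := by
  unfold primaryForce
  exact (continuous_const.mul (continuous_invSq_comp (H.continuous_q.sub continuous_const)
    fun t => sub_ne_zero.2 (H.ne_sun t))).add
    (continuous_const.mul (continuous_invSq_comp (H.continuous_q.sub continuous_const)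
    fun t => sub_ne_zero.2 (H.ne_jupiter t)))

/-- The mean force along a periodic orbit is its mean position. -/
theorem integral_primaryForce (H : IsPeriodicOrbit μ q p T) :
    ∫ t in (0 : ℝ)..T, primaryForce μ (q t) = ∫ t in (0 : ℝ)..T, q t := by
  have h1 : ∀ t, HasDerivAt (fun s => p s + Complex.I * q s) (q t - primaryForce μ (q t)) t := by
    intro t
    refine ((H.deriv_p t).add ((H.deriv_q t).const_mul Complex.I)).congr_deriv ?_
    rw [primaryForce]
    linear_combination -(q t) * Complex.I_sq
  have h2 := intervalIntegral.integral_eq_sub_of_hasDerivAt (a := 0) (b := T)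
    (fun t _ => h1 t) ((H.continuous_q.sub H.continuous_primaryForce).intervalIntegrable 0 T)
  have e1 : q T = q 0 := by simpa using H.periodic_q 0
  have e2 : p T = p 0 := by simpa using H.periodic_p 0
  rw [e1, e2, sub_self, intervalIntegral.integral_sub (H.continuous_q.intervalIntegrable 0 T)
    (H.continuous_primaryForce.intervalIntegrable 0 T), sub_eq_zero] at h2
  exact h2.symm

end IsPeriodicOrbit

/-- The mean over the period of a periodic curve. -/
noncomputable def meanPos (q : ℝ → ℂ) (T : ℝ) : ℂ := ((1 / T : ℝ) : ℂ) * ∫ t in (0 : ℝ)..T, q t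

theorem abs_mean_sub_le {f : ℝ → ℝ} {F : ℝ → ℂ} {T c B : ℝ} {Q : ℂ} (hT : 0 < T)
    (hf : Continuous f) (hF : Continuous F) (h : ∀ t, |f t - (c + inner ℝ Q (F t))| ≤ B) :
    |(1 / T) * (∫ t in (0 : ℝ)..T, f t) - (c + inner ℝ Q (meanPos F T))| ≤ B := by
  have e1 : inner ℝ Q (∫ t in (0 : ℝ)..T, F t) = ∫ t in (0 : ℝ)..T, inner ℝ Q (F t) := by
    have hi : IntervalIntegrable F MeasureTheory.volume 0 T := hF.intervalIntegrable 0 T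
    have := (innerSL ℝ Q).intervalIntegral_comp_comm hi
    simpa using this.symm
  have hG : Continuous fun t => c + inner ℝ Q (F t) := by fun_prop
  have e2 : ∫ t in (0 : ℝ)..T, (f t - (c + inner ℝ Q (F t)))
      = (∫ t in (0 : ℝ)..T, f t) - (T * c + inner ℝ Q (∫ t in (0 : ℝ)..T, F t)) := by
    rw [intervalIntegral.integral_sub (hf.intervalIntegrable 0 T) (hG.intervalIntegrable 0 T),
      intervalIntegral.integral_add (continuous_const.intervalIntegrable 0 T)
        ((by fun_prop : Continuous fun t => inner ℝ Q (F t)).intervalIntegrable 0 T), e1]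
    simp
  have e3 : (1 / T) * (∫ t in (0 : ℝ)..T, f t) - (c + inner ℝ Q (meanPos F T))
      = (1 / T) * ∫ t in (0 : ℝ)..T, (f t - (c + inner ℝ Q (F t))) := by
    rw [e2, meanPos, ← Complex.real_smul, real_inner_smul_right]
    field_simp
  have b := intervalIntegral.norm_integral_le_of_norm_le_const (a := 0) (b := T) (C := B)
    (f := fun t => f t - (c + inner ℝ Q (F t))) (fun t _ => h t)
  rw [sub_zero, abs_of_pos hT, Real.norm_eq_abs] at b
  rw [e3, abs_mul, abs_of_pos (by positivity)]
  calc _ ≤ (1 / T) * (B * T) := by gcongr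
    _ = B := by field_simp

/-- First-order Taylor expansion of `1/‖w‖`, with an exact remainder obtained from `‖w + h‖² = ‖w‖²
+ 2⟨w, h⟩ + ‖h‖²`. -/
theorem abs_inv_norm_sub_le {w h : ℂ} {d : ℝ} (hd : 0 < d) (hw : d ≤ ‖w‖) (hh : ‖h‖ ≤ d / 2) :
    |1 / ‖w‖ - 1 / ‖w + h‖ - inner ℝ h (invSq w)| ≤ 8 * (‖h‖ ^ 2 / d ^ 3) := by
  have s0 : 0 < ‖w‖ := by linarith
  have l1 := norm_sub_le_norm_add w h
  have l2 : |‖w‖ - ‖w + h‖| ≤ ‖h‖ := by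
    have := abs_norm_sub_norm_le w (w + h)
    simpa using this
  have s1 : ‖w‖ / 2 ≤ ‖w + h‖ := by linarith
  have s1' : 0 < ‖w + h‖ := by linarith
  have i1 : inner ℝ h (invSq w) = ‖w‖⁻¹ ^ 3 * inner ℝ w h := by
    rw [invSq_eq, ← Complex.real_smul, real_inner_smul_right, real_inner_comm]
  have i2 := norm_add_sq_real w h
  have i3 := abs_real_inner_le_norm w h
  set s := ‖w‖ with hs
  set r := ‖w + h‖ with hr
  have e : 1 / s - 1 / r - inner ℝ h (invSq w)
      = inner ℝ w h * ((s - r) * (2 * s + r)) / (s ^ 3 * r * (s + r))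
        + ‖h‖ ^ 2 / (s * r * (s + r)) := by
    have e1 : inner ℝ w h = (r ^ 2 - s ^ 2 - ‖h‖ ^ 2) / 2 := by linarith
    rw [i1, e1]
    field_simp
    ring
  have b1 : |inner ℝ w h * ((s - r) * (2 * s + r)) / (s ^ 3 * r * (s + r))|
      ≤ 4 * (‖h‖ ^ 2 / s ^ 3) := by
    rw [abs_div, abs_mul, abs_mul, abs_of_pos (by positivity : 0 < 2 * s + r),
      abs_of_pos (by positivity : 0 < s ^ 3 * r * (s + r))]
    calc _ ≤ (s * ‖h‖) * (‖h‖ * (2 * (s + r))) / (s ^ 3 * r * (s + r)) := by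
          gcongr
          linarith
      _ = 2 * (‖h‖ ^ 2 / (s ^ 2 * r)) := by field_simp
      _ ≤ 2 * (‖h‖ ^ 2 / (s ^ 2 * (s / 2))) := by gcongr
      _ = _ := by field_simp; ring
  have b2 : |‖h‖ ^ 2 / (s * r * (s + r))| ≤ 2 * (‖h‖ ^ 2 / s ^ 3) := by
    rw [abs_of_nonneg (by positivity)]
    calc _ ≤ ‖h‖ ^ 2 / (s * (s / 2) * s) := by
          gcongr
          linarith
      _ = _ := by field_simp
  rw [e]
  have b3 := (abs_add_le _ _).trans (add_le_add b1 b2)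
  have b4 : ‖h‖ ^ 2 / s ^ 3 ≤ ‖h‖ ^ 2 / d ^ 3 := by gcongr
  have b5 : 0 ≤ ‖h‖ ^ 2 / d ^ 3 := by positivity
  linarith

namespace Motion

variable {M : Motion} {t : ℝ}

theorem norm_toRotating (h : M.q1 t ≠ 0) (z : ℂ) : ‖M.toRotating t z‖ = ‖z‖ := by
  have : ‖M.q1 t‖ ≠ 0 := norm_ne_zero_iff.2 h
  rw [toRotating, norm_mul, RCLike.norm_conj, norm_div, Complex.norm_real, norm_norm,
    div_self this, one_mul]

theorem toRotating_q1 (h : M.q1 t ≠ 0) : M.toRotating t (M.q1 t) = (M.r t : ℂ) := by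
  have : ((‖M.q1 t‖ : ℝ) : ℂ) ≠ 0 := by exact_mod_cast norm_ne_zero_iff.2 h
  rw [toRotating, map_div₀, Complex.conj_ofReal, div_mul_eq_mul_div, mul_comm, mul_conj_self, r]
  field_simp

end Motion

namespace IsThreeBodySolution

variable {μ δ : ℝ} {M : Motion}

theorem toRotating_qS (H : IsThreeBodySolution μ δ M) (t : ℝ) :
    M.toRotating t (M.qS t) = -(δ * M.toRotating t (M.qP t)) - μ * (M.r t : ℂ) := by
  rw [← Motion.toRotating_q1 (H.q1_ne_zero t), H.qS_eq]
  simp only [Motion.toRotating]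
  ring

theorem toRotating_qJ (H : IsThreeBodySolution μ δ M) (t : ℝ) :
    M.toRotating t (M.qJ t)
      = -(δ * M.toRotating t (M.qP t)) + ((1 - μ : ℝ) : ℂ) * (M.r t : ℂ) := by
  rw [← Motion.toRotating_q1 (H.q1_ne_zero t), H.qJ_eq]
  simp only [Motion.toRotating]
  ring

end IsThreeBodySolution


/-! ### The perturbation to first order -/

theorem inner_real_mul_right (z w : ℂ) (c : ℝ) : inner ℝ z ((c : ℂ) * w) = c * inner ℝ z w := by
  rw [← Complex.real_smul, real_inner_smul_right]

/-- Here `ρ = r - 1`. Both primaries are shifted by `-δ Q`, which pairs with the total force; the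
shifts proportional to `ρ` have opposite signs and are counted as errors, as is the replacement of
`δ/|q - Q|` by `δ/|Q|`. -/
theorem abs_perturbation_sub_le {μ δ θ c ρ d : ℝ} {wS wJ q Q : ℂ} (h0 : 0 < μ) (h1 : μ < 1)
    (hδ : 0 < δ) (hd : 0 < d) (hS : d ≤ ‖wS‖) (hJ : d ≤ ‖wJ‖)
    (hs : |ρ| + δ * ‖Q‖ ≤ d / 2) (hQ : 1 + ‖q‖ ≤ ‖Q‖) :
    |(-θ * c + (1 - μ) * (1 / ‖wS‖ - 1 / ‖wS + (μ * (ρ : ℂ) + δ * Q)‖)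
      + μ * (1 / ‖wJ‖ - 1 / ‖wJ + (-((1 - μ : ℝ) : ℂ) * (ρ : ℂ) + δ * Q)‖) - δ / ‖q - Q‖)
      - (-(δ / ‖Q‖) + inner ℝ ((δ : ℂ) * Q) (((1 - μ : ℝ) : ℂ) * invSq wS + (μ : ℂ) * invSq wJ))|
      ≤ |θ| * |c| + 2 * (|ρ| / d ^ 2) + 16 * ((|ρ| + δ * ‖Q‖) ^ 2 / d ^ 3) + δ * ‖q‖ := by
  have hμ1 : 0 < 1 - μ := by linarith
  have nδQ : ‖(δ : ℂ) * Q‖ = δ * ‖Q‖ := by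
    rw [norm_mul, Complex.norm_real, Real.norm_of_nonneg hδ.le]
  have nS : ‖(μ : ℂ) * (ρ : ℂ)‖ ≤ |ρ| := by
    rw [norm_mul, Complex.norm_real, Complex.norm_real, Real.norm_of_nonneg h0.le,
      Real.norm_eq_abs]
    exact mul_le_of_le_one_left (abs_nonneg ρ) h1.le
  have nJ : ‖-((1 - μ : ℝ) : ℂ) * (ρ : ℂ)‖ ≤ |ρ| := by
    rw [norm_mul, norm_neg, Complex.norm_real, Complex.norm_real, Real.norm_of_nonneg hμ1.le,
      Real.norm_eq_abs]
    exact mul_le_of_le_one_left (abs_nonneg ρ) (by linarith)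
  have nhS := (norm_add_le ((μ : ℂ) * (ρ : ℂ)) (δ * Q)).trans (add_le_add nS nδQ.le)
  have nhJ := (norm_add_le (-((1 - μ : ℝ) : ℂ) * (ρ : ℂ)) (δ * Q)).trans (add_le_add nJ nδQ.le)
  have aS := abs_inv_norm_sub_le hd hS (nhS.trans hs)
  have aJ := abs_inv_norm_sub_le hd hJ (nhJ.trans hs)
  have ni : ∀ w : ℂ, d ≤ ‖w‖ → ∀ z : ℂ, ‖z‖ ≤ |ρ| → |inner ℝ z (invSq w)| ≤ |ρ| / d ^ 2 := by
    intro w hw z hz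
    refine (abs_real_inner_le_norm _ _).trans ?_
    rw [norm_invSq, div_eq_mul_inv, ← inv_pow]
    gcongr
  have bS := ni wS hS _ nS
  have bJ := ni wJ hJ _ nJ
  have hq0 := norm_nonneg q
  have hQq : 1 ≤ ‖q - Q‖ := by
    have := norm_sub_norm_le Q q
    rw [norm_sub_rev] at this
    linarith
  have bP : |δ / ‖q - Q‖ - δ / ‖Q‖| ≤ δ * ‖q‖ := by
    have hQ0 : 0 < ‖Q‖ := by linarith
    have hq1 : 0 < ‖q - Q‖ := by linarith
    have e : δ / ‖q - Q‖ - δ / ‖Q‖ = δ * (‖Q‖ - ‖q - Q‖) / (‖q - Q‖ * ‖Q‖) := by field_simp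
    have h3 : |‖Q‖ - ‖q - Q‖| ≤ ‖q‖ := by
      have := abs_norm_sub_norm_le Q (Q - q)
      rw [norm_sub_rev Q q] at this
      simpa using this
    rw [e, abs_div, abs_mul, abs_of_pos hδ, abs_of_pos (by positivity : 0 < ‖q - Q‖ * ‖Q‖)]
    rw [div_le_iff₀ (by positivity)]
    have h4 : 1 ≤ ‖q - Q‖ * ‖Q‖ := one_le_mul_of_one_le_of_one_le hQq (by linarith)
    calc δ * |‖Q‖ - ‖q - Q‖| ≤ δ * ‖q‖ := by gcongr
      _ ≤ δ * ‖q‖ * (‖q - Q‖ * ‖Q‖) := le_mul_of_one_le_right (by positivity) h4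
  rw [inner_add_left] at aS aJ
  have e : inner ℝ ((δ : ℂ) * Q) (((1 - μ : ℝ) : ℂ) * invSq wS + (μ : ℂ) * invSq wJ)
      = (1 - μ) * inner ℝ ((δ : ℂ) * Q) (invSq wS) + μ * inner ℝ ((δ : ℂ) * Q) (invSq wJ) := by
    rw [inner_add_right, inner_real_mul_right, inner_real_mul_right]
  rw [e]
  have hsq : 8 * (‖(μ : ℂ) * (ρ : ℂ) + δ * Q‖ ^ 2 / d ^ 3)
      ≤ 8 * ((|ρ| + δ * ‖Q‖) ^ 2 / d ^ 3) := by gcongr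
  have hsq' : 8 * (‖-((1 - μ : ℝ) : ℂ) * (ρ : ℂ) + δ * Q‖ ^ 2 / d ^ 3)
      ≤ 8 * ((|ρ| + δ * ‖Q‖) ^ 2 / d ^ 3) := by gcongr
  set s := (|ρ| + δ * ‖Q‖) ^ 2 / d ^ 3 with hs'
  have hs0 : 0 ≤ s := by positivity
  set AS := 1 / ‖wS‖ - 1 / ‖wS + (μ * (ρ : ℂ) + δ * Q)‖ with hAS
  set AJ := 1 / ‖wJ‖ - 1 / ‖wJ + (-((1 - μ : ℝ) : ℂ) * (ρ : ℂ) + δ * Q)‖ with hAJ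
  set iS := inner ℝ ((μ : ℂ) * (ρ : ℂ)) (invSq wS) with hiS
  set iJ := inner ℝ (-((1 - μ : ℝ) : ℂ) * (ρ : ℂ)) (invSq wJ) with hiJ
  set jS := inner ℝ ((δ : ℂ) * Q) (invSq wS) with hjS
  set jJ := inner ℝ ((δ : ℂ) * Q) (invSq wJ) with hjJ
  have cS : |(1 - μ) * (AS - jS)| ≤ 1 * (8 * s + |ρ| / d ^ 2) := by
    rw [abs_mul, abs_of_pos hμ1]
    have h3 := abs_le.1 (aS.trans hsq)
    have h4 := abs_le.1 bS
    have h5 : |AS - jS| ≤ 8 * s + |ρ| / d ^ 2 := by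
      rw [abs_le]; constructor <;> linarith
    gcongr
    linarith
  have cJ : |μ * (AJ - jJ)| ≤ 1 * (8 * s + |ρ| / d ^ 2) := by
    rw [abs_mul, abs_of_pos h0]
    have h3 := abs_le.1 (aJ.trans hsq')
    have h4 := abs_le.1 bJ
    have h5 : |AJ - jJ| ≤ 8 * s + |ρ| / d ^ 2 := by
      rw [abs_le]; constructor <;> linarith
    gcongr
  have cθ : |θ * c| = |θ| * |c| := abs_mul θ c
  have e2 : -θ * c + (1 - μ) * AS + μ * AJ - δ / ‖q - Q‖
      - (-(δ / ‖Q‖) + ((1 - μ) * jS + μ * jJ))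
      = -(θ * c) + (1 - μ) * (AS - jS) + μ * (AJ - jJ) - (δ / ‖q - Q‖ - δ / ‖Q‖) := by ring
  rw [e2]
  have d1 := abs_le.1 cS
  have d2 := abs_le.1 cJ
  have d3 := abs_le.1 cθ.le
  have d4 := abs_le.1 bP
  rw [abs_le]
  constructor <;> linarith

theorem exists_norm_le_of_periodic {f : ℝ → ℂ} {T : ℝ} (hf : Continuous f)
    (hp : Function.Periodic f T) (hT : T ≠ 0) : ∃ K : ℝ, 0 < K ∧ ∀ t, ‖f t‖ ≤ K := by
  obtain ⟨K, hK, h⟩ := (hp.isBounded_of_continuous hT hf).exists_pos_norm_le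
  exact ⟨K, hK, fun t => h _ ⟨t, rfl⟩⟩

theorem exists_le_norm_of_periodic {f : ℝ → ℂ} {T : ℝ} (hf : Continuous f)
    (hp : Function.Periodic f T) (hT : T ≠ 0) (h0 : ∀ t, f t ≠ 0) :
    ∃ d : ℝ, 0 < d ∧ ∀ t, d ≤ ‖f t‖ := by
  obtain ⟨K, hK, h⟩ := exists_norm_le_of_periodic (f := fun t => (f t)⁻¹) (hf.inv₀ h0)
    (fun t => by simp only [hp t]) hT
  refine ⟨K⁻¹, inv_pos.2 hK, fun t => ?_⟩
  have := h t
  rw [norm_inv] at this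
  exact (inv_le_comm₀ (norm_pos_iff.2 (h0 t)) hK).1 this

/-- The average of the perturbation along a periodic orbit to first order. -/
theorem IsPeriodicOrbit.exists_average_estimate {μ T : ℝ} {q p : ℝ → ℂ} (hμ0 : 0 < μ)
    (hμ1 : μ < 1) (H : IsPeriodicOrbit μ q p T) : ∃ K : ℝ, 0 < K ∧ ∃ d : ℝ, 0 < d ∧
    ∀ (δ ε ν : ℝ) (M : Motion), IsThreeBodySolution μ δ M → 0 < δ →
    |M.r (ν / ε) - 1| + δ * ‖M.qP (ν / ε)‖ ≤ d → K ≤ ‖M.qP (ν / ε)‖ →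
    |average μ δ ε M q p T ν - (-(δ / ‖M.qP (ν / ε)‖)
      + inner ℝ ((δ : ℂ) * M.toRotating (ν / ε) (M.qP (ν / ε))) (meanPos q T))|
      ≤ K * (|M.thetaDot (ν / ε)| + |M.r (ν / ε) - 1|
        + (|M.r (ν / ε) - 1| + δ * ‖M.qP (ν / ε)‖) ^ 2 + δ) := by
  have hT := H.period_pos.ne'
  obtain ⟨dS, hdS, hS⟩ := exists_le_norm_of_periodic (f := fun t => q t - ((-μ : ℝ) : ℂ))
    (H.continuous_q.sub continuous_const) (fun t => by simp only [H.periodic_q t]) hT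
    (fun t => sub_ne_zero.2 (H.ne_sun t))
  obtain ⟨dJ, hdJ, hJ⟩ := exists_le_norm_of_periodic (f := fun t => q t - ((1 - μ : ℝ) : ℂ))
    (H.continuous_q.sub continuous_const) (fun t => by simp only [H.periodic_q t]) hT
    (fun t => sub_ne_zero.2 (H.ne_jupiter t))
  obtain ⟨Kq, hKq, hq⟩ := exists_norm_le_of_periodic H.continuous_q H.periodic_q hT
  obtain ⟨Kp, hKp, hp⟩ := exists_norm_le_of_periodic H.continuous_p H.periodic_p hT
  set d := min dS dJ with hd
  have hd0 : 0 < d := lt_min hdS hdJ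
  set K := Kq * Kp + 2 / d ^ 2 + 16 / d ^ 3 + Kq + 1 with hK
  have hK0 : 0 < K := by positivity
  refine ⟨K, hK0, d / 2, by positivity, ?_⟩
  intro δ ε ν M HM hδ hs hQ
  set τ := ν / ε with hτ
  have h1 := HM.q1_ne_zero τ
  set Q := M.toRotating τ (M.qP τ) with hQdef
  have nQ : ‖M.qP τ‖ = ‖Q‖ := (Motion.norm_toRotating h1 _).symm
  rw [nQ] at hs hQ ⊢
  set ρ := M.r τ - 1 with hρ
  have hr : M.r τ = 1 + ρ := by rw [hρ]; ring
  have eS : ∀ t, q t - M.toRotating τ (M.qS τ)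
      = (q t - ((-μ : ℝ) : ℂ)) + (μ * (ρ : ℂ) + δ * Q) := fun t => by
    rw [HM.toRotating_qS, hr]; push_cast; ring
  have eJ : ∀ t, q t - M.toRotating τ (M.qJ τ)
      = (q t - ((1 - μ : ℝ) : ℂ)) + (-((1 - μ : ℝ) : ℂ) * (ρ : ℂ) + δ * Q) := fun t => by
    rw [HM.toRotating_qJ, hr]; push_cast; ring
  have p1 : 0 < 2 / d ^ 2 := by positivity
  have p2 : 0 < 16 / d ^ 3 := by positivity
  have p3 : 0 < Kq * Kp := by positivity
  have hQ1 : ∀ t, 1 + ‖q t‖ ≤ ‖Q‖ := fun t => by linarith [hq t]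
  have wS : ∀ t, d ≤ ‖q t - ((-μ : ℝ) : ℂ)‖ := fun t => (min_le_left _ _).trans (hS t)
  have wJ : ∀ t, d ≤ ‖q t - ((1 - μ : ℝ) : ℂ)‖ := fun t => (min_le_right _ _).trans (hJ t)
  have nδQ : ‖(δ : ℂ) * Q‖ = δ * ‖Q‖ := by
    rw [norm_mul, Complex.norm_real, Real.norm_of_nonneg hδ.le]
  have nz : ∀ (c : ℝ), |c| ≤ 1 → ∀ w : ℂ, d ≤ ‖w‖ → w + ((c : ℂ) * (ρ : ℂ) + δ * Q) ≠ 0 := by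
    intro c hc w hw h0
    have h2 : ‖w‖ ≤ |ρ| + δ * ‖Q‖ := by
      rw [eq_neg_of_add_eq_zero_left h0, norm_neg]
      refine (norm_add_le _ _).trans ?_
      rw [nδQ, norm_mul, Complex.norm_real, Complex.norm_real, Real.norm_eq_abs, Real.norm_eq_abs]
      have := mul_le_of_le_one_left (abs_nonneg ρ) hc
      linarith
    linarith
  have cont : Continuous fun t => perturbation μ δ ε M (q t) (p t) ν := by
    unfold perturbation
    rw [← hτ, ← hQdef]
    simp only [eS, eJ]
    have cq := H.continuous_q
    refine (((continuous_const.mul (continuous_cross cq H.continuous_p)).add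
      (continuous_const.mul ((continuous_const.div (by fun_prop) fun t => ?_).sub
        (continuous_const.div (by fun_prop) fun t => ?_)))).add
      (continuous_const.mul ((continuous_const.div (by fun_prop) fun t => ?_).sub
        (continuous_const.div (by fun_prop) fun t => ?_)))).sub
      (continuous_const.div (by fun_prop) fun t => ?_)
    · exact norm_ne_zero_iff.2 (sub_ne_zero.2 (H.ne_sun t))
    · exact norm_ne_zero_iff.2 (nz μ (abs_le.2 ⟨by linarith, hμ1.le⟩) _ (wS t))
    · exact norm_ne_zero_iff.2 (sub_ne_zero.2 (H.ne_jupiter t))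
    · have := nz (-(1 - μ)) (abs_le.2 ⟨by linarith, by linarith⟩) _ (wJ t)
      rw [Complex.ofReal_neg] at this
      exact norm_ne_zero_iff.2 this
    · have := norm_sub_norm_le Q (q t)
      rw [norm_sub_rev] at this
      linarith [hQ1 t]
  -- The expansion is linear in the force, whose mean is the mean position.
  have em : meanPos (fun t => primaryForce μ (q t)) T = meanPos q T := by
    rw [meanPos, meanPos, H.integral_primaryForce]
  rw [← em]
  refine abs_mean_sub_le H.period_pos cont H.continuous_primaryForce fun t => ?_
  have b := abs_perturbation_sub_le (θ := M.thetaDot τ) (c := cross (q t) (p t)) hμ0 hμ1 hδ hd0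
    (wS t) (wJ t) hs (hQ1 t)
  rw [← eS, ← eJ] at b
  refine b.trans ?_
  have hc : |cross (q t) (p t)| ≤ Kq * Kp :=
    (abs_cross_le _ _).trans (mul_le_mul (hq t) (hp t) (norm_nonneg _) hKq.le)
  have c1 : |M.thetaDot τ| * |cross (q t) (p t)| ≤ |M.thetaDot τ| * K := by
    gcongr; linarith
  have c2 : 2 * (|ρ| / d ^ 2) ≤ |ρ| * K := by
    have : 2 * (|ρ| / d ^ 2) = |ρ| * (2 / d ^ 2) := by ring
    rw [this]
    gcongr; linarith
  have c3 : 16 * ((|ρ| + δ * ‖Q‖) ^ 2 / d ^ 3) ≤ (|ρ| + δ * ‖Q‖) ^ 2 * K := by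
    have : 16 * ((|ρ| + δ * ‖Q‖) ^ 2 / d ^ 3) = (|ρ| + δ * ‖Q‖) ^ 2 * (16 / d ^ 3) := by ring
    rw [this]
    gcongr; linarith
  have c4 : δ * ‖q t‖ ≤ δ * K := by
    gcongr; linarith [hq t]
  linarith

/-! ### The Lagrangian points -/

/-- With `s` the distance to Jupiter, equilibrium reads `μ/s² = 1 - μ + s - (1 - μ)/(1 + s)²`, and
`1/(1 + s)² ≥ 1 - 2s` bounds the right side by `3s`. -/
theorem IsL2.cube_le {μ a : ℝ} (hμ0 : 0 < μ) (hμ1 : μ < 1) (h : IsL2 μ a) :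
    μ ≤ 3 * (a - (1 - μ)) ^ 3 := by
  obtain ⟨ha, hd⟩ := h
  obtain ⟨s, rfl⟩ : ∃ s, a = 1 - μ + s := ⟨a - (1 - μ), by ring⟩
  have hs : 0 < s := by linarith
  have d1 : HasDerivAt (fun x : ℝ => x ^ 2 / 2 + (1 - μ) * (x + μ)⁻¹ + μ * (x + μ - 1)⁻¹)
      ((1 - μ + s) - (1 - μ) / (1 + s) ^ 2 - μ / s ^ 2) (1 - μ + s) := by
    have i := hasDerivAt_id' (1 - μ + s)
    have h1 := ((i.add_const μ).inv (by positivity)).const_mul (1 - μ)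
    have h2 := (((i.add_const μ).sub_const 1).inv (by
      rw [show 1 - μ + s + μ - 1 = s by ring]; exact hs.ne')).const_mul μ
    refine ((((i.pow 2).div_const 2).add h1).add h2).congr_deriv ?_
    rw [show 1 - μ + s + μ - 1 = s by ring, show 1 - μ + s + μ = 1 + s by ring]
    norm_num
    ring
  have d2 : HasDerivAt (axisPotential μ)
      ((1 - μ + s) - (1 - μ) / (1 + s) ^ 2 - μ / s ^ 2) (1 - μ + s) := by
    refine d1.congr_of_eventuallyEq ?_
    filter_upwards [Ioi_mem_nhds ha] with x hx
    have hx' : 1 - μ < x := hx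
    rw [axisPotential, abs_of_pos (by linarith : 0 < x + μ),
      abs_of_pos (by linarith : 0 < x + μ - 1), div_eq_mul_inv (1 - μ), div_eq_mul_inv μ]
  have e := hd.unique d2
  have hle : 1 - 2 * s ≤ 1 / (1 + s) ^ 2 := by
    rw [le_div_iff₀ (by positivity)]
    nlinarith [mul_pos hs hs, mul_pos (mul_pos hs hs) hs]
  have e2 : μ / s ^ 2 = 1 - μ + s - (1 - μ) * (1 / (1 + s) ^ 2) := by
    rw [mul_one_div]; linarith
  have h3 : μ / s ^ 2 ≤ 3 * s := by
    rw [e2]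
    have := mul_le_mul_of_nonneg_left hle (by linarith : 0 ≤ 1 - μ)
    nlinarith
  rw [div_le_iff₀ (by positivity)] at h3
  have : 1 - μ + s - (1 - μ) = s := by ring
  rw [this]
  linarith

/-- The closed ball about the mean position with radius the diameter contains the curve, hence its
convex hull, hence the Lagrangian point. -/
theorem IsLyapunovOrbit.norm_meanPos_sub_le {μ a T : ℝ} {q p : ℝ → ℂ}
    (H : IsLyapunovOrbit μ a q p T) :
    ‖meanPos q T - (a : ℂ)‖ ≤ Metric.diam (Set.range q) := by
  have hT := H.period_pos
  have hq := H.toIsPeriodicOrbit.continuous_q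
  have hb := H.periodic_q.isBounded_of_continuous hT.ne' hq
  have h1 : Set.range q ⊆ Metric.closedBall (meanPos q T) (Metric.diam (Set.range q)) := by
    rintro _ ⟨s, rfl⟩
    have e : q s - meanPos q T = ((1 / T : ℝ) : ℂ) * ∫ t in (0 : ℝ)..T, (q s - q t) := by
      rw [intervalIntegral.integral_sub (continuous_const.intervalIntegrable 0 T)
        (hq.intervalIntegrable 0 T), mul_sub, meanPos]
      have : (T : ℂ) ≠ 0 := by exact_mod_cast hT.ne'
      simp
      field_simp
    rw [Metric.mem_closedBall, dist_eq_norm, e, norm_mul, Complex.norm_real,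
      Real.norm_of_nonneg (by positivity)]
    have b := intervalIntegral.norm_integral_le_of_norm_le_const (a := 0) (b := T)
      (C := Metric.diam (Set.range q)) (f := fun t => q s - q t) (fun t _ => by
        rw [← dist_eq_norm]
        exact Metric.dist_le_diam_of_mem hb ⟨s, rfl⟩ ⟨t, rfl⟩)
    rw [sub_zero, abs_of_pos hT] at b
    calc _ ≤ (1 / T) * (Metric.diam (Set.range q) * T) := by gcongr
      _ = _ := by field_simp
  have h2 := convexHull_min h1 (convex_closedBall _ _) H.surrounds
  rwa [Metric.mem_closedBall, dist_comm, dist_eq_norm] at h2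

/-- Equal means would give `a₂ - a₁ < μ^(1/3) / 2`. As Jupiter lies between the two points, `(a₂ -
(1 - μ))³ < μ/8`, against the lower bound `μ/3`. -/
theorem meanPos_sub_ne_zero {μ a₁ a₂ T₁ T₂ : ℝ} {q₁ p₁ q₂ p₂ : ℝ → ℂ} (hμ0 : 0 < μ)
    (hμ1 : μ < 1) (h₁ : IsL1 μ a₁) (h₂ : IsL2 μ a₂) (H₁ : IsLyapunovOrbit μ a₁ q₁ p₁ T₁)
    (H₂ : IsLyapunovOrbit μ a₂ q₂ p₂ T₂)
    (d₁ : Metric.diam (Set.range q₁) < 1 / 4 * μ ^ (1 / 3 : ℝ))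
    (d₂ : Metric.diam (Set.range q₂) < 1 / 4 * μ ^ (1 / 3 : ℝ)) :
    meanPos q₁ T₁ - meanPos q₂ T₂ ≠ 0 := by
  intro h
  have b1 := H₁.norm_meanPos_sub_le
  have b2 := H₂.norm_meanPos_sub_le
  rw [sub_eq_zero] at h
  rw [h] at b1
  have b3 := norm_sub_le (meanPos q₂ T₂ - (a₁ : ℂ)) (meanPos q₂ T₂ - (a₂ : ℂ))
  have e : meanPos q₂ T₂ - (a₁ : ℂ) - (meanPos q₂ T₂ - (a₂ : ℂ)) = ((a₂ - a₁ : ℝ) : ℂ) := by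
    push_cast; ring
  rw [e, Complex.norm_real] at b3
  have b4 := le_abs_self (a₂ - a₁)
  rw [← Real.norm_eq_abs] at b4
  have b5 := h₁.2.1
  set r := μ ^ (1 / 3 : ℝ) with hr
  have hr3 : r ^ 3 = μ := by
    rw [hr, ← Real.rpow_natCast, ← Real.rpow_mul hμ0.le]
    norm_num
  have hr0 : 0 < r := Real.rpow_pos_of_pos hμ0 _
  have h6 : a₂ - (1 - μ) < r / 2 := by linarith
  have h7 : 0 < a₂ - (1 - μ) := by linarith [h₂.1]
  have h8 : (a₂ - (1 - μ)) ^ 3 < (r / 2) ^ 3 := by gcongr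
  have h9 := h₂.cube_le hμ0 hμ1
  have h10 : (r / 2) ^ 3 = μ / 8 := by rw [div_pow, hr3]; norm_num
  linarith


/-! ### The direction of the planet and the comparison of the two averages -/

/-- In the rotating frame a slow planet is seen in every direction. -/
theorem IsThreeBodySolution.exists_direction {μ δ : ℝ} {M : Motion}
    (H : IsThreeBodySolution μ δ M) (h0 : ∀ t, M.qP t ≠ 0)
    (hs : ∀ t, |cross (M.qP t) (M.vP t) / ‖M.qP t‖ ^ 2| + |M.thetaDot t| ≤ 1 / 20) {u : ℂ}
    (hu : u ≠ 0) :
    ∃ s, ‖u‖ * ‖M.qP s‖ / 2 ≤ inner ℝ u (M.toRotating s (M.qP s)) := by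
  -- The factor `e^(it)` compensates the mean rotation of the frame, so `W` turns with speed at most
  -- `1 / 20`.
  set W : ℝ → ℂ := fun t => conj (M.q1 t / (‖M.q1 t‖ : ℂ)) * (M.qP t / (‖M.qP t‖ : ℂ))
    * Complex.exp ((t : ℂ) * Complex.I) with hW
  have hn : ∀ z : ℂ, z ≠ 0 → ‖z / (‖z‖ : ℂ)‖ = 1 := fun z hz => by
    rw [norm_div, Complex.norm_real, norm_norm, div_self (norm_ne_zero_iff.2 hz)]
  have hnW : ∀ t, ‖W t‖ = 1 := fun t => by
    rw [hW]
    simp only [norm_mul, RCLike.norm_conj, hn _ (H.q1_ne_zero t), hn _ (h0 t),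
      Complex.norm_exp_ofReal_mul_I, mul_one]
  have hd : ∀ t, HasDerivAt W (Complex.I * W t *
      ((cross (M.qP t) (M.vP t) / ‖M.qP t‖ ^ 2 - M.thetaDot t : ℝ) : ℂ)) t := fun t => by
    have e1 : HasDerivAt (fun s : ℝ => Complex.exp ((s : ℂ) * Complex.I))
        (Complex.exp ((t : ℂ) * Complex.I) * (1 * Complex.I)) t :=
      ((Complex.ofRealCLM.hasDerivAt (x := t)).mul_const Complex.I).cexp
    have e2 := ((hasDerivAt_conj (hasDerivAt_unit (H.hasDerivAt_q1 t) (H.q1_ne_zero t))).mul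
      (hasDerivAt_unit (H.deriv_qP t) (h0 t))).mul e1
    refine e2.congr_deriv ?_
    simp only [hW, Motion.thetaDot, Pi.mul_apply, map_mul, Complex.conj_I, Complex.conj_ofReal]
    push_cast
    ring
  have hb : ∀ t, ‖Complex.I * W t *
      ((cross (M.qP t) (M.vP t) / ‖M.qP t‖ ^ 2 - M.thetaDot t : ℝ) : ℂ)‖ ≤ 1 / 20 := fun t => by
    rw [norm_mul, norm_mul, Complex.norm_I, hnW, one_mul, one_mul, Complex.norm_real]
    exact (abs_sub _ _).trans (hs t)
  have hlip : ∀ s, ‖W s - W 0‖ ≤ 1 / 20 * |s| := fun s => by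
    have := Convex.norm_image_sub_le_of_norm_hasDerivWithin_le
      (fun t _ => (hd t).hasDerivWithinAt) (fun t _ => hb t) convex_univ
      (Set.mem_univ (0 : ℝ)) (Set.mem_univ s)
    simpa using this
  set v := u / (‖u‖ : ℂ) with hv
  have nv : ‖v‖ = 1 := hn u hu
  have huc : (‖u‖ : ℂ) ≠ 0 := by exact_mod_cast norm_ne_zero_iff.2 hu
  have huv : u = (‖u‖ : ℂ) * v := by rw [hv]; field_simp
  -- If `W` were constant, the planet would be seen exactly in direction `v` at this time. Since
  -- `|s| ≤ π`, the true direction is off by at most `π/20 ≤ 1/5`.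
  set s := Complex.arg (W 0 * conj v) with hsdef
  have nWv : ‖W 0 * conj v‖ = 1 := by rw [norm_mul, RCLike.norm_conj, hnW, nv, one_mul]
  have hexp : Complex.exp ((s : ℂ) * Complex.I) = W 0 * conj v := by
    have := Complex.norm_mul_exp_arg_mul_I (W 0 * conj v)
    rwa [nWv, Complex.ofReal_one, one_mul] at this
  have hvv : v * conj v = 1 := by rw [mul_conj_self, nv]; norm_num
  refine ⟨s, ?_⟩
  have hQ : M.toRotating s (M.qP s) * Complex.exp ((s : ℂ) * Complex.I)
      = (‖M.qP s‖ : ℂ) * W s := by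
    have : (‖M.qP s‖ : ℂ) ≠ 0 := by exact_mod_cast norm_ne_zero_iff.2 (h0 s)
    simp only [hW, Motion.toRotating]
    field_simp
  set E := Complex.exp ((s : ℂ) * Complex.I) with hE
  have nE : ‖E‖ = 1 := Complex.norm_exp_ofReal_mul_I s
  have hEE : E * conj E = 1 := by rw [mul_conj_self, nE]; norm_num
  have hEv : v * E = W 0 := by
    rw [hexp]; linear_combination W 0 * hvv
  have hQ' : M.toRotating s (M.qP s) = (‖M.qP s‖ : ℂ) * (v + conj E * (W s - W 0)) := by
    linear_combination conj E * hQ - (M.toRotating s (M.qP s) - (‖M.qP s‖ : ℂ) * v) * hEE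
      - (‖M.qP s‖ : ℂ) * conj E * hEv
  have herr : ‖conj E * (W s - W 0)‖ ≤ 1 / 5 := by
    rw [norm_mul, RCLike.norm_conj, nE, one_mul]
    refine (hlip s).trans ?_
    have := Complex.abs_arg_le_pi (W 0 * conj v)
    have := Real.pi_lt_d2
    linarith
  have hin : 4 / 5 * ‖u‖ ≤ inner ℝ u (v + conj E * (W s - W 0)) := by
    rw [inner_add_right]
    have h1 : inner ℝ u v = ‖u‖ := by
      rw [real_inner_comm]
      nth_rewrite 1 [huv]
      rw [inner_real_mul_right, real_inner_self_eq_norm_sq, nv]; ring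
    have h2 := abs_le.1 (abs_real_inner_le_norm u (conj E * (W s - W 0)))
    have h3 : ‖u‖ * ‖conj E * (W s - W 0)‖ ≤ ‖u‖ * (1 / 5) := by gcongr
    linarith
  rw [hQ', inner_real_mul_right]
  have h4 := mul_le_mul_of_nonneg_left hin (norm_nonneg (M.qP s))
  have h5 : 0 ≤ ‖M.qP s‖ * ‖u‖ := by positivity
  linarith

/-- The conclusion about the averages for one `η`, with the data for the change of sign. -/
theorem exists_average_difference {μ T₁ T₂ C e₀ η : ℝ} {q₁ p₁ q₂ p₂ : ℝ → ℂ} {k : ℕ}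
    (hμ0 : 0 < μ) (hμ1 : μ < 1) (H₁ : IsPeriodicOrbit μ q₁ p₁ T₁)
    (H₂ : IsPeriodicOrbit μ q₂ p₂ T₂) (hC : 0 < C) (he₀ : 0 < e₀) (hk : 0 < k) (hη : 0 < η) :
    ∃ ε₀ : ℝ, 0 < ε₀ ∧ ∀ (m : ℕ) (ε δ eP T : ℝ) (M : Motion),
    0 < m → ε = (k : ℝ) / m → ε < ε₀ → 0 < δ → δ ≤ C * ε ^ 3 → e₀ ≤ eP → eP < 1 / 2 →
    IsBackgroundMotion μ δ k m C eP T M →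
    (∀ t, M.qP t ≠ 0) ∧
    (∀ t, |cross (M.qP t) (M.vP t) / ‖M.qP t‖ ^ 2| + |M.thetaDot t| ≤ 1 / 20) ∧
    ∀ ν : ℝ, |average μ δ ε M q₁ p₁ T₁ ν - average μ δ ε M q₂ p₂ T₂ ν
      - δ * inner ℝ (meanPos q₁ T₁ - meanPos q₂ T₂) (M.toRotating (ν / ε) (M.qP (ν / ε)))|
      ≤ η * (δ * ‖M.qP (ν / ε)‖) := by
  obtain ⟨K, hK, h₀, hh₀, hh₀1, bg⟩ := exists_background_estimates hμ0 hμ1 hC he₀ hk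
  obtain ⟨K₁, hK₁, d₁, hd₁, av₁⟩ := H₁.exists_average_estimate hμ0 hμ1
  obtain ⟨K₂, hK₂, d₂, hd₂, av₂⟩ := H₂.exists_average_estimate hμ0 hμ1
  set Z := 2 * K + (K + 7) ^ 2 * C + 1 with hZ
  have hZ0 : 0 < Z := by positivity
  set W := 1 / h₀ + 20 * (60 + K * C) + 6 * K₁ + 6 * K₂ + (K + 7) * C / d₁ + (K + 7) * C / d₂
    + 6 * ((K₁ + K₂) * Z) / η with hW
  have w1 : 0 < 1 / h₀ := by positivity
  have w2 : 0 < 20 * (60 + K * C) := by positivity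
  have w3 : 0 < (K + 7) * C / d₁ := by positivity
  have w4 : 0 < (K + 7) * C / d₂ := by positivity
  have w5 : 0 < 6 * ((K₁ + K₂) * Z) / η := by positivity
  have hW0 : 0 < W := by positivity
  refine ⟨(1 / W) ^ 3, by positivity, ?_⟩
  intro m ε δ eP T M hm hε hεlt hδ hδC he he' H
  have hm' : (0 : ℝ) < m := by exact_mod_cast hm
  have hk' : (0 : ℝ) < k := by exact_mod_cast hk
  have hε0 : 0 < ε := by rw [hε]; positivity
  obtain ⟨h, hh, hcube⟩ : ∃ h : ℝ, 0 < h ∧ h ^ 3 = ε := by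
    refine ⟨ε ^ (1 / 3 : ℝ), Real.rpow_pos_of_pos hε0 _, ?_⟩
    rw [← Real.rpow_natCast, ← Real.rpow_mul hε0.le]
    norm_num
  have hlt : h < 1 / W := by
    rw [← hcube] at hεlt
    exact lt_of_pow_lt_pow_left₀ 3 (by positivity) hεlt
  have hWh : W * h < 1 := by
    rw [lt_div_iff₀ hW0] at hlt
    linarith
  have hle : ∀ x, x ≤ W → x * h ≤ 1 := fun x hx => le_trans (by gcongr) hWh.le
  have s0 : h < h₀ := by
    have : 1 / h₀ * h < 1 := lt_of_le_of_lt (by gcongr; linarith) hWh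
    rwa [one_div_mul_eq_div, div_lt_one hh₀] at this
  have s1 := hle (20 * (60 + K * C)) (by linarith)
  have s2 := hle (6 * K₁) (by linarith)
  have s3 := hle (6 * K₂) (by linarith)
  have s4 := hle ((K + 7) * C / d₁) (by linarith)
  have s5 := hle ((K + 7) * C / d₂) (by linarith)
  have s6 := hle (6 * ((K₁ + K₂) * Z) / η) (by linarith)
  rw [div_mul_eq_mul_div, div_le_one hd₁] at s4
  rw [div_mul_eq_mul_div, div_le_one hd₂] at s5
  rw [div_mul_eq_mul_div, div_le_one hη] at s6
  have h1 : h ≤ 1 := by linarith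
  have hpow : ∀ n : ℕ, h ^ (n + 1) ≤ h := fun n => by
    calc h ^ (n + 1) = h * h ^ n := by ring
      _ ≤ h * 1 := by gcongr; exact pow_le_one₀ hh.le h1
      _ = h := mul_one h
  have hδ9 : δ ≤ C * h ^ 9 := by
    rw [← hcube] at hδC
    calc δ ≤ C * (h ^ 3) ^ 3 := hδC
      _ = _ := by ring
  have bounds := bg m δ eP T h M hm hh s0 (hcube.trans hε) hδ hδ9 he he' H
  have hδh : δ / h ≤ C * h := by
    rw [div_le_iff₀ hh]
    calc δ ≤ C * h ^ 9 := hδ9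
      _ = C * h ^ (7 + 1) * h := by ring
      _ ≤ C * h * h := by gcongr; exact hpow 7
  have hqP : ∀ t, 0 < ‖M.qP t‖ := fun t =>
    lt_of_lt_of_le (by positivity) (bounds t).1
  refine ⟨fun t => norm_pos_iff.1 (hqP t), fun t => ?_, fun ν => ?_⟩
  · obtain ⟨-, -, b3, -, b5⟩ := bounds t
    have h3 := hpow 2
    have : K * (δ / h) ≤ K * (C * h) := by gcongr
    norm_num at h3
    linarith
  · set τ := ν / ε with hτ
    obtain ⟨b1, b2, -, b4, b5⟩ := bounds τ
    have hp0 : 0 < δ / h := by positivity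
    have hδδ : δ ≤ δ / h := by
      rw [le_div_iff₀ hh]
      exact mul_le_of_le_one_right hδ.le h1
    have hδ2 : δ * ‖M.qP τ‖ ≤ 7 * (δ / h ^ 2) := by
      calc _ ≤ δ * (7 / h ^ 2) := by gcongr
        _ = _ := by ring
    have hδh2 : δ / h ≤ δ / h ^ 2 := by
      gcongr
      exact hpow 1
    have hsum : |M.r τ - 1| + δ * ‖M.qP τ‖ ≤ (K + 7) * (δ / h ^ 2) := by
      have : K * (δ / h) ≤ K * (δ / h ^ 2) := by gcongr
      linarith
    have hδh2' : δ / h ^ 2 ≤ C * h := by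
      rw [div_le_iff₀ (by positivity)]
      calc δ ≤ C * h ^ 9 := hδ9
        _ = C * h ^ (6 + 1) * h ^ 2 := by ring
        _ ≤ C * h * h ^ 2 := by gcongr; exact hpow 6
    have hsum' : |M.r τ - 1| + δ * ‖M.qP τ‖ ≤ (K + 7) * C * h := by
      calc _ ≤ (K + 7) * (δ / h ^ 2) := hsum
        _ ≤ (K + 7) * (C * h) := by gcongr
        _ = _ := by ring
    have hlarge : ∀ x, 6 * x * h ≤ 1 → x ≤ ‖M.qP τ‖ := fun x hx => by
      refine le_trans ?_ b1
      rw [le_div_iff₀ (by positivity)]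
      have : 0 ≤ h ^ 2 := by positivity
      rcases le_total x 0 with h2 | h2
      · exact (mul_nonpos_of_nonpos_of_nonneg h2 this).trans (by norm_num)
      · calc x * h ^ 2 ≤ x * h := by gcongr; exact hpow 1
          _ ≤ 1 / 6 := by linarith
    -- The assumption `δ ≤ C ε³ = C h⁹` is used here: it makes the square of `δ/h²` at most a
    -- multiple of `δ`.
    have hsq : (|M.r τ - 1| + δ * ‖M.qP τ‖) ^ 2 ≤ (K + 7) ^ 2 * C * δ := by
      have hn : 0 ≤ |M.r τ - 1| + δ * ‖M.qP τ‖ := by positivity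
      calc _ ≤ ((K + 7) * (δ / h ^ 2)) ^ 2 := by gcongr
        _ = (K + 7) ^ 2 * (δ / h ^ 4) * δ := by field_simp
        _ ≤ (K + 7) ^ 2 * C * δ := by
          gcongr
          rw [div_le_iff₀ (by positivity)]
          calc δ ≤ C * h ^ 9 := hδ9
            _ = C * h ^ 4 * h ^ 5 := by ring
            _ ≤ C * h ^ 4 * 1 := by gcongr; exact pow_le_one₀ hh.le h1
            _ = _ := mul_one _
    have htot : |M.thetaDot τ| + |M.r τ - 1| + (|M.r τ - 1| + δ * ‖M.qP τ‖) ^ 2 + δ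
        ≤ Z * (δ / h) := by
      have : (K + 7) ^ 2 * C * δ ≤ (K + 7) ^ 2 * C * (δ / h) := by gcongr
      rw [hZ]
      linarith
    have HM := H.toIsThreeBodySolution
    have a1 := av₁ δ ε ν M HM hδ (hsum'.trans s4) (hlarge _ s2)
    have a2 := av₂ δ ε ν M HM hδ (hsum'.trans s5) (hlarge _ s3)
    rw [← hτ] at a1 a2
    set Q := M.toRotating τ (M.qP τ) with hQ
    have e : δ * inner ℝ (meanPos q₁ T₁ - meanPos q₂ T₂) Q
        = inner ℝ ((δ : ℂ) * Q) (meanPos q₁ T₁) - inner ℝ ((δ : ℂ) * Q) (meanPos q₂ T₂) := by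
      rw [← inner_sub_right, real_inner_comm, ← Complex.real_smul, real_inner_smul_left]
    have a3 := abs_le.1 (a1.trans (mul_le_mul_of_nonneg_left htot hK₁.le))
    have a4 := abs_le.1 (a2.trans (mul_le_mul_of_nonneg_left htot hK₂.le))
    -- The error is of order `δ/h`, while `|q_P| ≥ 1/(6h²)`; the spare factor `h` beats `η`.
    have a5 : (K₁ + K₂) * Z * (δ / h) ≤ η * (δ * ‖M.qP τ‖) := by
      calc (K₁ + K₂) * Z * (δ / h) = 6 * ((K₁ + K₂) * Z) * h * (δ * (1 / 6 / h ^ 2)) := by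
            field_simp
        _ ≤ η * (δ * ‖M.qP τ‖) := by gcongr
    rw [e, abs_le]
    constructor <;> linarith

end FourBody

theorem lemma5p1 :
    ∃ μ₀ : ℝ, 0 < μ₀ ∧ ∃ κ : ℝ, 0 < κ ∧
    ∀ μ : ℝ, 0 < μ → μ < μ₀ →
    ∀ a₁ a₂ : ℝ, FourBody.IsL1 μ a₁ → FourBody.IsL2 μ a₂ →
    ∀ (q₁ p₁ q₂ p₂ : ℝ → ℂ) (T₁ T₂ : ℝ),
      FourBody.IsLyapunovOrbit μ a₁ q₁ p₁ T₁ → FourBody.IsLyapunovOrbit μ a₂ q₂ p₂ T₂ →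
      Metric.diam (Set.range q₁) < κ * μ ^ (1 / 3 : ℝ) →
      Metric.diam (Set.range q₂) < κ * μ ^ (1 / 3 : ℝ) →
    ∃ u : ℂ, u ≠ 0 ∧
    ∀ k : ℕ, 0 < k → ∀ C : ℝ, 0 < C → ∀ e₀ : ℝ, 0 < e₀ → ∀ η : ℝ, 0 < η →
    ∃ ε₀ : ℝ, 0 < ε₀ ∧
    ∀ (m : ℕ) (ε δ eP T : ℝ) (M : FourBody.Motion),
      0 < m → ε = (k : ℝ) / m → ε < ε₀ → 0 < δ → δ ≤ C * ε ^ 3 →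
      e₀ ≤ eP → eP < 1 / 2 →
      FourBody.IsBackgroundMotion μ δ k m C eP T M →
      (¬ ∃ c : ℝ, ∀ ν : ℝ,
        FourBody.average μ δ ε M q₁ p₁ T₁ ν - FourBody.average μ δ ε M q₂ p₂ T₂ ν = c) ∧
      (∀ ν : ℝ,
        |FourBody.average μ δ ε M q₁ p₁ T₁ ν - FourBody.average μ δ ε M q₂ p₂ T₂ ν
          - δ * inner ℝ u (M.toRotating (ν / ε) (M.qP (ν / ε)))|
        ≤ η * (δ * ‖M.qP (ν / ε)‖)) := by
  -- No smallness of `μ` beyond `μ < 1` is needed. With `κ = 1/4` the two diameters add up to less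
  -- than `μ^(1/3) / 2`.
  refine ⟨1, one_pos, 1 / 4, by norm_num, ?_⟩
  intro μ hμ0 hμ1 a₁ a₂ hL₁ hL₂ q₁ p₁ q₂ p₂ T₁ T₂ H₁ H₂ hd₁ hd₂
  have hu := FourBody.meanPos_sub_ne_zero hμ0 hμ1 hL₁ hL₂ H₁ H₂ hd₁ hd₂
  refine ⟨FourBody.meanPos q₁ T₁ - FourBody.meanPos q₂ T₂, hu, ?_⟩
  set u := FourBody.meanPos q₁ T₁ - FourBody.meanPos q₂ T₂ with hudef
  intro k hk C hC e₀ he₀ η hη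
  have hu0 : 0 < ‖u‖ := norm_pos_iff.2 hu
  obtain ⟨ε₁, hε₁, h₁⟩ := FourBody.exists_average_difference hμ0 hμ1 H₁.toIsPeriodicOrbit
    H₂.toIsPeriodicOrbit hC he₀ hk hη
  -- A second use with tolerance `‖u‖ / 4`, half of the size `‖u‖ |q_P| / 2` that `exists_direction`
  -- guarantees in the directions `u` and `-u`. The difference of averages is thus positive at one
  -- time and negative at another.
  obtain ⟨ε₂, hε₂, h₂⟩ := FourBody.exists_average_difference hμ0 hμ1 H₁.toIsPeriodicOrbit
    H₂.toIsPeriodicOrbit hC he₀ hk (by positivity : 0 < ‖u‖ / 4)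
  refine ⟨min ε₁ ε₂, lt_min hε₁ hε₂, ?_⟩
  intro m ε δ eP T M hm hε hlt hδ hδC he he' H
  refine ⟨?_, (h₁ m ε δ eP T M hm hε (hlt.trans_le (min_le_left _ _)) hδ hδC he he' H).2.2⟩
  rintro ⟨c, hc⟩
  obtain ⟨hP, hslow, hav⟩ :=
    h₂ m ε δ eP T M hm hε (hlt.trans_le (min_le_right _ _)) hδ hδC he he' H
  have hε0 : ε ≠ 0 := by
    have : (0 : ℝ) < m := by exact_mod_cast hm
    have : (0 : ℝ) < k := by exact_mod_cast hk
    rw [hε]; positivity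
  have hsol := H.toIsThreeBodySolution
  obtain ⟨s, hs⟩ := hsol.exists_direction hP hslow hu
  obtain ⟨s', hs'⟩ := hsol.exists_direction hP hslow (neg_ne_zero.2 hu)
  rw [norm_neg, inner_neg_left] at hs'
  have b := hav (ε * s)
  have b' := hav (ε * s')
  rw [hc, mul_div_cancel_left₀ _ hε0] at b b'
  rw [← hudef] at b b'
  have n : 0 < ‖u‖ * (δ * ‖M.qP s‖) := by
    have := norm_pos_iff.2 (hP s)
    positivity
  have n' : 0 < ‖u‖ * (δ * ‖M.qP s'‖) := by
    have := norm_pos_iff.2 (hP s')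
    positivity
  have i := mul_le_mul_of_nonneg_left hs hδ.le
  have i' := mul_le_mul_of_nonneg_left hs' hδ.le
  have j := abs_le.1 b
  have j' := abs_le.1 b'
  linarith
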